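/- **Cubical sets with connections.** Let $\mathbf 1=\{0<1\}$, and let $\square_c$ be the category whose objects are the posets $\mathbf 1^n$, $n\ge 0$, and whose morphisms are the monotone maps generated under composition by the co-faces $\mathbf 1^n\to\mathbf 1^{n+1}$, which insert $\varepsilon\in\{0,1\}$ at position $j$ ($1\le j\le n+1$), the co-degeneracies $\mathbf 1^{n+1}\to\mathbf 1^{n}$, which forget the $j$-th coordinate ($1\le j\le n+1$), and the co-connections $\mathbf 1^{n+1}\to\mathbf 1^{n}$, $(s_1,\dots,s_{n+1})\mapsto(s_1,\dots,s_{j-1},\max(s_j,s_{j+1}),s_{j+2},\dots,s_{n+1})$ ($1\le j\le n$). The category $Set_{\square_c}$ of presheaves of sets on $\square_c$ is monoidal for $K\otimes L=\operatorname{colim}_{\square_c^m\to K,\ \square_c^n\to L}\square_c^{m+n}$, where $\square_c^n$ is the presheaf represented by $\mathbf 1^n$. Let $Cat_{\square_c}$ be the category of small categories enriched over $(Set_{\square_c},\otimes)$ and enriched functors, and $Cat_\Delta$ the category of small categories enriched over $(Set_\Delta,\times)$ (simplicial categories) and simplicial functors. **Necklaces.** A necklace is a simplicial set $T=\Delta^{n_1}\vee\dots\vee\Delta^{n_k}$,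 in which the last vertex of each bead $\Delta^{n_i}$ is glued to the first vertex of $\Delta^{n_{i+1}}$, with all $n_i\ge 1$, or $T=\Delta^0$. Its vertices are ordered, with first vertex $\alpha_T$ and last vertex $\omega_T$; $V_T$ is the set of vertices, and $J_T\subseteq V_T$ is the set of joints, that is, of the first and last vertices of the beads ($J_T=V_T$ if $T=\Delta^0$). The category $Nec$ has the necklaces as objects and the maps of simplicial sets preserving first and last vertices as morphisms. Let $P(T)$ be the poset of all $X$ with $J_T\subseteq X\subseteq V_T$, ordered by inclusion. Listing $V_T\setminus J_T$ in increasing order identifies $P(T)$ with $\mathbf 1^{N}$, $N=|V_T\setminus J_T|$, and under these identifications the maps $X\mapsto f(X)$, for $f:T\to T'$ in $Nec$, are morphisms of $\square_c$. Composing the resulting functor $Nec\to\square_c$ with the Yoneda embedding gives a functor $C_{\square_c}:Nec\to Set_{\square_c}$, $C_{\square_c}(T)=\square_c^{|V_T\setminus J_T|}$. **Cubical rigidification.** For a simplicial set $S$, let $\mathfrak C_{\square_c}(S)\in Cat_{\square_c}$ have the vertices of $S$ as objects and the mapping objects $$\mathfrak C_{\square_c}(S)(x,y)=\operatorname*{colim}_{T\to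 S\,\in\,(Nec\downarrow S)_{x,y}}C_{\square_c}(T),$$ where $(Nec\downarrow S)_{x,y}$ is the category of necklaces $T$ with a map $t:T\to S$ such that $t(\alpha_T)=x$ and $t(\omega_T)=y$. The composition $\mathfrak C_{\square_c}(S)(x,y)\otimes\mathfrak C_{\square_c}(S)(y,z)\to\mathfrak C_{\square_c}(S)(x,z)$ is induced by concatenation, $(T\to S,\ U\to S)\mapsto(T\vee U\to S)$, and by the isomorphisms $C_{\square_c}(T)\otimes C_{\square_c}(U)\cong C_{\square_c}(T\vee U)$ given by $(X,Y)\mapsto X\cup Y$; the identity of $x$ is given by the constant necklace $\Delta^0\to S$ at $x$. This is functorial in $S$ and defines $\mathfrak C_{\square_c}:Set_\Delta\to Cat_{\square_c}$. **Triangulation.** For $K\in Set_{\square_c}$ put $|K|=\operatorname{colim}_{\square_c^n\to K}N(\mathbf 1^n)\in Set_\Delta$, where $N$ is the nerve. There are canonical natural isomorphisms $|K|\times|L|\cong|K\otimes L|$, induced by $N(\mathbf 1^m)\times N(\mathbf 1^n)\cong N(\mathbf 1^{m+n})$. The functor $\mathfrak T:Cat_{\square_c}\to Cat_\Delta$ keeps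 the objects of $\mathcal K$ and replaces each $\mathcal K(x,y)$ by $|\mathcal K(x,y)|$, with the composition $|\mathcal K(x,y)|\times|\mathcal K(y,z)|\cong|\mathcal K(x,y)\otimes\mathcal K(y,z)|\to|\mathcal K(x,z)|$. **Lurie's rigidification.** Let $\mathfrak C(\Delta^n)$ be the simplicial category with objects $0,\dots,n$, in which the mapping space from $i$ to $j$ is the nerve of the poset, ordered by inclusion, of the subsets of $\{i,i+1,\dots,j\}$ that contain $i$ and $j$ if $i\le j$, and is empty if $j<i$, and in which composition is induced by union. It is functorial in $\Delta^n$ by taking images of subsets. Put $\mathfrak C(S)=\operatorname{colim}_{\Delta^n\to S}\mathfrak C(\Delta^n)$, a colimit in $Cat_\Delta$; this defines $\mathfrak C:Set_\Delta\to Cat_\Delta$. **Proposition.** The functor $\mathfrak C:Set_\Delta\to Cat_\Delta$ is naturally isomorphic to the composition $$Set_\Delta\xrightarrow{\ \mathfrak C_{\square_c}\ }Cat_{\square_c}\xrightarrow{\ \mathfrak T\ }Cat_\Delta .$$ -/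

import Mathlib

universe u v w v' w'

namespace CubicalRigidification

open CategoryTheory MonoidalCategory Limits Opposite

/-! ### Cubes -/

/-- The poset `𝟏ⁿ`, the `n`-fold power of `𝟏 = {0 < 1}`. -/
abbrev Cube (n : ℕ) : Type := Fin n → Bool

/-- Co-face: insert the constant `ε` at position `j`. -/
def coface {n : ℕ} (j : Fin (n + 1)) (ε : Bool) : Cube n →o Cube (n + 1) where
  toFun s := Fin.insertNth (α := fun _ => Bool) j ε s
  monotone' s t h i := by
    rcases Fin.eq_self_or_eq_succAbove j i with rfl | ⟨k, rfl⟩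
    · simp
    · simpa using h k

/-- Co-degeneracy: forget the coordinate at position `j`. -/
def codegeneracy {n : ℕ} (j : Fin (n + 1)) : Cube (n + 1) →o Cube n where
  toFun s i := s (j.succAbove i)
  monotone' _ _ h i := h (j.succAbove i)

/-- Co-connection: replace the coordinates at the consecutive positions `j`, `j + 1` by their
maximum. -/
def coconnection {n : ℕ} (j : Fin (n + 1)) : Cube (n + 2) →o Cube (n + 1) where
  toFun s i :=
    if i < j then s i.castSucc else if i = j then max (s j.castSucc) (s j.succ) else s i.succ
  monotone' s t h i := by
    dsimp only
    split_ifs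
    · exact h _
    · exact max_le_max (h _) (h _)
    · exact h _

/-- The monotone maps `𝟏ᵐ → 𝟏ⁿ` (that is, the functors) generated under composition by co-faces,
co-degeneracies and co-connections. -/
inductive IsCubical : ∀ {m n : ℕ}, (Cube m →o Cube n) → Prop
  | id (n : ℕ) : IsCubical (OrderHom.id : Cube n →o Cube n)
  | coface {n : ℕ} (j : Fin (n + 1)) (ε : Bool) : IsCubical (coface j ε)
  | codegeneracy {n : ℕ} (j : Fin (n + 1)) : IsCubical (codegeneracy j)
  | coconnection {n : ℕ} (j : Fin (n + 1)) : IsCubical (coconnection j)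
  | comp {l m n : ℕ} {f : Cube l →o Cube m} {g : Cube m →o Cube n} :
      IsCubical f → IsCubical g → IsCubical (g.comp f)

@[simp] theorem coface_same {n : ℕ} (j : Fin (n + 1)) (ε : Bool) (s : Cube n) :
    coface j ε s j = ε := Fin.insertNth_apply_same (α := fun _ => Bool) j ε s

@[simp] theorem coface_succAbove {n : ℕ} (j : Fin (n + 1)) (ε : Bool) (s : Cube n) (i : Fin n) :
    coface j ε s (j.succAbove i) = s i := Fin.insertNth_apply_succAbove (α := fun _ => Bool) j ε s i

@[simp] theorem codegeneracy_apply {n : ℕ} (j : Fin (n + 1)) (s : Cube (n + 1)) (i : Fin n) :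
    codegeneracy j s i = s (j.succAbove i) := rfl

theorem coconnection_apply {n : ℕ} (j : Fin (n + 1)) (s : Cube (n + 2)) (i : Fin (n + 1)) :
    coconnection j s i = if i < j then s i.castSucc else
      if i = j then max (s j.castSucc) (s j.succ) else s i.succ := rfl

/-- Every coordinate of `g` is either constantly `1` or the maximum of a set of coordinates of the
argument, where these sets are disjoint and ordered as the coordinates are. -/
def HasMaxForm {m n : ℕ} (g : Cube m →o Cube n) : Prop :=
  ∃ (R : Fin m → Fin n → Prop) (c : Fin n → Bool),
    (∀ k k' i i', k ≤ k' → R k i → R k' i' → i ≤ i') ∧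
    ∀ s i, g s i = true ↔ (c i = true ∨ ∃ k, R k i ∧ s k = true)

theorem isCubical_of_hasMaxForm : ∀ (d m n : ℕ), m + n = d → ∀ (g : Cube m →o Cube n),
    HasMaxForm g → IsCubical g := by
  intro d
  induction d using Nat.strong_induction_on with
  | _ d ih =>
  intro m n hd g hg
  obtain ⟨R, c, hR, hg⟩ := hg
  by_cases h1 : ∃ k, ∀ i, ¬ R k i
  · obtain ⟨k, hk⟩ := h1
    obtain _ | m := m
    · exact k.elim0
    have key : g = (g.comp (coface k false)).comp
        (codegeneracy k) := by
      ext s i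
      rw [Bool.eq_iff_iff, hg]
      simp only [OrderHom.comp_coe, Function.comp_apply, hg]
      refine or_congr Iff.rfl (exists_congr fun a => ?_)
      rcases Fin.eq_self_or_eq_succAbove k a with rfl | ⟨b, rfl⟩
      · simp [hk]
      · simp
    rw [key]
    refine IsCubical.comp (.codegeneracy k) (ih (m + n) (by omega) _ _ rfl _ ?_)
    refine ⟨fun a i => R (k.succAbove a) i, c, fun a a' i i' h => hR _ _ _ _ (by simpa using h), ?_⟩
    intro s i
    simp only [OrderHom.comp_coe, Function.comp_apply, hg]
    refine or_congr Iff.rfl ⟨?_, ?_⟩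
    · rintro ⟨a, ha, hs⟩
      rcases Fin.eq_self_or_eq_succAbove k a with rfl | ⟨b, rfl⟩
      · exact absurd ha (hk _)
      · exact ⟨b, ha, by simpa using hs⟩
    · rintro ⟨b, hb, hs⟩
      exact ⟨_, hb, by simpa using hs⟩
  by_cases h2 : ∃ i, c i = true ∨ ∀ k, ¬ R k i
  · obtain ⟨i, hi⟩ := h2
    obtain _ | n := n
    · exact i.elim0
    have key : g = (coface i (c i)).comp
        ((codegeneracy i).comp g) := by
      ext s a
      rcases Fin.eq_self_or_eq_succAbove i a with rfl | ⟨b, rfl⟩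
      · rw [Bool.eq_iff_iff, hg]
        rcases hi with hi | hi <;>
          simp [hi]
      · simp
    rw [key]
    refine IsCubical.comp (ih (m + n) (by omega) _ _ rfl _ ?_) (.coface i _)
    refine ⟨fun k a => R k (i.succAbove a), fun a => c (i.succAbove a), ?_, ?_⟩
    · intro k k' a a' h h1 h2
      simpa using hR _ _ _ _ h h1 h2
    · intro s a
      exact hg s (i.succAbove a)
  push Not at h1 h2
  by_cases h3 : ∀ k k' i, R k i → R k' i → k = k'
  · choose θ hθ using h1
    have hmono : StrictMono θ := by
      intro k k' h
      refine lt_of_le_of_ne (hR _ _ _ _ h.le (hθ k) (hθ k')) fun he => ?_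
      exact h.ne (h3 _ _ _ (hθ k) (he ▸ hθ k'))
    have hsurj : Function.Surjective θ := fun i => by
      obtain ⟨k, hk⟩ := (h2 i).2
      exact ⟨k, le_antisymm (hR _ _ _ _ le_rfl (hθ k) hk) (hR _ _ _ _ le_rfl hk (hθ k))⟩
    have hmn : m = n := by
      simpa using Fintype.card_of_bijective ⟨hmono.injective, hsurj⟩
    subst hmn
    have hid : ∀ k, θ k = k := fun k => by
      have := Subsingleton.elim (hmono.orderIsoOfSurjective θ hsurj) (OrderIso.refl (Fin m))
      exact congrArg (fun e : Fin m ≃o Fin m => e k) this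
    have key : g = OrderHom.id := by
      ext s i
      rw [Bool.eq_iff_iff, hg]
      constructor
      · rintro (h | ⟨k, hk, hs⟩)
        · exact absurd h (h2 i).1
        · rwa [h3 _ _ _ hk (by simpa [hid] using hθ i)] at hs
      · intro hs
        exact Or.inr ⟨i, by simpa [hid] using hθ i, hs⟩
    rw [key]
    exact .id _
  · push Not at h3
    have h3' : ∃ k k' i, R k i ∧ R k' i ∧ k < k' := by
      obtain ⟨k, k', i, hk, hk', hne⟩ := h3
      rcases lt_or_gt_of_ne hne with h | h
      · exact ⟨k, k', i, hk, hk', h⟩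
      · exact ⟨k', k, i, hk', hk, h⟩
    obtain ⟨k, k', i, hk, hk', hlt⟩ := h3'
    obtain _ | _ | m := m
    · exact k.elim0
    · exact absurd hlt (by omega)
    obtain ⟨k, rfl⟩ : ∃ l : Fin (m + 1), k = l.castSucc :=
      ⟨k.castLT (by omega), by simp⟩
    have hks : R k.succ i := by
      obtain ⟨i', hi'⟩ := h1 k.succ
      have a1 := hR _ _ _ _ (Fin.castSucc_lt_succ (i := k)).le hk hi'
      have a2 := hR _ _ _ _ (Fin.le_def.2 (by simpa [Fin.lt_def] using hlt)) hi' hk'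
      rwa [le_antisymm a1 a2]
    have key : g = (g.comp (coface k.castSucc false)).comp
        (coconnection k) := by
      ext s a
      rw [Bool.eq_iff_iff, hg]
      simp only [OrderHom.comp_coe, Function.comp_apply, hg]
      refine or_congr Iff.rfl ⟨?_, ?_⟩
      · rintro ⟨b, hb, hs⟩
        by_cases hbk : b = k.castSucc ∨ b = k.succ
        · have : a = i := by
            rcases hbk with rfl | rfl
            · exact le_antisymm (hR _ _ _ _ le_rfl hb hk) (hR _ _ _ _ le_rfl hk hb)
            · exact le_antisymm (hR _ _ _ _ le_rfl hb hks) (hR _ _ _ _ le_rfl hks hb)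
          subst this
          refine ⟨k.succ, hks, ?_⟩
          have e : k.succ = k.castSucc.succAbove k := by simp
          rw [e]
          simp only [coface_succAbove]
          rcases hbk with rfl | rfl <;> simp [coconnection_apply, hs]
        · push Not at hbk
          refine ⟨b, hb, ?_⟩
          rcases Fin.eq_self_or_eq_succAbove k.castSucc b with rfl | ⟨b, rfl⟩
          · exact absurd rfl hbk.1
          · simp only [coface_succAbove, coconnection_apply]
            rcases lt_trichotomy b k with h | h | h
            · rw [Fin.succAbove_of_castSucc_lt _ _ (by simpa using h)] at hs
              simp [h, hs]
            · subst h
              simp at hbk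
            · rw [Fin.succAbove_of_le_castSucc _ _ (by simpa using h.le)] at hs
              simp [h.not_gt, h.ne', hs]
      · rintro ⟨b, hb, hs⟩
        rcases Fin.eq_self_or_eq_succAbove k.castSucc b with rfl | ⟨b, rfl⟩
        · simp at hs
        · simp only [coface_succAbove, coconnection_apply] at hs
          rcases lt_trichotomy b k with h | h | h
          · rw [Fin.succAbove_of_castSucc_lt _ _ (by simpa using h)] at hb
            simp only [h, if_true] at hs
            exact ⟨_, hb, hs⟩
          · subst h
            have : a = i := by
              rw [Fin.succAbove_castSucc_self] at hb
              exact le_antisymm (hR _ _ _ _ le_rfl hb hks) (hR _ _ _ _ le_rfl hks hb)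
            subst this
            simp only [lt_irrefl, if_false, if_true] at hs
            rcases (by simpa using hs : s b.castSucc = true ∨ s b.succ = true) with h | h
            · exact ⟨_, hk, h⟩
            · exact ⟨_, hks, h⟩
          · rw [Fin.succAbove_of_le_castSucc _ _ (by simpa using h.le)] at hb
            simp only [h.not_gt, h.ne', if_false] at hs
            exact ⟨_, hb, hs⟩
    rw [key]
    refine IsCubical.comp (.coconnection k) (ih (m + 1 + n) (by omega) _ _ rfl _ ?_)
    refine ⟨fun a i => R (k.castSucc.succAbove a) i, c,
      fun a a' i i' h => hR _ _ _ _ (by simpa using h), ?_⟩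
    intro s a
    simp only [OrderHom.comp_coe, Function.comp_apply, hg]
    refine or_congr Iff.rfl ⟨?_, ?_⟩
    · rintro ⟨b, hb, hs⟩
      rcases Fin.eq_self_or_eq_succAbove k.castSucc b with rfl | ⟨b, rfl⟩
      · simp at hs
      · exact ⟨b, hb, by simpa using hs⟩
    · rintro ⟨b, hb, hs⟩
      exact ⟨_, hb, by simpa using hs⟩

theorem HasMaxForm.isCubical {m n : ℕ} {g : Cube m →o Cube n} (h : HasMaxForm g) : IsCubical g :=
  isCubical_of_hasMaxForm _ _ _ rfl g h

theorem IsCubical.hasMaxForm {m n : ℕ} {g : Cube m →o Cube n} (h : IsCubical g) :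
    HasMaxForm g := by
  induction h with
  | id n =>
    refine ⟨fun k i => k = i, fun _ => false, ?_, ?_⟩
    · rintro k k' _ _ h rfl rfl
      exact h
    · intro s i
      simp
  | @coface n j ε =>
    refine ⟨fun k i => i = j.succAbove k, fun i => decide (i = j) && ε, ?_, ?_⟩
    · rintro k k' _ _ h rfl rfl
      simpa using h
    · intro s i
      rcases Fin.eq_self_or_eq_succAbove j i with rfl | ⟨b, rfl⟩
      · simp [(Fin.succAbove_ne _ _).symm]
      · simp [(Fin.succAbove_ne _ _)]
  | @codegeneracy n j =>
    refine ⟨fun k i => k = j.succAbove i, fun _ => false, ?_, ?_⟩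
    · rintro _ _ i i' h rfl rfl
      simpa using h
    · intro s i
      simp
  | @coconnection n j =>
    refine ⟨fun k i => i = j.predAbove k, fun _ => false, ?_, ?_⟩
    · rintro k k' _ _ h rfl rfl
      exact Fin.predAbove_right_monotone j h
    · intro s i
      have hpred : ∀ k : Fin (n + 2), i = j.predAbove k ↔
          (i < j ∧ k = i.castSucc) ∨ (i = j ∧ (k = j.castSucc ∨ k = j.succ)) ∨
            (j < i ∧ k = i.succ) := by
        intro k
        simp only [Fin.predAbove, Fin.ext_iff, Fin.lt_def]
        split_ifs with hk <;> simp only [Fin.val_castSucc, Fin.val_succ, Fin.val_pred,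
          Fin.coe_castPred] at hk ⊢ <;> omega
      simp only [hpred, coconnection_apply]
      rcases lt_trichotomy i j with h | h | h
      · simp [h, h.ne, h.not_gt]
      · subst h
        simp [or_and_right, exists_or]
      · simp [h, h.ne', h.not_gt]
  | @comp l m n f g _ _ hf hg =>
    obtain ⟨R, c, hR, hf⟩ := hf
    obtain ⟨S, d, hS, hg⟩ := hg
    classical
    refine ⟨fun k i => ∃ a, R k a ∧ S a i, fun i => decide (d i = true ∨ ∃ a, S a i ∧ c a = true),
      ?_, ?_⟩
    · rintro k k' i i' h ⟨a, ha, ha'⟩ ⟨b, hb, hb'⟩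
      exact hS _ _ _ _ (hR _ _ _ _ h ha hb) ha' hb'
    · intro s i
      simp only [OrderHom.comp_coe, Function.comp_apply, hg, hf, decide_eq_true_eq]
      constructor
      · rintro (h | ⟨a, h, h' | ⟨b, hb, hs⟩⟩)
        exacts [Or.inl (Or.inl h), Or.inl (Or.inr ⟨a, h, h'⟩), Or.inr ⟨b, ⟨a, hb, h⟩, hs⟩]
      · rintro ((h | ⟨a, h, h'⟩) | ⟨b, ⟨a, hb, h⟩, hs⟩)
        exacts [Or.inl h, Or.inr ⟨a, h, Or.inl h'⟩, Or.inr ⟨a, h, Or.inr ⟨b, hb, hs⟩⟩]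

/-- The product of two maps of cubes, under `𝟏ᵐ × 𝟏ᵖ = 𝟏ᵐ⁺ᵖ`. -/
def tensorMap {m n p q : ℕ} (f : Cube m →o Cube n) (g : Cube p →o Cube q) :
    Cube (m + p) →o Cube (n + q) where
  toFun s := Fin.append (f fun i => s (i.castAdd p)) (g fun i => s (i.natAdd m))
  monotone' s t h i := by
    refine Fin.addCases (fun a => ?_) (fun a => ?_) i
    · dsimp only
      rw [Fin.append_left, Fin.append_left]
      exact f.monotone (show (fun i => s (i.castAdd p)) ≤ fun i => t (i.castAdd p) from
        fun i => h (i.castAdd p)) a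
    · dsimp only
      rw [Fin.append_right, Fin.append_right]
      exact g.monotone (show (fun i => s (i.natAdd m)) ≤ fun i => t (i.natAdd m) from
        fun i => h (i.natAdd m)) a

@[simp] theorem tensorMap_castAdd {m n p q : ℕ} (f : Cube m →o Cube n) (g : Cube p →o Cube q)
    (s : Cube (m + p)) (i : Fin n) :
    tensorMap f g s (i.castAdd q) = f (fun i => s (i.castAdd p)) i :=
  Fin.append_left _ _ i

@[simp] theorem tensorMap_natAdd {m n p q : ℕ} (f : Cube m →o Cube n) (g : Cube p →o Cube q)
    (s : Cube (m + p)) (i : Fin q) :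
    tensorMap f g s (i.natAdd n) = g (fun i => s (i.natAdd m)) i :=
  Fin.append_right _ _ i

theorem IsCubical.tensorMap {m n p q : ℕ} {f : Cube m →o Cube n} {g : Cube p →o Cube q}
    (hf : IsCubical f) (hg : IsCubical g) : IsCubical (tensorMap f g) := by
  obtain ⟨R, c, hR, hf⟩ := hf.hasMaxForm
  obtain ⟨S, d, hS, hg⟩ := hg.hasMaxForm
  refine HasMaxForm.isCubical ⟨fun k i => (∃ a b, k = Fin.castAdd p a ∧ i = Fin.castAdd q b ∧ R a b) ∨
    (∃ a b, k = Fin.natAdd m a ∧ i = Fin.natAdd n b ∧ S a b), Fin.append c d, ?_, ?_⟩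
  · rintro k k' i i' h (⟨a, b, rfl, rfl, h1⟩ | ⟨a, b, rfl, rfl, h1⟩)
      (⟨a', b', rfl, rfl, h2⟩ | ⟨a', b', rfl, rfl, h2⟩)
    · exact hR a a' b b' h h1 h2
    · exact Fin.le_def.2 (b.isLt.le.trans (Nat.le_add_right _ _))
    · exact absurd (Fin.le_def.1 h) (not_le.2 (a'.isLt.trans_le (Nat.le_add_right _ _)))
    · exact Nat.add_le_add_left (hS a a' b b' (Nat.le_of_add_le_add_left h) h1 h2) n
  · intro s i
    refine Fin.addCases (fun a => ?_) (fun a => ?_) i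
    · simp only [tensorMap_castAdd, hf, Fin.append_left]
      refine or_congr Iff.rfl ⟨?_, ?_⟩
      · rintro ⟨k, hk, hs⟩
        exact ⟨_, Or.inl ⟨k, a, rfl, rfl, hk⟩, hs⟩
      · rintro ⟨_, (⟨k, b, rfl, h, hk⟩ | ⟨k, b, rfl, h, hk⟩), hs⟩
        · exact ⟨k, by rwa [(Fin.castAdd_injective _ _).eq_iff.1 h], hs⟩
        · simp [Fin.ext_iff] at h; omega
    · simp only [tensorMap_natAdd, hg, Fin.append_right]
      refine or_congr Iff.rfl ⟨?_, ?_⟩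
      · rintro ⟨k, hk, hs⟩
        exact ⟨_, Or.inr ⟨k, a, rfl, rfl, hk⟩, hs⟩
      · rintro ⟨_, (⟨k, b, rfl, h, hk⟩ | ⟨k, b, rfl, h, hk⟩), hs⟩
        · simp [Fin.ext_iff] at h; omega
        · exact ⟨k, by rwa [(Fin.natAdd_injective _ _).eq_iff.1 h], hs⟩

/-- The identification `𝟏ᵐ = 𝟏ⁿ` for `m = n`. -/
def castMap {m n : ℕ} (h : m = n) : Cube m →o Cube n where
  toFun s i := s (i.cast h.symm)
  monotone' _ _ h' _ := h' _

@[simp] theorem castMap_apply {m n : ℕ} (h : m = n) (s : Cube m) (i : Fin n) :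
    castMap h s i = s (i.cast h.symm) := rfl

theorem IsCubical.castMap {m n : ℕ} (h : m = n) : IsCubical (castMap h) := by
  subst h
  exact .id _

theorem tensorMap_ext {l m n : ℕ} {f g : Cube l →o Cube (m + n)}
    (h₁ : ∀ s (i : Fin m), f s (i.castAdd n) = g s (i.castAdd n))
    (h₂ : ∀ s (i : Fin n), f s (i.natAdd m) = g s (i.natAdd m)) : f = g := by
  ext s i
  exact Fin.addCases (h₁ s) (h₂ s) i

theorem tensorMap_id (m n : ℕ) :
    tensorMap (OrderHom.id : Cube m →o Cube m) (OrderHom.id : Cube n →o Cube n) = OrderHom.id := by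
  apply tensorMap_ext <;> intro s i <;> simp

theorem tensorMap_comp {m n o p q r : ℕ} (f : Cube m →o Cube n) (f' : Cube n →o Cube o)
    (g : Cube p →o Cube q) (g' : Cube q →o Cube r) :
    (tensorMap f' g').comp (tensorMap f g) = tensorMap (f'.comp f) (g'.comp g) := by
  apply tensorMap_ext <;> intro s i <;> simp

theorem castMap_comp {l m n : ℕ} (h : l = m) (h' : m = n) :
    (castMap h').comp (castMap h) = castMap (h.trans h') := rfl

theorem tensorMap_castMap {m n p q : ℕ} (h : m = n) (h' : p = q) :
    tensorMap (castMap h) (castMap h') = castMap (by rw [h, h']) := by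
  subst h h'
  exact tensorMap_id _ _

theorem tensorMap_assoc {m m' n n' p p' : ℕ} (f : Cube m →o Cube m') (g : Cube n →o Cube n')
    (h : Cube p →o Cube p') :
    (castMap (Nat.add_assoc m' n' p')).comp (tensorMap (tensorMap f g) h) =
      (tensorMap f (tensorMap g h)).comp (castMap (Nat.add_assoc m n p)) := by
  have e₁ (a b c : ℕ) (i : Fin a) : (i.castAdd (b + c)).cast (Nat.add_assoc a b c).symm =
      (i.castAdd b).castAdd c := rfl
  have e₂ (a b c : ℕ) (i : Fin b) : ((i.castAdd c).natAdd a).cast (Nat.add_assoc a b c).symm =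
      (i.natAdd a).castAdd c := rfl
  have e₃ (a b c : ℕ) (i : Fin c) : ((i.natAdd b).natAdd a).cast (Nat.add_assoc a b c).symm =
      i.natAdd (a + b) := by ext; simp [Nat.add_assoc]
  apply tensorMap_ext
  · intro s i
    simp [e₁]
  · intro s i
    refine Fin.addCases (fun i => ?_) (fun i => ?_) i <;> simp [e₂, e₃]

theorem tensorMap_zero_left {m n : ℕ} (f : Cube m →o Cube n) :
    (castMap (Nat.zero_add n)).comp (tensorMap (OrderHom.id : Cube 0 →o Cube 0) f) =
      f.comp (castMap (Nat.zero_add m)) := by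
  have e (a : ℕ) (i : Fin a) : i.cast (Nat.zero_add a).symm = i.natAdd 0 := by ext; simp
  ext s i
  simp only [OrderHom.comp_coe, Function.comp_apply, castMap_apply, e, tensorMap_natAdd]
  exact congrArg (fun t => f t i) (funext fun i => congrArg s (e m i).symm)

theorem tensorMap_zero_right {m n : ℕ} (f : Cube m →o Cube n) :
    (castMap (Nat.add_zero n)).comp (tensorMap f (OrderHom.id : Cube 0 →o Cube 0)) =
      f.comp (castMap (Nat.add_zero m)) := by
  ext s i
  exact tensorMap_castAdd f _ s i

/-- The category `□_c`: its objects are the categories `𝟏ⁿ`, its morphisms are the functors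
generated by co-faces, co-degeneracies and co-connections. -/
@[ext]
structure CubeCat : Type where
  dim : ℕ

namespace CubeCat

/-- Morphisms of `□_c`. -/
@[ext]
structure Hom (a b : CubeCat) : Type where
  map : Cube a.dim →o Cube b.dim
  isCubical : IsCubical map

instance : Category CubeCat where
  Hom := Hom
  id a := ⟨OrderHom.id, .id _⟩
  comp f g := ⟨g.map.comp f.map, f.isCubical.comp g.isCubical⟩

@[ext]
theorem hom_ext {a b : CubeCat} {f g : a ⟶ b} (h : ∀ s i, f.map s i = g.map s i) : f = g :=
  Hom.ext (by ext s i; exact h s i)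

@[simp] theorem id_map (a : CubeCat) (s : Cube a.dim) : Hom.map (𝟙 a) s = s := rfl

@[simp] theorem comp_map {a b c : CubeCat} (f : a ⟶ b) (g : b ⟶ c) (s : Cube a.dim) :
    (f ≫ g).map s = g.map (f.map s) := rfl

/-- The isomorphism of cubes of equal dimension that preserves the order of the coordinates. -/
def castIso {a b : CubeCat} (h : a.dim = b.dim) : a ≅ b where
  hom := ⟨castMap h, .castMap h⟩
  inv := ⟨castMap h.symm, .castMap h.symm⟩
  hom_inv_id := rfl
  inv_hom_id := rfl

@[simp] theorem castIso_hom_map {a b : CubeCat} (h : a.dim = b.dim) (s : Cube a.dim) (i) :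
    (castIso h).hom.map s i = s (i.cast h.symm) := rfl

@[simp] theorem castIso_inv_map {a b : CubeCat} (h : a.dim = b.dim) (s : Cube b.dim) (i) :
    (castIso h).inv.map s i = s (i.cast h) := rfl

/-- The monoidal structure `𝟏ᵐ ⊗ 𝟏ⁿ = 𝟏ᵐ⁺ⁿ`. -/
instance : MonoidalCategoryStruct CubeCat where
  tensorObj a b := ⟨a.dim + b.dim⟩
  tensorUnit := ⟨0⟩
  tensorHom f g := ⟨tensorMap f.map g.map, f.isCubical.tensorMap g.isCubical⟩
  whiskerLeft a _ _ g := ⟨tensorMap OrderHom.id g.map, (IsCubical.id a.dim).tensorMap g.isCubical⟩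
  whiskerRight f b := ⟨tensorMap f.map OrderHom.id, f.isCubical.tensorMap (IsCubical.id b.dim)⟩
  associator a b c := castIso (Nat.add_assoc a.dim b.dim c.dim)
  leftUnitor a := castIso (Nat.zero_add a.dim)
  rightUnitor a := castIso (Nat.add_zero a.dim)

instance : MonoidalCategory CubeCat where
  tensorHom_def f g := Hom.ext (tensorMap_comp f.map OrderHom.id OrderHom.id g.map).symm
  id_tensorHom_id a b := Hom.ext (tensorMap_id _ _)
  tensorHom_comp_tensorHom f₁ f₂ g₁ g₂ := Hom.ext (tensorMap_comp _ _ _ _)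
  whiskerLeft_id a b := Hom.ext (tensorMap_id _ _)
  id_whiskerRight a b := Hom.ext (tensorMap_id _ _)
  associator_naturality f₁ f₂ f₃ := Hom.ext (tensorMap_assoc _ _ _)
  leftUnitor_naturality f := Hom.ext (tensorMap_zero_left _)
  rightUnitor_naturality f := Hom.ext (tensorMap_zero_right _)
  pentagon a b c d := Hom.ext <| by
    have h₁ := tensorMap_castMap (Nat.add_assoc a.dim b.dim c.dim) (rfl : d.dim = d.dim)
    have h₂ := tensorMap_castMap (rfl : a.dim = a.dim) (Nat.add_assoc b.dim c.dim d.dim)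
    exact (congrArg₂ (fun x y => (OrderHom.comp y (castMap
      (Nat.add_assoc a.dim (b.dim + c.dim) d.dim))).comp x) h₁ h₂)
  triangle a b := Hom.ext <| by
    have h₁ := tensorMap_castMap (Nat.add_zero a.dim) (rfl : b.dim = b.dim)
    have h₂ := tensorMap_castMap (rfl : a.dim = a.dim) (Nat.zero_add b.dim)
    exact (congrArg (fun y => OrderHom.comp y (castMap
      (Nat.add_assoc a.dim 0 b.dim))) h₂).trans h₁.symm

end CubeCat

/-! ### Cubical sets with connections -/

/-- Cubical sets with connections: presheaves on `□_c`. The synonym `DayFunctor` for the functor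
category carries the Day convolution
`(K ⊗ L)_p = ∫^{m, n} K_m × L_n × □_c(𝟏ᵖ, 𝟏ᵐ⁺ⁿ)`, that is, the colimit of the standard cubes
`□_c^{m + n}` over all `□_c^m ⟶ K` and `□_c^n ⟶ L`. -/
abbrev CubSet : Type (u + 1) := DayFunctor CubeCatᵒᵖ (Type u)

namespace CubSet

variable {K K' L L' M N : CubSet.{u}} {m m' n n' p : CubeCat}

/-- The cell `a ⊗ b` of `K ⊗ L`. -/
noncomputable def tens (a : K.functor.obj (op m)) (b : L.functor.obj (op n)) :
    (K ⊗ L).functor.obj (op (m ⊗ n)) :=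
  (DayFunctor.η K L).app (op m, op n) (a, b)

theorem map_tens (f : m' ⟶ m) (g : n' ⟶ n) (a : K.functor.obj (op m))
    (b : L.functor.obj (op n)) :
    (K ⊗ L).functor.map (f ⊗ₘ g).op (tens a b) =
      tens (K.functor.map f.op a) (L.functor.map g.op b) :=
  (ConcreteCategory.congr_hom ((DayFunctor.η K L).naturality
    (show ((op m, op n) : CubeCatᵒᵖ × CubeCatᵒᵖ) ⟶ (op m', op n') from (f.op, g.op)))
    ((a, b) : K.functor.obj (op m) × L.functor.obj (op n))).symm

theorem exists_tens (x : (K ⊗ L).functor.obj (op p)) :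
    ∃ (m n : CubeCat) (f : p ⟶ m ⊗ n) (a : K.functor.obj (op m)) (b : L.functor.obj (op n)),
      x = (K ⊗ L).functor.map f.op (tens a b) := by
  obtain ⟨j, y, rfl⟩ := Types.jointly_surjective_of_isColimit
    (LawfulDayConvolutionMonoidalCategoryStruct.isPointwiseLeftKanExtensionConvolutionExtensionUnit
      (C := CubeCatᵒᵖ) (V := Type u) K L (op p)) x
  exact ⟨j.left.1.unop, j.left.2.unop, j.hom.unop, y.1, y.2, rfl⟩

theorem hom_natural (φ : K ⟶ L) (f : m ⟶ n) (a : K.functor.obj (op n)) :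
    φ.natTrans.app (op m) (K.functor.map f.op a) =
      L.functor.map f.op (φ.natTrans.app (op n) a) :=
  ConcreteCategory.congr_hom (φ.natTrans.naturality f.op) a

theorem hom_ext' {φ ψ : K ⟶ L}
    (h : ∀ m (a : K.functor.obj (op m)), φ.natTrans.app (op m) a = ψ.natTrans.app (op m) a) :
    φ = ψ := by
  ext m a
  exact h m.unop a

theorem tensor_hom_ext' {φ ψ : K ⊗ L ⟶ M}
    (h : ∀ m n (a : K.functor.obj (op m)) (b : L.functor.obj (op n)),
      φ.natTrans.app (op (m ⊗ n)) (tens a b) = ψ.natTrans.app (op (m ⊗ n)) (tens a b)) :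
    φ = ψ := by
  refine hom_ext' fun p x => ?_
  obtain ⟨m, n, f, a, b, rfl⟩ := exists_tens x
  rw [hom_natural, hom_natural, h]

theorem tensor_hom_ext₃ {φ ψ : (K ⊗ L) ⊗ M ⟶ N}
    (h : ∀ m n p (a : K.functor.obj (op m)) (b : L.functor.obj (op n)) (c : M.functor.obj (op p)),
      φ.natTrans.app (op ((m ⊗ n) ⊗ p)) (tens (tens a b) c) =
        ψ.natTrans.app (op ((m ⊗ n) ⊗ p)) (tens (tens a b) c)) : φ = ψ := by
  refine tensor_hom_ext' fun m n x c => ?_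
  obtain ⟨m, n, f, a, b, rfl⟩ := exists_tens x
  have e := map_tens f (𝟙 _) (tens a b) c
  rw [op_id, Functor.map_id_apply] at e
  rw [← e, hom_natural, hom_natural, h]

theorem comp_app (φ : K ⟶ L) (ψ : L ⟶ M) (a : K.functor.obj (op m)) :
    (φ ≫ ψ).natTrans.app (op m) a = ψ.natTrans.app (op m) (φ.natTrans.app (op m) a) := rfl

theorem tensorHom_tens (φ : K ⟶ K') (ψ : L ⟶ L') (a : K.functor.obj (op m))
    (b : L.functor.obj (op n)) :
    (φ ⊗ₘ ψ).natTrans.app (op (m ⊗ n)) (tens a b) =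
      tens (φ.natTrans.app (op m) a) (ψ.natTrans.app (op n) b) :=
  ConcreteCategory.congr_hom
    (LawfulDayConvolutionMonoidalCategoryStruct.convolutionExtensionUnit_comp_ι_map_tensorHom_app
      CubeCatᵒᵖ (Type u) φ ψ (op m) (op n)) ((a, b) : K.functor.obj (op m) × L.functor.obj (op n))

theorem whiskerRight_tens (φ : K ⟶ K') (a : K.functor.obj (op m))
    (b : L.functor.obj (op n)) :
    (φ ▷ L).natTrans.app (op (m ⊗ n)) (tens a b) = tens (φ.natTrans.app (op m) a) b :=
  ConcreteCategory.congr_hom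
    (LawfulDayConvolutionMonoidalCategoryStruct.convolutionExtensionUnit_comp_ι_map_whiskerRight_app
      CubeCatᵒᵖ (Type u) φ L (op m) (op n)) ((a, b) : K.functor.obj (op m) × L.functor.obj (op n))

theorem whiskerLeft_tens (ψ : L ⟶ L') (a : K.functor.obj (op m))
    (b : L.functor.obj (op n)) :
    (K ◁ ψ).natTrans.app (op (m ⊗ n)) (tens a b) = tens a (ψ.natTrans.app (op n) b) :=
  ConcreteCategory.congr_hom
    (LawfulDayConvolutionMonoidalCategoryStruct.convolutionExtensionUnit_comp_ι_map_whiskerLeft_app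
      (C := CubeCatᵒᵖ) (Type u) K ψ (op m) (op n)) ((a, b) : K.functor.obj (op m) × L.functor.obj (op n))

theorem associator_hom_tens (a : K.functor.obj (op m)) (b : L.functor.obj (op n))
    (c : M.functor.obj (op p)) :
    (α_ K L M).hom.natTrans.app (op ((m ⊗ n) ⊗ p)) (tens (tens a b) c) =
      (K ⊗ L ⊗ M).functor.map (α_ m n p).hom.op (tens a (tens b c)) :=
  ConcreteCategory.congr_hom
    (LawfulDayConvolutionMonoidalCategoryStruct.associator_hom_unit_unit
      (C := CubeCatᵒᵖ) (Type u) K L M (op m) (op n) (op p)) (((a, b), c) :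
        (K.functor.obj (op m) × L.functor.obj (op n)) × M.functor.obj (op p))

theorem associator_inv_tens (a : K.functor.obj (op m)) (b : L.functor.obj (op n))
    (c : M.functor.obj (op p)) :
    (α_ K L M).inv.natTrans.app (op (m ⊗ n ⊗ p)) (tens a (tens b c)) =
      ((K ⊗ L) ⊗ M).functor.map (α_ m n p).inv.op (tens (tens a b) c) := by
  have h := congrArg ((K ⊗ L ⊗ M).functor.map (α_ m n p).inv.op)
    (associator_hom_tens a b c)
  rw [← Functor.map_comp_apply, ← op_comp, Iso.inv_hom_id, op_id, Functor.map_id_apply,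
    ← hom_natural] at h
  rw [← h]
  exact ConcreteCategory.congr_hom (congrArg (fun t => t.natTrans.app (op (m ⊗ n ⊗ p)))
    (α_ K L M).hom_inv_id) _

/-- The unique cell of dimension `0` that generates the unit. -/
noncomputable def unitCell : (𝟙_ CubSet.{u}).functor.obj (op (𝟙_ CubeCat)) :=
  DayFunctor.ν CubeCatᵒᵖ (Type u) PUnit.unit

theorem leftUnitor_hom_tens (a : K.functor.obj (op m)) :
    (λ_ K).hom.natTrans.app (op (𝟙_ CubeCat ⊗ m)) (tens unitCell a) =
      K.functor.map (λ_ m).hom.op a :=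
  ConcreteCategory.congr_hom
    (LawfulDayConvolutionMonoidalCategoryStruct.leftUnitor_hom_unit_app
      (C := CubeCatᵒᵖ) (Type u) K (op m))
    ((PUnit.unit, a) : PUnit.{u + 1} × K.functor.obj (op m))

theorem rightUnitor_hom_tens (a : K.functor.obj (op m)) :
    (ρ_ K).hom.natTrans.app (op (m ⊗ 𝟙_ CubeCat)) (tens a unitCell) =
      K.functor.map (ρ_ m).hom.op a :=
  ConcreteCategory.congr_hom
    (LawfulDayConvolutionMonoidalCategoryStruct.rightUnitor_hom_unit_app
      (C := CubeCatᵒᵖ) (Type u) K (op m))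
    ((a, PUnit.unit) : K.functor.obj (op m) × PUnit.{u + 1})

theorem leftUnitor_inv_apply (a : K.functor.obj (op m)) :
    (λ_ K).inv.natTrans.app (op m) a =
      (𝟙_ CubSet.{u} ⊗ K).functor.map (λ_ m).inv.op (tens unitCell a) := by
  have h := congrArg (K.functor.map (λ_ m).inv.op) (leftUnitor_hom_tens a)
  rw [← Functor.map_comp_apply, ← op_comp, Iso.inv_hom_id, op_id, Functor.map_id_apply,
    ← hom_natural] at h
  exact (congrArg _ h.symm).trans (ConcreteCategory.congr_hom
    (congrArg (fun t => t.natTrans.app (op m)) (λ_ K).hom_inv_id) _)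

theorem rightUnitor_inv_apply (a : K.functor.obj (op m)) :
    (ρ_ K).inv.natTrans.app (op m) a =
      (K ⊗ 𝟙_ CubSet.{u}).functor.map (ρ_ m).inv.op (tens a unitCell) := by
  have h := congrArg (K.functor.map (ρ_ m).inv.op) (rightUnitor_hom_tens a)
  rw [← Functor.map_comp_apply, ← op_comp, Iso.inv_hom_id, op_id, Functor.map_id_apply,
    ← hom_natural] at h
  exact (congrArg _ h.symm).trans (ConcreteCategory.congr_hom
    (congrArg (fun t => t.natTrans.app (op m)) (ρ_ K).hom_inv_id) _)

theorem unit_hom_ext' {φ ψ : 𝟙_ CubSet.{u} ⟶ K}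
    (h : φ.natTrans.app (op (𝟙_ CubeCat)) unitCell = ψ.natTrans.app (op (𝟙_ CubeCat)) unitCell) :
    φ = ψ := by
  apply DayFunctor.unit_hom_ext
  ext ⟨⟩
  exact h

/-- The map `𝟙 ⟶ K` that picks out a given `0`-cell. -/
noncomputable def unitLift (a : K.functor.obj (op (𝟙_ CubeCat))) : 𝟙_ CubSet.{u} ⟶ K :=
  DayFunctor.unitDesc (↾fun _ => a)

theorem unitLift_unitCell (a : K.functor.obj (op (𝟙_ CubeCat))) :
    (unitLift a).natTrans.app (op (𝟙_ CubeCat)) unitCell = a :=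
  ConcreteCategory.congr_hom (DayFunctor.ν_comp_unitDesc (C := CubeCatᵒᵖ) (V := Type u)
    (F := K) (↾fun _ => a)) PUnit.unit

/-- A map out of `K ⊗ L` is a natural family of maps `K_m × L_n ⟶ M_{m + n}`. -/
noncomputable def tensorLift
    (φ : ∀ m n, K.functor.obj (op m) → L.functor.obj (op n) → M.functor.obj (op (m ⊗ n)))
    (hφ : ∀ (m m' n n' : CubeCat) (f : m' ⟶ m) (g : n' ⟶ n) (a : K.functor.obj (op m))
      (b : L.functor.obj (op n)), φ m' n' (K.functor.map f.op a) (L.functor.map g.op b) =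
        M.functor.map (f ⊗ₘ g).op (φ m n a b)) : K ⊗ L ⟶ M :=
  DayFunctor.tensorDesc
    { app := fun x => ↾fun y => φ x.1.unop x.2.unop y.1 y.2
      naturality := fun x y f => by
        ext z
        exact hφ _ _ _ _ f.1.unop f.2.unop z.1 z.2 }

theorem tensorLift_tens
    (φ : ∀ m n, K.functor.obj (op m) → L.functor.obj (op n) → M.functor.obj (op (m ⊗ n))) (hφ)
    (a : K.functor.obj (op m)) (b : L.functor.obj (op n)) :
    (tensorLift φ hφ).natTrans.app (op (m ⊗ n)) (tens a b) = φ m n a b :=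
  ConcreteCategory.congr_hom (DayFunctor.η_comp_tensorDesc_app (C := CubeCatᵒᵖ) (V := Type u) _
    (op m) (op n))
    ((a, b) : K.functor.obj (op m) × L.functor.obj (op n))

end CubSet

/-! ### Triangulation -/

theorem elem_induction {J D : Type*} [Category* J] [Category* D] {F : J ⥤ D ⥤ Type u}
    {c : Cocone F} (hc : IsColimit c) (d : D)
    [PreservesColimit F ((evaluation D (Type u)).obj d)] (x : c.pt.obj d) :
    ∃ (j : J) (y : (F.obj j).obj d), x = (c.ι.app j).app d y := by
  obtain ⟨j, y, h⟩ := Types.jointly_surjective_of_isColimit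
    (isColimitOfPreserves ((evaluation D (Type u)).obj d) hc) x
  exact ⟨j, y, h.symm⟩

/-- Maps out of the value at `d` of a colimit of set-valued functors. -/
noncomputable def elemLift {J D : Type*} [Category* J] [Category* D] {F : J ⥤ D ⥤ Type u}
    {c : Cocone F} (hc : IsColimit c) (d : D)
    [PreservesColimit F ((evaluation D (Type u)).obj d)] {Z : Type u}
    (φ : ∀ j, (F.obj j).obj d → Z)
    (h : ∀ (j j' : J) (f : j ⟶ j') (x : (F.obj j).obj d), φ j' ((F.map f).app d x) = φ j x)
    (x : c.pt.obj d) : Z :=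
  (isColimitOfPreserves ((evaluation D (Type u)).obj d) hc).desc
    { pt := Z
      ι := { app := fun j => ↾(φ j)
             naturality := fun j j' f => by ext x; exact h j j' f x } } x

theorem elemLift_ι {J D : Type*} [Category* J] [Category* D] {F : J ⥤ D ⥤ Type u}
    {c : Cocone F} (hc : IsColimit c) (d : D)
    [PreservesColimit F ((evaluation D (Type u)).obj d)] {Z : Type u}
    (φ : ∀ j, (F.obj j).obj d → Z) (h) (j : J) (x : (F.obj j).obj d) :
    elemLift hc d φ h ((c.ι.app j).app d x) = φ j x :=
  ConcreteCategory.congr_hom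
    ((isColimitOfPreserves ((evaluation D (Type u)).obj d) hc).fac _ j) x

/-- The poset `𝟏ⁿ`, in an arbitrary universe. -/
def Vert (n : CubeCat) : Type u := ULift.{u} (Cube n.dim)

namespace Vert

instance (n : CubeCat) : PartialOrder (Vert.{u} n) :=
  inferInstanceAs (PartialOrder (ULift.{u} (Cube n.dim)))

/-- The functor `𝟏ᵐ ⥤ 𝟏ⁿ` given by a morphism of `□_c`. -/
def map {m n : CubeCat} (f : m ⟶ n) : Vert.{u} m →o Vert.{u} n where
  toFun v := ⟨f.map v.down⟩
  monotone' _ _ h := f.map.monotone h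

/-- The identification `𝟏ᵐ × 𝟏ⁿ = 𝟏ᵐ⁺ⁿ`. -/
def append {m n : CubeCat} (v : Vert.{u} m) (w : Vert.{u} n) : Vert.{u} (m ⊗ n) :=
  ⟨Fin.append v.down w.down⟩

theorem append_mono {m n : CubeCat} {v v' : Vert.{u} m} {w w' : Vert.{u} n} (h : v ≤ v')
    (h' : w ≤ w') : append v w ≤ append v' w' := fun i => by
  refine Fin.addCases (fun a => ?_) (fun a => ?_) i
  · exact (Fin.append_left v.down w.down a).trans_le
      ((h a).trans_eq (Fin.append_left v'.down w'.down a).symm)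
  · exact (Fin.append_right v.down w.down a).trans_le
      ((h' a).trans_eq (Fin.append_right v'.down w'.down a).symm)

theorem map_append {m m' n n' : CubeCat} (f : m ⟶ m') (g : n ⟶ n') (v : Vert.{u} m)
    (w : Vert.{u} n) : map (f ⊗ₘ g) (append v w) = append (map f v) (map g w) := by
  refine congrArg ULift.up ?_
  change Fin.append (f.map fun i => Fin.append v.down w.down (i.castAdd _))
    (g.map fun i => Fin.append v.down w.down (i.natAdd _)) = _
  simp only [Fin.append_left, Fin.append_right]
  rfl

theorem map_associator {m n p : CubeCat} (v : Vert.{u} m) (w : Vert.{u} n) (x : Vert.{u} p) :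
    map (α_ m n p).hom (append (append v w) x) = append v (append w x) :=
  congrArg ULift.up (funext fun i => congrFun (Fin.append_assoc v.down w.down x.down) _)

theorem map_leftUnitor {n : CubeCat} (v : Vert.{u} (𝟙_ CubeCat)) (w : Vert.{u} n) :
    map (λ_ n).hom (append v w) = w := by
  refine congrArg ULift.up (funext fun i => ?_)
  have h := Fin.append_right v.down w.down i
  refine Eq.trans ?_ h
  exact congrArg (Fin.append v.down w.down) (Fin.ext (Nat.zero_add _).symm)

theorem map_rightUnitor {n : CubeCat} (v : Vert.{u} n) (w : Vert.{u} (𝟙_ CubeCat)) :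
    map (ρ_ n).hom (append v w) = v :=
  congrArg ULift.up (funext fun i => Fin.append_left v.down w.down i)

end Vert

/-- The functor `𝟏ⁿ ↦ N(𝟏ⁿ)` from `□_c` to simplicial sets. -/
def cubeNerve : CubeCat ⥤ SSet.{u} where
  obj n := nerve (Vert.{u} n)
  map f := nerveMap (Vert.map f).monotone.functor

namespace cubeNerve
variable {m m' n n' p : CubeCat} {k k' : SimplexCategoryᵒᵖ}

theorem ext' {x y : (cubeNerve.{u}.obj n).obj k} (h : ∀ i, Functor.obj x i = Functor.obj y i) :
    x = y := nerve.ext_of_isThin (funext h)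

theorem map_obj (f : m ⟶ n) (x : (cubeNerve.{u}.obj m).obj k) (i) :
    Functor.obj ((cubeNerve.map f).app k x) i = Vert.map f (Functor.obj x i) := rfl

/-- The identification `N(𝟏ᵐ) × N(𝟏ⁿ) = N(𝟏ᵐ⁺ⁿ)`. -/
def pair (x : (cubeNerve.{u}.obj m).obj k) (y : (cubeNerve.{u}.obj n).obj k) :
    (cubeNerve.{u}.obj (m ⊗ n)).obj k :=
  Monotone.functor (f := fun i => Vert.append (Functor.obj x i) (Functor.obj y i)) fun _ _ h =>
    Vert.append_mono (Functor.monotone x h) (Functor.monotone y h)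

theorem map_pair (f : m ⟶ m') (g : n ⟶ n') (x : (cubeNerve.{u}.obj m).obj k)
    (y : (cubeNerve.{u}.obj n).obj k) :
    (cubeNerve.map (f ⊗ₘ g)).app k (pair x y) =
      pair ((cubeNerve.map f).app k x) ((cubeNerve.map g).app k y) :=
  ext' fun _ => Vert.map_append _ _ _ _

theorem pair_map (θ : k ⟶ k') (x : (cubeNerve.{u}.obj m).obj k)
    (y : (cubeNerve.{u}.obj n).obj k) :
    (cubeNerve.obj (m ⊗ n)).map θ (pair x y) =
      pair ((cubeNerve.obj m).map θ x) ((cubeNerve.obj n).map θ y) :=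
  ext' fun _ => rfl

theorem map_associator (x : (cubeNerve.{u}.obj m).obj k) (y : (cubeNerve.{u}.obj n).obj k)
    (z : (cubeNerve.{u}.obj p).obj k) :
    (cubeNerve.map (α_ m n p).hom).app k (pair (pair x y) z) = pair x (pair y z) :=
  ext' fun _ => Vert.map_associator _ _ _

theorem map_leftUnitor (x : (cubeNerve.{u}.obj (𝟙_ CubeCat)).obj k)
    (y : (cubeNerve.{u}.obj n).obj k) :
    (cubeNerve.map (λ_ n).hom).app k (pair x y) = y :=
  ext' fun _ => Vert.map_leftUnitor _ _

theorem map_rightUnitor (x : (cubeNerve.{u}.obj n).obj k)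
    (y : (cubeNerve.{u}.obj (𝟙_ CubeCat)).obj k) :
    (cubeNerve.map (ρ_ n).hom).app k (pair x y) = x :=
  ext' fun _ => Vert.map_rightUnitor _ _

/-- The only simplex of each dimension of `N(𝟏⁰)`. -/
def point (k : SimplexCategoryᵒᵖ) : (cubeNerve.{u}.obj (𝟙_ CubeCat)).obj k :=
  Monotone.functor (f := fun _ => ⟨Fin.elim0⟩) fun _ _ _ => le_rfl

end cubeNerve

/-- The triangulation functor `K ↦ |K| = colim_{□_c^n ⟶ K} N(𝟏ⁿ)`. -/
noncomputable def triangulation : CubSet.{u} ⥤ SSet.{u} :=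
  (DayFunctor.equiv CubeCatᵒᵖ (Type u)).functor ⋙
    (uliftYoneda.{u} (C := CubeCat)).pointwiseLeftKanExtension cubeNerve.{u}

namespace triangulation
variable {K L M : CubSet.{u}} {m m' n n' p : CubeCat} {k k' : SimplexCategoryᵒᵖ}

/-- The simplex of `|K|` given by a cell `a` of `K` and a simplex of the corresponding cube. -/
noncomputable def mk (a : K.functor.obj (op n)) (x : (cubeNerve.{u}.obj n).obj k) :
    (triangulation.obj K).obj k :=
  (colimit.ι (CostructuredArrow.proj (uliftYoneda.{u} (C := CubeCat)) K.functor ⋙ cubeNerve.{u})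
    (CostructuredArrow.mk (uliftYonedaEquiv.symm a))).app k x

theorem mk_map (f : m ⟶ n) (a : K.functor.obj (op n)) (x : (cubeNerve.{u}.obj m).obj k) :
    mk (K.functor.map f.op a) x = mk a ((cubeNerve.map f).app k x) := by
  let j : CostructuredArrow (uliftYoneda.{u} (C := CubeCat)) K.functor :=
    CostructuredArrow.mk (uliftYonedaEquiv.symm (K.functor.map f.op a))
  let j' : CostructuredArrow (uliftYoneda.{u} (C := CubeCat)) K.functor :=
    CostructuredArrow.mk (uliftYonedaEquiv.symm a)
  let g : j ⟶ j' := CostructuredArrow.homMk f (by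
    exact (uliftYonedaEquiv_symm_map f.op a).symm)
  have := colimit.w (CostructuredArrow.proj (uliftYoneda.{u} (C := CubeCat)) K.functor ⋙
    cubeNerve.{u}) g
  exact (ConcreteCategory.congr_hom (congrArg (fun t => NatTrans.app t k) this) x).symm

theorem ι_eq_mk (j : CostructuredArrow (uliftYoneda.{u} (C := CubeCat)) K.functor)
    (x : (cubeNerve.{u}.obj j.left).obj k) :
    (colimit.ι (CostructuredArrow.proj (uliftYoneda.{u} (C := CubeCat)) K.functor ⋙
      cubeNerve.{u}) j).app k x = mk (K := K) (uliftYonedaEquiv j.hom) x := by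
  let j' : CostructuredArrow (uliftYoneda.{u} (C := CubeCat)) K.functor :=
    CostructuredArrow.mk (uliftYonedaEquiv.symm (uliftYonedaEquiv j.hom))
  let g : j ⟶ j' := CostructuredArrow.homMk (𝟙 j.left) (by
    simp only [j', CostructuredArrow.mk_hom_eq_self, Equiv.symm_apply_apply]
    exact (congrArg (· ≫ j.hom) (uliftYoneda.map_id j.left)).trans (Category.id_comp _))
  have := colimit.w (CostructuredArrow.proj (uliftYoneda.{u} (C := CubeCat)) K.functor ⋙
    cubeNerve.{u}) g
  refine (ConcreteCategory.congr_hom (congrArg (fun t => NatTrans.app t k) this) x).symm.trans ?_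
  refine congrArg (mk (K := K) (uliftYonedaEquiv j.hom)) ?_
  exact ConcreteCategory.congr_hom (congrArg (fun t => NatTrans.app t k)
    (cubeNerve.map_id j.left)) x

theorem exists_mk (x : (triangulation.obj K).obj k) :
    ∃ (n : CubeCat) (a : K.functor.obj (op n)) (y : (cubeNerve.{u}.obj n).obj k), x = mk a y := by
  obtain ⟨j, y, rfl⟩ := elem_induction (colimit.isColimit
    (CostructuredArrow.proj (uliftYoneda.{u} (C := CubeCat)) K.functor ⋙ cubeNerve.{u})) k x
  exact ⟨j.left, uliftYonedaEquiv j.hom, y, ι_eq_mk j y⟩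

/-- Maps out of the set of `k`-simplices of `|K|`. -/
noncomputable def lift {Z : Type u}
    (φ : ∀ n, K.functor.obj (op n) → (cubeNerve.{u}.obj n).obj k → Z)
    (h : ∀ (m n : CubeCat) (f : m ⟶ n) (a : K.functor.obj (op n)) (x : (cubeNerve.obj m).obj k),
      φ m (K.functor.map f.op a) x = φ n a ((cubeNerve.map f).app k x))
    (x : (triangulation.obj K).obj k) : Z :=
  elemLift (colimit.isColimit (CostructuredArrow.proj (uliftYoneda.{u} (C := CubeCat)) K.functor ⋙
    cubeNerve.{u})) k (fun j y => φ j.left (uliftYonedaEquiv j.hom) y) (fun j j' f y => by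
      refine (h _ _ f.left _ _).symm.trans (congrArg (fun a => φ j.left a y) ?_)
      rw [← CostructuredArrow.w f]
      exact (uliftYonedaEquiv_naturality j'.hom f.left.op)) x

theorem lift_mk {Z : Type u}
    (φ : ∀ n, K.functor.obj (op n) → (cubeNerve.{u}.obj n).obj k → Z) (h)
    (a : K.functor.obj (op n)) (x : (cubeNerve.{u}.obj n).obj k) :
    lift φ h (mk a x) = φ n a x := by
  refine (elemLift_ι _ _ _ _ _ _).trans (congrArg (fun a => φ n a x) ?_)
  exact Equiv.apply_symm_apply _ _

theorem obj_map_mk (θ : k ⟶ k') (a : K.functor.obj (op n)) (x : (cubeNerve.{u}.obj n).obj k) :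
    (triangulation.obj K).map θ (mk a x) = mk a ((cubeNerve.obj n).map θ x) :=
  (ConcreteCategory.congr_hom ((colimit.ι (CostructuredArrow.proj (uliftYoneda.{u} (C := CubeCat))
    K.functor ⋙ cubeNerve.{u}) (CostructuredArrow.mk (uliftYonedaEquiv.symm a))).naturality θ)
    x).symm

theorem map_mk (φ : K ⟶ L) (a : K.functor.obj (op n)) (x : (cubeNerve.{u}.obj n).obj k) :
    (triangulation.map φ).app k (mk a x) = mk (φ.natTrans.app (op n) a) x := by
  refine (ConcreteCategory.congr_hom (congrArg (fun t => NatTrans.app t k) (colimit.ι_desc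
    (F := CostructuredArrow.proj (uliftYoneda.{u} (C := CubeCat)) K.functor ⋙ cubeNerve.{u})
    _ (CostructuredArrow.mk (uliftYonedaEquiv.symm a)))) x).trans ?_
  refine (ι_eq_mk ((CostructuredArrow.map φ.natTrans).obj
    (CostructuredArrow.mk (uliftYonedaEquiv.symm a))) x).trans ?_
  refine congrArg (fun b => mk (K := L) b x) ?_
  exact (uliftYonedaEquiv_comp (uliftYonedaEquiv.symm a) φ.natTrans).trans
    (congrArg _ (Equiv.apply_symm_apply _ _))

/-- The comparison map `|K| × |L| ⟶ |K ⊗ L|` in each dimension. -/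
noncomputable def pairing (x : (triangulation.obj K).obj k) (y : (triangulation.obj L).obj k) :
    (triangulation.obj (K ⊗ L)).obj k :=
  lift (fun _ a x => lift (fun _ b y => mk (CubSet.tens a b) (cubeNerve.pair x y))
    (fun m n f b y => by
      have h := CubSet.map_tens (𝟙 _) f a b
      rw [op_id, Functor.map_id_apply] at h
      rw [← h, mk_map, cubeNerve.map_pair, CategoryTheory.Functor.map_id]
      rfl) y)
    (fun m n f a x => by
      obtain ⟨p, b, y, rfl⟩ := exists_mk y
      rw [lift_mk, lift_mk]
      have h := CubSet.map_tens f (𝟙 _) a b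
      rw [op_id, Functor.map_id_apply] at h
      rw [← h, mk_map, cubeNerve.map_pair, CategoryTheory.Functor.map_id]
      rfl) x

theorem pairing_mk (a : K.functor.obj (op m)) (x : (cubeNerve.{u}.obj m).obj k)
    (b : L.functor.obj (op n)) (y : (cubeNerve.{u}.obj n).obj k) :
    pairing (mk a x) (mk b y) = mk (CubSet.tens a b) (cubeNerve.pair x y) := by
  unfold pairing
  rw [lift_mk, lift_mk]

theorem map_pairing (θ : k ⟶ k') (x : (triangulation.obj K).obj k)
    (y : (triangulation.obj L).obj k) :
    (triangulation.obj (K ⊗ L)).map θ (pairing x y) =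
      pairing ((triangulation.obj K).map θ x) ((triangulation.obj L).map θ y) := by
  obtain ⟨m, a, x, rfl⟩ := exists_mk x
  obtain ⟨n, b, y, rfl⟩ := exists_mk y
  rw [pairing_mk, obj_map_mk, obj_map_mk, obj_map_mk, pairing_mk, cubeNerve.pair_map]

/-- The comparison map `|K| × |L| ⟶ |K ⊗ L|`. -/
noncomputable def μ (K L : CubSet.{u}) :
    triangulation.obj K ⊗ triangulation.obj L ⟶ triangulation.obj (K ⊗ L) where
  app k := ↾fun x : (triangulation.obj K).obj k × (triangulation.obj L).obj k => pairing x.1 x.2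
  naturality k k' θ := by
    ext x
    exact (map_pairing θ x.1 x.2).symm

/-- The comparison map from the one-point simplicial set to the triangulation of the unit. -/
noncomputable def ε : 𝟙_ SSet.{u} ⟶ triangulation.obj (𝟙_ CubSet.{u}) where
  app k := ↾fun _ => mk CubSet.unitCell (cubeNerve.point k)
  naturality k k' θ := by
    ext x
    exact (obj_map_mk θ CubSet.unitCell (cubeNerve.point k)).symm

theorem μ_apply (a : K.functor.obj (op m)) (x : (cubeNerve.{u}.obj m).obj k)
    (b : L.functor.obj (op n)) (y : (cubeNerve.{u}.obj n).obj k) :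
    (μ K L).app k ((mk a x, mk b y) : (triangulation.obj K).obj k × (triangulation.obj L).obj k) =
      mk (CubSet.tens a b) (cubeNerve.pair x y) := pairing_mk a x b y

/-- The comparison maps `|K| × |L| ⟶ |K ⊗ L|`, which are the canonical isomorphisms, are coherent. -/
noncomputable instance : (triangulation.{u}).LaxMonoidal where
  ε := ε
  μ := μ
  μ_natural_left f L := by
    ext k ⟨x, y⟩
    obtain ⟨m, a, x, rfl⟩ := exists_mk x
    obtain ⟨n, b, y, rfl⟩ := exists_mk y
    refine (congrArg (fun z => pairing z (mk b y)) (map_mk f a x)).trans ?_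
    refine (pairing_mk _ _ _ _).trans ?_
    refine Eq.trans ?_ (congrArg ((triangulation.map (f ▷ L)).app k) (pairing_mk a x b y).symm)
    rw [map_mk, CubSet.whiskerRight_tens]
  μ_natural_right K f := by
    ext k ⟨x, y⟩
    obtain ⟨m, a, x, rfl⟩ := exists_mk x
    obtain ⟨n, b, y, rfl⟩ := exists_mk y
    refine (congrArg (fun z => pairing (mk a x) z) (map_mk f b y)).trans ?_
    refine (pairing_mk _ _ _ _).trans ?_
    refine Eq.trans ?_ (congrArg ((triangulation.map (K ◁ f)).app k) (pairing_mk a x b y).symm)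
    rw [map_mk, CubSet.whiskerLeft_tens]
  associativity K L M := by
    ext k ⟨⟨x, y⟩, z⟩
    obtain ⟨m, a, x, rfl⟩ := exists_mk x
    obtain ⟨n, b, y, rfl⟩ := exists_mk y
    obtain ⟨p, c, z, rfl⟩ := exists_mk z
    change (triangulation.map (α_ K L M).hom).app k (pairing (pairing (mk a x) (mk b y)) (mk c z)) =
      pairing (mk a x) (pairing (mk b y) (mk c z))
    rw [pairing_mk, pairing_mk, pairing_mk, pairing_mk, map_mk, CubSet.associator_hom_tens,
      mk_map, cubeNerve.map_associator]
  left_unitality K := by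
    ext k ⟨_, x⟩
    obtain ⟨m, a, x, rfl⟩ := exists_mk x
    change mk a x = (triangulation.map (λ_ K).hom).app k
      (pairing (mk CubSet.unitCell (cubeNerve.point k)) (mk a x))
    rw [pairing_mk, map_mk, CubSet.leftUnitor_hom_tens, mk_map, cubeNerve.map_leftUnitor]
  right_unitality K := by
    ext k ⟨x, _⟩
    obtain ⟨m, a, x, rfl⟩ := exists_mk x
    change mk a x = (triangulation.map (ρ_ K).hom).app k
      (pairing (mk a x) (mk CubSet.unitCell (cubeNerve.point k)))
    rw [pairing_mk, map_mk, CubSet.rightUnitor_hom_tens, mk_map, cubeNerve.map_rightUnitor]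

end triangulation

/-! ### Categories of enriched categories -/

section
variable {V : Type v} [Category.{w} V] [MonoidalCategory V]
  {W : Type v'} [Category.{w'} W] [MonoidalCategory W]

theorem enrichedFunctor_ext {C D : Type*} [EnrichedCategory V C] [EnrichedCategory V D]
    {F G : EnrichedFunctor V C D} (h : ∀ X, F.obj X = G.obj X)
    (h' : ∀ X Y, HEq (F.map X Y) (G.map X Y)) : F = G := by
  obtain ⟨Fo, Fm, _, _⟩ := F
  obtain ⟨Go, Gm, _, _⟩ := G
  obtain rfl : Fo = Go := funext h
  obtain rfl : Fm = Gm := funext fun X => funext fun Y => eq_of_heq (h' X Y)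
  rfl

/-- The category of small enriched categories and enriched functors. -/
instance enrichedCatCategory : Category (EnrichedCat.{w, v, u} V) where
  toCategoryStruct := EnrichedCat.bicategory.toCategoryStruct
  id_comp _ := enrichedFunctor_ext (fun _ => rfl) fun _ _ => heq_of_eq (Category.id_comp _)
  comp_id _ := enrichedFunctor_ext (fun _ => rfl) fun _ _ => heq_of_eq (Category.comp_id _)
  assoc _ _ _ := enrichedFunctor_ext (fun _ => rfl) fun _ _ => heq_of_eq (Category.assoc _ _ _)

variable (F : V ⥤ W) [F.LaxMonoidal]

/-- The functor between transported enriched categories. -/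
noncomputable def transportMap {C D : Type u} [EnrichedCategory V C] [EnrichedCategory V D]
    (G : EnrichedFunctor V C D) :
    EnrichedFunctor W (TransportEnrichment F C) (TransportEnrichment F D) where
  obj := G.obj
  map X Y := F.map (G.map X Y)
  map_id X := by
    refine (Category.assoc _ _ _).trans ?_
    refine congrArg (Functor.LaxMonoidal.ε F ≫ ·) ?_
    exact (F.map_comp _ _).symm.trans (congrArg F.map (G.map_id X))
  map_comp X Y Z := by
    refine (Category.assoc _ _ _).trans ?_
    refine Eq.trans (congrArg (Functor.LaxMonoidal.μ F _ _ ≫ ·)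
      ((F.map_comp _ _).symm.trans ((congrArg F.map (G.map_comp X Y Z)).trans
        (F.map_comp _ _)))) ?_
    exact (Functor.LaxMonoidal.μ_natural_assoc F _ _ _).symm

/-- Change of base along a lax monoidal functor: apply it to all mapping objects. -/
noncomputable def changeOfBase : EnrichedCat.{w, v, u} V ⥤ EnrichedCat.{w', v', u} W where
  obj C := EnrichedCat.of W (TransportEnrichment F C)
  map {C D} G := transportMap (C := C) (D := D) F (G : EnrichedFunctor V C D)
  map_id _ := enrichedFunctor_ext (fun _ => rfl) fun _ _ => heq_of_eq (F.map_id _)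
  map_comp _ _ := enrichedFunctor_ext (fun _ => rfl) fun _ _ => heq_of_eq (F.map_comp _ _)

end

/-- The functor `𝔗` from categories enriched in cubical sets with connections to simplicial
categories: it keeps the objects and applies triangulation to the mapping spaces, with composition
`|K(x, y)| × |K(y, z)| ≅ |K(x, y) ⊗ K(y, z)| ⟶ |K(x, z)|`. -/
noncomputable def triangulateCat :
    EnrichedCat.{u, u + 1, u} CubSet.{u} ⥤ EnrichedCat.{u, u + 1, u} SSet.{u} :=
  changeOfBase triangulation.{u}

/-! ### Simplicial categories, dimension by dimension -/

namespace Simp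
variable {C D : Type*} [EnrichedCategory SSet.{u} C] [EnrichedCategory SSet.{u} D]
  {n n' : SimplexCategoryᵒᵖ}

/-- The `n`-simplices of a mapping space. -/
abbrev Hom (n : SimplexCategoryᵒᵖ) (X Y : C) : Type u :=
  (EnrichedCategory.Hom (V := SSet.{u}) X Y).obj n

/-- Degenerate identities. -/
def ident (n : SimplexCategoryᵒᵖ) (X : C) : Hom.{u} n X X :=
  (eId SSet.{u} X).app n (PUnit.unit : PUnit.{u + 1})

/-- Composition of `n`-simplices. -/
def comp {X Y Z : C} (f : Hom.{u} n X Y) (g : Hom.{u} n Y Z) : Hom.{u} n X Z :=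
  (eComp SSet.{u} X Y Z).app n ((f, g) : Hom.{u} n X Y × Hom.{u} n Y Z)

/-- The simplicial structure. -/
abbrev act (θ : n ⟶ n') {X Y : C} (f : Hom.{u} n X Y) : Hom.{u} n' X Y :=
  (EnrichedCategory.Hom (V := SSet.{u}) X Y).map θ f

/-- Enriched functors on `n`-simplices. -/
abbrev fmap (G : EnrichedFunctor SSet.{u} C D) {X Y : C} (f : Hom.{u} n X Y) :
    Hom.{u} n (G.obj X) (G.obj Y) := (G.map X Y).app n f

theorem ident_comp {X Y : C} (f : Hom.{u} n X Y) : comp (ident n X) f = f :=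
  ConcreteCategory.congr_hom (congrArg (fun t => NatTrans.app t n) (e_id_comp SSet.{u} X Y)) f

theorem comp_ident {X Y : C} (f : Hom.{u} n X Y) : comp f (ident n Y) = f :=
  ConcreteCategory.congr_hom (congrArg (fun t => NatTrans.app t n) (e_comp_id SSet.{u} X Y)) f

theorem comp_assoc {W X Y Z : C} (f : Hom.{u} n W X) (g : Hom.{u} n X Y) (h : Hom.{u} n Y Z) :
    comp (comp f g) h = comp f (comp g h) :=
  ConcreteCategory.congr_hom (congrArg (fun t => NatTrans.app t n) (e_assoc SSet.{u} W X Y Z))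
    ((f, (g, h)) : Hom.{u} n W X × Hom.{u} n X Y × Hom.{u} n Y Z)

theorem act_ident (θ : n ⟶ n') (X : C) : act θ (ident.{u} n X) = ident n' X :=
  (ConcreteCategory.congr_hom ((eId SSet.{u} X).naturality θ) (PUnit.unit : PUnit.{u + 1})).symm

theorem act_comp (θ : n ⟶ n') {X Y Z : C} (f : Hom.{u} n X Y) (g : Hom.{u} n Y Z) :
    act θ (comp f g) = comp (act θ f) (act θ g) :=
  (ConcreteCategory.congr_hom ((eComp SSet.{u} X Y Z).naturality θ)
    ((f, g) : Hom.{u} n X Y × Hom.{u} n Y Z)).symm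

theorem fmap_ident (G : EnrichedFunctor SSet.{u} C D) (X : C) :
    fmap G (ident n X) = ident n (G.obj X) :=
  ConcreteCategory.congr_hom (congrArg (fun t => NatTrans.app t n) (G.map_id X))
    (PUnit.unit : PUnit.{u + 1})

theorem fmap_comp (G : EnrichedFunctor SSet.{u} C D) {X Y Z : C} (f : Hom.{u} n X Y)
    (g : Hom.{u} n Y Z) : fmap G (comp f g) = comp (fmap G f) (fmap G g) :=
  ConcreteCategory.congr_hom (congrArg (fun t => NatTrans.app t n) (G.map_comp X Y Z))
    ((f, g) : Hom.{u} n X Y × Hom.{u} n Y Z)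

theorem fmap_act (G : EnrichedFunctor SSet.{u} C D) (θ : n ⟶ n') {X Y : C} (f : Hom.{u} n X Y) :
    fmap G (act θ f) = act θ (fmap G f) :=
  ConcreteCategory.congr_hom ((G.map X Y).naturality θ) f

theorem fmap_congr {G H : EnrichedFunctor SSet.{u} C D} (e : G = H) {X Y : C}
    (f : Hom.{u} n X Y) : HEq (fmap G f) (fmap H f) := by
  subst e
  rfl

theorem heq_of_app {A : SSet.{u}} {X X' Y Y' : C} (hX : X = X') (hY : Y = Y')
    {φ : A ⟶ EnrichedCategory.Hom X Y} {ψ : A ⟶ EnrichedCategory.Hom X' Y'}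
    (h : ∀ n a, HEq (φ.app n a) (ψ.app n a)) : HEq φ ψ := by
  subst hX hY
  apply heq_of_eq
  ext n a
  exact eq_of_heq (h n a)

theorem comp_heq {X X' Y Y' Z Z' : C} (hX : X = X') (hY : Y = Y') (hZ : Z = Z')
    {f : Hom.{u} n X Y} {f' : Hom.{u} n X' Y'} {g : Hom.{u} n Y Z} {g' : Hom.{u} n Y' Z'}
    (hf : HEq f f') (hg : HEq g g') : HEq (comp f g) (comp f' g') := by
  subst hX hY hZ hf hg
  rfl

end Simp

/-! ### Colimits of simplicial categories -/

namespace Colim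
variable {J : Type u} [Category.{v} J] (F : J ⥤ EnrichedCat.{u, u + 1, u} SSet.{u})

/-- The underlying enriched functor of a morphism of `EnrichedCat`. -/
abbrev fn {C D : EnrichedCat.{u, u + 1, u} SSet.{u}} (G : C ⟶ D) : EnrichedFunctor SSet.{u} C D := G

/-- Objects of the colimit. -/
def Ob : Type u :=
  Quot fun a b : Σ j, (F.obj j : Type u) => ∃ f : a.1 ⟶ b.1, (fn (F.map f)).obj a.2 = b.2

variable {F}

/-- The class of an object. -/
def ob (j : J) (a : F.obj j) : Ob F := Quot.mk _ ⟨j, a⟩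

theorem ob_map {j k : J} (f : j ⟶ k) (a : F.obj j) : ob k ((fn (F.map f)).obj a) = ob j a :=
  (Quot.sound ⟨f, rfl⟩).symm

/-- Formal composites of `n`-simplices of mapping spaces of the `F.obj j`. -/
inductive Term (n : SimplexCategoryᵒᵖ) : Ob F → Ob F → Type u
  | gen {x y : Ob F} (j : J) (a b : F.obj j) (hx : ob j a = x) (hy : ob j b = y)
      (f : Simp.Hom.{u} n a b) : Term n x y
  | ident (x : Ob F) : Term n x x
  | comp {x y z : Ob F} (s : Term n x y) (t : Term n y z) : Term n x z

/-- The relations: the laws of a category, and functoriality and naturality of the maps from the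
`F.obj j` to the colimit. -/
inductive Rel {n : SimplexCategoryᵒᵖ} : ∀ {x y : Ob F}, Term n x y → Term n x y → Prop
  | ident_comp {x y} (t : Term n x y) : Rel (.comp (.ident x) t) t
  | comp_ident {x y} (t : Term n x y) : Rel (.comp t (.ident y)) t
  | assoc {w x y z} (r : Term n w x) (s : Term n x y) (t : Term n y z) :
      Rel (.comp (.comp r s) t) (.comp r (.comp s t))
  | comp_left {x y z} {s s' : Term n x y} (t : Term n y z) :
      Rel s s' → Rel (.comp s t) (.comp s' t)
  | comp_right {x y z} (s : Term n x y) {t t' : Term n y z} :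
      Rel t t' → Rel (.comp s t) (.comp s t')
  | gen_ident {x} (j : J) (a : F.obj j) (hx : ob j a = x) :
      Rel (.gen j a a hx hx (Simp.ident n a)) (.ident x)
  | gen_comp {x y z} (j : J) (a b c : F.obj j) (hx : ob j a = x) (hy : ob j b = y)
      (hz : ob j c = z) (f : Simp.Hom.{u} n a b) (g : Simp.Hom.{u} n b c) :
      Rel (.gen j a c hx hz (Simp.comp f g)) (.comp (.gen j a b hx hy f) (.gen j b c hy hz g))
  | gen_map {x y} {j k : J} (u : j ⟶ k) (a b : F.obj j) (hx : ob j a = x) (hy : ob j b = y)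
      (hx' : ob k ((fn (F.map u)).obj a) = x) (hy' : ob k ((fn (F.map u)).obj b) = y)
      (f : Simp.Hom.{u} n a b) :
      Rel (.gen j a b hx hy f) (.gen k _ _ hx' hy' (Simp.fmap (fn (F.map u)) f))

variable {n n' n'' : SimplexCategoryᵒᵖ}

/-- The simplicial structure on formal composites. -/
def Term.act (θ : n ⟶ n') : ∀ {x y : Ob F}, Term n x y → Term n' x y
  | _, _, .gen j a b hx hy f => .gen j a b hx hy (Simp.act θ f)
  | _, _, .ident x => .ident x
  | _, _, .comp s t => .comp (s.act θ) (t.act θ)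

theorem Rel.act (θ : n ⟶ n') {x y : Ob F} {s t : Term n x y} (h : Rel s t) :
    Rel (s.act θ) (t.act θ) := by
  induction h with
  | ident_comp t => exact .ident_comp _
  | comp_ident t => exact .comp_ident _
  | assoc r s t => exact .assoc _ _ _
  | comp_left t _ ih => exact .comp_left _ ih
  | comp_right s _ ih => exact .comp_right _ ih
  | gen_ident j a hx =>
    simp only [Term.act]
    rw [Simp.act_ident]
    exact .gen_ident j a hx
  | gen_comp j a b c hx hy hz f g =>
    simp only [Term.act]
    rw [Simp.act_comp]
    exact .gen_comp j a b c hx hy hz _ _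
  | gen_map u a b hx hy hx' hy' f =>
    simp only [Term.act]
    rw [← Simp.fmap_act]
    exact .gen_map u a b hx hy hx' hy' _

theorem Term.act_id {x y : Ob F} (t : Term n x y) : t.act (𝟙 n) = t := by
  induction t with
  | gen j a b hx hy f =>
    simp only [Term.act, Simp.act, Functor.map_id_apply]
  | ident x => rfl
  | comp s t hs ht => simp only [Term.act, hs, ht]

theorem Term.act_comp (θ : n ⟶ n') (θ' : n' ⟶ n'') {x y : Ob F} (t : Term n x y) :
    t.act (θ ≫ θ') = (t.act θ).act θ' := by
  induction t with
  | gen j a b hx hy f =>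
    simp only [Term.act, Simp.act, Functor.map_comp_apply]
  | ident x => rfl
  | comp s t hs ht => simp only [Term.act, hs, ht]

/-- The mapping spaces of the colimit. -/
def hom (x y : Ob F) : SSet.{u} where
  obj n := Quot (Rel (n := n) (x := x) (y := y))
  map θ := ↾Quot.map (Term.act θ) fun _ _ h => h.act θ
  map_id n := by
    ext ⟨t⟩
    exact congrArg (Quot.mk _) t.act_id
  map_comp θ θ' := by
    ext ⟨t⟩
    exact congrArg (Quot.mk _) (t.act_comp θ θ')

/-- Composition in the colimit. -/
def compose (x y z : Ob F) (n : SimplexCategoryᵒᵖ) (s : (hom x y).obj n) (t : (hom y z).obj n) :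
    (hom x z).obj n :=
  Quot.map₂ Term.comp (fun s _ _ h => .comp_right s h) (fun _ _ t h => .comp_left t h) s t

instance : EnrichedCategory SSet.{u} (Ob F) where
  Hom := hom
  id x := { app := fun n => ↾fun _ => Quot.mk _ (.ident x) }
  comp x y z :=
    { app := fun n => ↾fun p : (hom x y).obj n × (hom y z).obj n => compose x y z n p.1 p.2
      naturality := fun n n' θ => by
        ext ⟨⟨s⟩, ⟨t⟩⟩
        rfl }
  id_comp x y := by
    ext n ⟨t⟩
    exact Quot.sound (.ident_comp t)
  comp_id x y := by
    ext n ⟨t⟩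
    exact Quot.sound (.comp_ident t)
  assoc w x y z := by
    ext n ⟨⟨r⟩, ⟨⟨s⟩, ⟨t⟩⟩⟩
    exact Quot.sound (.assoc r s t)

/-- The map from `F.obj j` to the colimit. -/
def ι (j : J) : EnrichedFunctor SSet.{u} (F.obj j) (Ob F) where
  obj := ob j
  map a b :=
    { app := fun n => ↾fun f => Quot.mk _ (.gen j a b rfl rfl f) }
  map_id a := by
    ext n x
    exact Quot.sound (.gen_ident j a rfl)
  map_comp a b c := by
    ext n ⟨f, g⟩
    exact Quot.sound (.gen_comp j a b c rfl rfl rfl f g)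

theorem gen_heq {x y x' y' : Ob F} (ex : x = x') (ey : y = y') (j : J) (a b : F.obj j)
    (hx : ob j a = x) (hy : ob j b = y) (f : Simp.Hom.{u} n a b) :
    HEq (Quot.mk _ (.gen j a b hx hy f) : (hom x y).obj n)
      (Quot.mk _ (.gen j a b (hx.trans ex) (hy.trans ey) f) : (hom x' y').obj n) := by
  subst ex ey
  rfl

variable (F) in
/-- The colimit cocone. -/
def cocone : Cocone F where
  pt := EnrichedCat.of SSet.{u} (Ob F)
  ι :=
    { app := fun j => ι j
      naturality := fun j k u => by
        refine enrichedFunctor_ext (fun a => ob_map u a) fun a b => ?_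
        refine Simp.heq_of_app (ob_map u a) (ob_map u b) fun n f => ?_
        refine (gen_heq (ob_map u a) (ob_map u b) k _ _ rfl rfl (Simp.fmap (fn (F.map u)) f)).trans
          (heq_of_eq ?_)
        exact (Quot.sound (.gen_map u a b rfl rfl _ _ f)).symm }

section desc
variable (s : Cocone F)

theorem w {j k : J} (u : j ⟶ k) :
    (fn (F.map u)).comp SSet.{u} (fn (s.ι.app k)) = fn (s.ι.app j) := s.w u

/-- The induced map out of the colimit on objects. -/
def descOb : Ob F → (s.pt : Type u) :=
  Quot.lift (fun a => (fn (s.ι.app a.1)).obj a.2) (by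
    rintro ⟨j, a⟩ ⟨k, b⟩ ⟨f, h⟩
    exact (congrArg (fun G => EnrichedFunctor.obj G a) (w s (show j ⟶ k from f))).symm.trans
      (congrArg (fn (s.ι.app k)).obj h))

/-- The induced map out of the colimit on formal composites. -/
def eval : ∀ {x y : Ob F}, Term n x y → Simp.Hom.{u} n (descOb s x) (descOb s y)
  | _, _, .gen j a b hx hy f => by
      subst hx hy
      exact Simp.fmap (fn (s.ι.app j)) f
  | _, _, .ident x => Simp.ident n (descOb s x)
  | _, _, .comp s' t => Simp.comp (eval s') (eval t)

theorem eval_gen_heq {x y : Ob F} (j : J) (a b : F.obj j) (hx : ob j a = x) (hy : ob j b = y)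
    (f : Simp.Hom.{u} n a b) :
    HEq (eval s (.gen j a b hx hy f)) (Simp.fmap (fn (s.ι.app j)) f) := by
  subst hx hy
  rfl

theorem Rel.eval {x y : Ob F} {t t' : Term n x y} (h : Rel t t') : eval s t = eval s t' := by
  induction h with
  | ident_comp t => exact Simp.ident_comp _
  | comp_ident t => exact Simp.comp_ident _
  | assoc r s t => exact Simp.comp_assoc _ _ _
  | comp_left t _ ih => simp only [Colim.eval, ih]
  | comp_right t _ ih => simp only [Colim.eval, ih]
  | gen_ident j a hx =>
    subst hx
    exact Simp.fmap_ident (fn (s.ι.app j)) a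
  | gen_comp j a b c hx hy hz f g =>
    subst hx hy hz
    exact Simp.fmap_comp (fn (s.ι.app j)) f g
  | gen_map u a b hx hy hx' hy' f =>
    refine eq_of_heq ((eval_gen_heq s _ _ _ hx hy f).trans ?_)
    refine HEq.trans ?_ (eval_gen_heq s _ _ _ hx' hy' _).symm
    exact (Simp.fmap_congr (w s u) f).symm

theorem eval_act (θ : n ⟶ n') {x y : Ob F} (t : Term n x y) :
    eval s (t.act θ) = Simp.act θ (eval s t) := by
  induction t with
  | gen j a b hx hy f =>
    subst hx hy
    exact Simp.fmap_act (fn (s.ι.app j)) θ f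
  | ident x => exact (Simp.act_ident θ _).symm
  | comp s t hs ht =>
    simp only [Term.act, eval, hs, ht]
    exact (Simp.act_comp θ _ _).symm

/-- The induced map out of the colimit. -/
def desc : EnrichedFunctor SSet.{u} (Ob F) s.pt where
  obj := descOb s
  map x y :=
    { app := fun n => ↾fun t : Quot (Rel (n := n) (x := x) (y := y)) =>
        Quot.lift (eval s) (fun _ _ h => h.eval s) t
      naturality := fun n n' θ => by
        ext ⟨t⟩
        exact eval_act s θ t }
  map_id x := by
    ext n t
    rfl
  map_comp x y z := by
    ext n ⟨⟨t⟩, ⟨t'⟩⟩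
    rfl

theorem hom_ext {D : Type u} [EnrichedCategory SSet.{u} D]
    {G H : EnrichedFunctor SSet.{u} (Ob F) D}
    (h : ∀ j, (ι j).comp SSet.{u} G = (ι j).comp SSet.{u} H) : G = H := by
  have hob : G.obj = H.obj := by
    funext x
    obtain ⟨j, a⟩ := x
    exact congrArg (fun G => EnrichedFunctor.obj G a) (h j)
  refine enrichedFunctor_ext (fun x => congrFun hob x) fun x y => ?_
  refine Simp.heq_of_app (congrFun hob x) (congrFun hob y) ?_
  rintro n ⟨t⟩
  induction t with
  | gen j a b hx hy f =>
    subst hx hy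
    exact Simp.fmap_congr (h j) f
  | ident x =>
    refine HEq.trans (heq_of_eq (Simp.fmap_ident G x)) (HEq.trans ?_
      (heq_of_eq (Simp.fmap_ident H x)).symm)
    rw [hob]
  | comp s t hs ht =>
    refine HEq.trans (heq_of_eq (Simp.fmap_comp G (Quot.mk _ s) (Quot.mk _ t))) (HEq.trans ?_
      (heq_of_eq (Simp.fmap_comp H (Quot.mk _ s) (Quot.mk _ t))).symm)
    exact Simp.comp_heq (congrFun hob _) (congrFun hob _) (congrFun hob _) (hs (Quot.mk _ s))
      (ht (Quot.mk _ t))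

end desc

variable (F) in
/-- The colimit cocone is a colimit. -/
def isColimit : IsColimit (cocone F) where
  desc s := desc s
  fac _ _ := rfl
  uniq _ _ hm := hom_ext fun j => hm j

end Colim

instance {J : Type u} [Category.{v} J] :
    HasColimitsOfShape J (EnrichedCat.{u, u + 1, u} SSet.{u}) where
  has_colimit F := ⟨⟨⟨Colim.cocone F, Colim.isColimit F⟩⟩⟩

/-! ### Lurie's rigidification -/

/-- The simplicial category `𝔠(Δⁿ)`, as a functor of `n`: its objects are `0, …, n`, the mapping
space from `i` to `j` is the nerve of the poset (ordered by inclusion) of all subsets of `[i, j]`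
that contain `i` and `j` (empty if `j < i`), and composition is union. -/
noncomputable def thickening : SimplexCategory ⥤ EnrichedCat.{u, u + 1, u} SSet.{u} where
  obj n := EnrichedCat.of SSet.{u} (SimplicialThickening (ULift.{u} (Fin (n.len + 1))))
  map f := SimplicialThickening.functor f.toOrderHom.uliftMap
  map_id _ := SimplicialThickening.functor_id _
  map_comp f g := SimplicialThickening.functor_comp f.toOrderHom.uliftMap g.toOrderHom.uliftMap

/-- Lurie's rigidification functor `𝔠(S) = colim_{Δⁿ ⟶ S} 𝔠(Δⁿ)`. -/
noncomputable def rigidification : SSet.{u} ⥤ EnrichedCat.{u, u + 1, u} SSet.{u} :=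
  SSet.stdSimplex.{u}.pointwiseLeftKanExtension thickening.{u}

open scoped Simplicial

/-! ### Necklaces -/

/-- A simplicial set with two distinguished vertices. -/
structure BipointedSSet : Type (u + 1) where
  carrier : SSet.{u}
  src : carrier _⦋0⦌
  tgt : carrier _⦋0⦌

namespace BipointedSSet

/-- Maps of simplicial sets that preserve the two distinguished vertices. -/
@[ext]
structure Hom (A B : BipointedSSet.{u}) : Type u where
  map : A.carrier ⟶ B.carrier
  map_src : map.app _ A.src = B.src
  map_tgt : map.app _ A.tgt = B.tgt

instance : Category BipointedSSet.{u} where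
  Hom := Hom
  id A := ⟨𝟙 _, rfl, rfl⟩
  comp f g := ⟨f.map ≫ g.map, (congrArg _ f.map_src).trans g.map_src,
    (congrArg _ f.map_tgt).trans g.map_tgt⟩

end BipointedSSet

/-- A necklace `Δ^{n₁} ∨ ⋯ ∨ Δ^{nₖ}` (with all `nᵢ ≥ 1`, or equal to `Δ⁰`), encoded by its set of
vertices `{0, …, n₁ + ⋯ + nₖ}` and its set of joints `{0, n₁, n₁ + n₂, …, n₁ + ⋯ + nₖ}`, which is
an arbitrary set of vertices that contains the first and the last one. -/
@[ext]
structure Necklace : Type u where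
  dim : ℕ
  joints : Finset (Fin (dim + 1))
  zero_mem : 0 ∈ joints
  last_mem : Fin.last dim ∈ joints

namespace Necklace

/-- A necklace as a simplicial set: the subcomplex of the standard simplex on its vertices that
consists of the simplices all of whose vertices lie in one bead, a bead being the set of all vertices
between two consecutive joints. -/
def subcomplex (T : Necklace.{u}) : (Δ[T.dim] : SSet.{u}).Subcomplex where
  obj k := {x | ∃ a ∈ T.joints, ∃ b ∈ T.joints, a ≤ b ∧ (∀ c ∈ T.joints, c ≤ a ∨ b ≤ c) ∧
    ∀ i, a ≤ SSet.stdSimplex.asOrderHom x i ∧ SSet.stdSimplex.asOrderHom x i ≤ b}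
  map θ := by
    rintro x ⟨a, ha, b, hb, hab, h, h'⟩
    exact ⟨a, ha, b, hb, hab, h, fun i => h' _⟩

/-- The underlying simplicial set of a necklace. -/
abbrev toSSet (T : Necklace.{u}) : SSet.{u} := T.subcomplex.toSSet

variable {T U V : Necklace.{u}} {k k' : SimplexCategoryᵒᵖ}

/-- The vertices of a simplex of a necklace. -/
def vtx (x : T.toSSet.obj k) : Fin (k.unop.len + 1) →o Fin (T.dim + 1) :=
  SSet.stdSimplex.asOrderHom x.1

theorem vtx_map (θ : k ⟶ k') (x : T.toSSet.obj k) :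
    vtx (T.toSSet.map θ x) = (vtx x).comp θ.unop.toOrderHom := rfl

theorem simplex_ext {x y : T.toSSet.obj k} (h : ∀ i, vtx x i = vtx y i) : x = y := by
  refine Subtype.ext (SSet.stdSimplex.objEquiv.injective ?_)
  apply SimplexCategory.Hom.ext
  ext i : 2
  exact h i

theorem vtx_joint (x : T.toSSet.obj k) {j} (hj : j ∈ T.joints) :
    (∀ i, vtx x i ≤ j) ∨ ∀ i, j ≤ vtx x i := by
  obtain ⟨a, ha, b, hb, hab, h, h'⟩ := x.2
  rcases h j hj with h | h
  · exact Or.inr fun i => h.trans (h' i).1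
  · exact Or.inl fun i => (h' i).2.trans h

/-- A simplex given by its vertices, no two of which are separated by a joint. -/
def ofVtx (g : Fin (k.unop.len + 1) →o Fin (T.dim + 1))
    (hg : ∀ j ∈ T.joints, (∀ i, g i ≤ j) ∨ ∀ i, j ≤ g i) : T.toSSet.obj k :=
  ⟨SSet.stdSimplex.objMk g, by
    have h1 : (T.joints.filter fun j => ∀ i, j ≤ g i).Nonempty :=
      ⟨0, Finset.mem_filter.2 ⟨T.zero_mem, fun i => Fin.zero_le _⟩⟩
    have h2 : (T.joints.filter fun j => ∀ i, g i ≤ j).Nonempty :=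
      ⟨Fin.last _, Finset.mem_filter.2 ⟨T.last_mem, fun i => Fin.le_last _⟩⟩
    have h1' := Finset.mem_filter.1 (Finset.max'_mem _ h1)
    have h2' := Finset.mem_filter.1 (Finset.min'_mem _ h2)
    refine ⟨_, h1'.1, _, h2'.1, (h1'.2 0).trans (h2'.2 0), fun c hc => ?_,
      fun i => ⟨h1'.2 i, h2'.2 i⟩⟩
    rcases hg c hc with h | h
    · exact Or.inr (Finset.min'_le _ _ (Finset.mem_filter.2 ⟨hc, h⟩))
    · exact Or.inl (Finset.le_max' _ _ (Finset.mem_filter.2 ⟨hc, h⟩))⟩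

theorem vtx_ofVtx (g : Fin (k.unop.len + 1) →o Fin (T.dim + 1)) (hg) :
    vtx (T := T) (ofVtx g hg) = g := rfl

/-- The vertex `v` of a necklace, as a degenerate simplex. -/
def const (T : Necklace.{u}) (k : SimplexCategoryᵒᵖ) (v : Fin (T.dim + 1)) : T.toSSet.obj k :=
  ofVtx (OrderHom.const _ v) fun j _ => (le_total v j).imp (fun h _ => h) fun h _ => h

/-- A necklace with its first and last vertices. -/
def toBipointed (T : Necklace.{u}) : BipointedSSet.{u} where
  carrier := T.toSSet
  src := T.const _ 0
  tgt := T.const _ (Fin.last T.dim)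

/-- The category of necklaces, a full subcategory of the category of bipointed simplicial sets:
morphisms are the maps of simplicial sets that preserve the first and the last vertex. -/
instance : Category Necklace.{u} := inferInstanceAs (Category (InducedCategory _ toBipointed))

/-- The inclusion of the category of necklaces. -/
def incl : Necklace.{u} ⥤ BipointedSSet.{u} := inducedFunctor toBipointed

/-- The map of simplicial sets given by a map of necklaces. -/
abbrev sMap (f : T ⟶ U) : T.toSSet ⟶ U.toSSet := (incl.map f).map

instance : incl.{u}.Full := inferInstanceAs (inducedFunctor toBipointed).Full

instance : incl.{u}.Faithful := inferInstanceAs (inducedFunctor toBipointed).Faithful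

theorem sMap_ext {f g : T ⟶ U} (h : sMap f = sMap g) : f = g :=
  incl.map_injective (BipointedSSet.Hom.ext h)

/-- The effect on vertices of a map of necklaces. -/
def vertFun (f : T ⟶ U) (v : Fin (T.dim + 1)) : Fin (U.dim + 1) :=
  vtx ((sMap f).app (op ⦋0⦌) (T.const _ v)) 0

theorem vtx_app (f : T ⟶ U) (x : T.toSSet.obj k) (i : Fin (k.unop.len + 1)) :
    vtx ((sMap f).app k x) i = vertFun f (vtx x i) := by
  let θ : k ⟶ op ⦋0⦌ := (SimplexCategory.const ⦋0⦌ k.unop i).op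
  have h := ConcreteCategory.congr_hom ((sMap f).naturality θ) x
  have h' : T.toSSet.map θ x = T.const _ (vtx x i) := simplex_ext fun _ => rfl
  have h2 : vtx ((sMap f).app _ (T.toSSet.map θ x)) 0 = vtx (U.toSSet.map θ ((sMap f).app k x)) 0 :=
    congrArg (fun z => vtx z 0) h
  rw [h'] at h2
  exact h2.symm

/-- The edge of a necklace between two vertices of a bead. -/
def edge (T : Necklace.{u}) (a b : Fin (T.dim + 1)) (h : a ≤ b)
    (h' : ∀ j ∈ T.joints, j ≤ a ∨ b ≤ j) : T.toSSet.obj (op ⦋1⦌) :=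
  ofVtx ⟨![a, b], by
    rw [Fin.monotone_iff_le_succ]
    intro i
    fin_cases i
    exact h⟩ fun j hj => (h' j hj).symm.imp
      (fun hb i => by
        fin_cases i
        exacts [h.trans hb, hb])
      (fun ha i => by
        fin_cases i
        exacts [ha, ha.trans h])

theorem vertFun_edge (f : T ⟶ U) (a b : Fin (T.dim + 1)) (h : a ≤ b)
    (h' : ∀ j ∈ T.joints, j ≤ a ∨ b ≤ j) : vertFun f a ≤ vertFun f b ∧
      ∀ j ∈ U.joints, j ≤ vertFun f a ∨ vertFun f b ≤ j := by
  have e0 := vtx_app f (T.edge a b h h') 0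
  have e1 := vtx_app f (T.edge a b h h') 1
  have hm := (vtx ((sMap f).app _ (T.edge a b h h'))).monotone (show (0 : Fin 2) ≤ 1 by decide)
  refine ⟨?_, fun j hj => ?_⟩
  · rw [e0, e1] at hm
    exact hm
  · rcases vtx_joint ((sMap f).app _ (T.edge a b h h')) hj with h | h
    · exact Or.inr (e1.symm.trans_le (h 1))
    · exact Or.inl ((h 0).trans_eq e0)

/-- The monotone map on vertices induced by a map of necklaces. -/
def vert (f : T ⟶ U) : Fin (T.dim + 1) →o Fin (U.dim + 1) where
  toFun := vertFun f
  monotone' := by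
    rw [Fin.monotone_iff_le_succ]
    intro i
    refine (vertFun_edge f _ _ (Fin.castSucc_lt_succ).le fun j _ => ?_).1
    rcases le_or_gt j i.castSucc with h | h
    · exact Or.inl h
    · exact Or.inr (Fin.castSucc_lt_iff_succ_le.1 h)

theorem vtx_sMap (f : T ⟶ U) (x : T.toSSet.obj k) :
    vtx ((sMap f).app k x) = (vert f).comp (vtx x) := by
  ext i : 2
  exact vtx_app f x i

theorem vert_zero (f : T ⟶ U) : vert f 0 = 0 :=
  congrArg (fun x => vtx x 0) (incl.map f).map_src

theorem vert_last (f : T ⟶ U) : vert f (Fin.last _) = Fin.last _ :=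
  congrArg (fun x => vtx x 0) (incl.map f).map_tgt

theorem hom_ext {f g : T ⟶ U} (h : ∀ v, vert f v = vert g v) : f = g := by
  apply sMap_ext
  ext k x
  exact simplex_ext fun i => (vtx_app f x i).trans ((h _).trans (vtx_app g x i).symm)

/-- Every joint of the target of a map of necklaces is the image of a joint. -/
theorem exists_joint (f : T ⟶ U) {j} (hj : j ∈ U.joints) : ∃ i ∈ T.joints, vert f i = j := by
  have h1 : (T.joints.filter fun i => vert f i ≤ j).Nonempty :=
    ⟨0, Finset.mem_filter.2 ⟨T.zero_mem, by rw [vert_zero]; exact Fin.zero_le _⟩⟩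
  have h2 : (T.joints.filter fun i => j ≤ vert f i).Nonempty :=
    ⟨Fin.last _, Finset.mem_filter.2 ⟨T.last_mem, by rw [vert_last]; exact Fin.le_last _⟩⟩
  obtain ⟨ha, ha'⟩ := Finset.mem_filter.1 (Finset.max'_mem _ h1)
  obtain ⟨hb, hb'⟩ := Finset.mem_filter.1 (Finset.min'_mem _ h2)
  set a := (T.joints.filter fun i => vert f i ≤ j).max' h1 with hadef
  set b := (T.joints.filter fun i => j ≤ vert f i).min' h2 with hbdef
  rcases le_total b a with h | h
  · exact ⟨a, ha, le_antisymm ha' (hb'.trans ((vert f).monotone h))⟩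
  · have key := (vertFun_edge f a b h fun c hc => by
      rcases le_total (vert f c) j with h | h
      · exact Or.inl (Finset.le_max' _ _ (Finset.mem_filter.2 ⟨hc, h⟩))
      · exact Or.inr (Finset.min'_le _ _ (Finset.mem_filter.2 ⟨hc, h⟩))).2 j hj
    rcases key with h | h
    · exact ⟨a, ha, le_antisymm ha' h⟩
    · exact ⟨b, hb, le_antisymm h hb'⟩

theorem vert_id (T : Necklace.{u}) : vert (𝟙 T) = OrderHom.id := rfl

theorem vert_comp (f : T ⟶ U) (g : U ⟶ V) : vert (f ≫ g) = (vert g).comp (vert f) := by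
  ext v : 2
  exact vtx_app g _ 0

/-- A map of necklaces given by its effect on vertices. -/
noncomputable def homMk (g : Fin (T.dim + 1) →o Fin (U.dim + 1)) (h0 : g 0 = 0)
    (h1 : g (Fin.last _) = Fin.last _) (hg : ∀ j ∈ U.joints, ∃ i ∈ T.joints, g i = j) : T ⟶ U :=
  incl.preimage
    { map :=
        { app := fun k => ↾fun x : T.toSSet.obj k => (ofVtx (g.comp (vtx x)) fun j hj => by
            obtain ⟨i, hi, rfl⟩ := hg j hj
            exact (vtx_joint x hi).imp (fun h l => g.monotone (h l)) fun h l => g.monotone (h l) :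
              U.toSSet.obj k)
          naturality := fun k k' θ => by
            ext x
            rfl }
      map_src := simplex_ext fun _ => h0
      map_tgt := simplex_ext fun _ => h1 }

theorem vert_homMk (g : Fin (T.dim + 1) →o Fin (U.dim + 1)) (h0 h1) (hg) :
    vert (T := T) (U := U) (homMk g h0 h1 hg) = g := by
  unfold vert vertFun sMap homMk
  ext v : 2
  simp only [Functor.map_preimage]
  rfl

/-! ### The cube of a necklace -/

variable (T) in
/-- The vertices that are not joints. -/
def nonjoints : Finset (Fin (T.dim + 1)) := Finset.univ \ T.joints

variable (T) in
/-- The increasing enumeration of the vertices that are not joints. -/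
def beadVertex (i : Fin T.nonjoints.card) : Fin (T.dim + 1) := T.nonjoints.orderEmbOfFin rfl i

theorem beadVertex_notMem (i : Fin T.nonjoints.card) : T.beadVertex i ∉ T.joints :=
  (Finset.mem_sdiff.1 (T.nonjoints.orderEmbOfFin_mem rfl i)).2

theorem beadVertex_le {i j : Fin T.nonjoints.card} :
    T.beadVertex i ≤ T.beadVertex j ↔ i ≤ j := (T.nonjoints.orderEmbOfFin rfl).le_iff_le

theorem exists_beadVertex {v : Fin (T.dim + 1)} (hv : v ∉ T.joints) :
    ∃ i, T.beadVertex i = v := by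
  have h : v ∈ Set.range (T.nonjoints.orderEmbOfFin rfl) := by
    rw [Finset.range_orderEmbOfFin]
    exact Finset.mem_coe.2 (Finset.mem_sdiff.2 ⟨Finset.mem_univ _, hv⟩)
  exact h

variable (T) in
/-- The poset `P(T)` of sets of vertices that contain all joints. -/
def VertexSets : Type := {X : Finset (Fin (T.dim + 1)) // T.joints ⊆ X}

instance : PartialOrder (VertexSets T) :=
  inferInstanceAs (PartialOrder {X : Finset (Fin (T.dim + 1)) // T.joints ⊆ X})

/-- The isomorphism of posets between `P(T)` and the cube whose coordinates are the vertices that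
are not joints, in increasing order. -/
def cubeEquiv (T : Necklace.{u}) : VertexSets T ≃o Cube T.nonjoints.card where
  toFun X i := decide (T.beadVertex i ∈ X.1)
  invFun s := ⟨T.joints ∪ (Finset.univ.filter fun i => s i = true).image T.beadVertex,
    Finset.subset_union_left⟩
  left_inv X := by
    refine Subtype.ext (Finset.ext fun v => ?_)
    simp only [Finset.mem_union, Finset.mem_image, Finset.mem_filter, Finset.mem_univ, true_and,
      decide_eq_true_eq]
    constructor
    · rintro (h | ⟨i, h, rfl⟩)
      exacts [X.2 h, h]
    · intro h
      by_cases hv : v ∈ T.joints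
      · exact Or.inl hv
      · obtain ⟨i, rfl⟩ := exists_beadVertex hv
        exact Or.inr ⟨i, h, rfl⟩
  right_inv s := by
    funext i
    rw [Bool.eq_iff_iff]
    simp only [decide_eq_true_eq, Finset.mem_union, Finset.mem_image, Finset.mem_filter,
      Finset.mem_univ, true_and]
    constructor
    · rintro (h | ⟨j, h, e⟩)
      · exact absurd h (beadVertex_notMem i)
      · rwa [← (T.nonjoints.orderEmbOfFin rfl).injective e]
    · exact fun h => Or.inr ⟨i, h, rfl⟩
  map_rel_iff' {X Y} := by
    constructor
    · intro h v hv
      by_cases hv' : v ∈ T.joints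
      · exact Y.2 hv'
      · obtain ⟨i, rfl⟩ := exists_beadVertex hv'
        exact of_decide_eq_true (h i (decide_eq_true hv))
    · intro h i hi
      exact decide_eq_true (h (of_decide_eq_true hi))

/-- The monotone map `P(T) → P(U)`, `X ↦ f(X)`. -/
def imageSets (f : T ⟶ U) : VertexSets T →o VertexSets U where
  toFun X := ⟨X.1.image (vert f), fun j hj => by
    obtain ⟨i, hi, rfl⟩ := exists_joint f hj
    exact Finset.mem_image_of_mem _ (X.2 hi)⟩
  monotone' X Y h := Finset.image_subset_image (show X.1 ⊆ Y.1 from h)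

theorem imageSets_id (T : Necklace.{u}) : imageSets (𝟙 T) = OrderHom.id := by
  ext X : 2
  exact Subtype.ext Finset.image_id

theorem imageSets_comp (f : T ⟶ U) (g : U ⟶ V) :
    imageSets (f ≫ g) = (imageSets g).comp (imageSets f) := by
  ext X : 2
  refine Subtype.ext ?_
  change X.1.image (vert (f ≫ g)) = (X.1.image (vert f)).image (vert g)
  rw [Finset.image_image, vert_comp]
  rfl

/-- The map of cubes induced by a map of necklaces. -/
def cubeMap (f : T ⟶ U) : Cube T.nonjoints.card →o Cube U.nonjoints.card :=
  (OrderHomClass.toOrderHom U.cubeEquiv).comp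
    ((imageSets f).comp (OrderHomClass.toOrderHom T.cubeEquiv.symm))

theorem cubeMap_apply (f : T ⟶ U) (s : Cube T.nonjoints.card) (i : Fin U.nonjoints.card) :
    cubeMap f s i = true ↔ (∃ v ∈ T.joints, vert f v = U.beadVertex i) ∨
      ∃ k, vert f (T.beadVertex k) = U.beadVertex i ∧ s k = true := by
  change decide (U.beadVertex i ∈ (T.joints ∪ (Finset.univ.filter fun i => s i = true).image
    T.beadVertex).image (vert f)) = true ↔ _
  simp only [decide_eq_true_eq, Finset.mem_image, Finset.mem_union, Finset.mem_filter,
    Finset.mem_univ, true_and]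
  constructor
  · rintro ⟨v, h | ⟨k, hk, rfl⟩, e⟩
    exacts [Or.inl ⟨v, h, e⟩, Or.inr ⟨k, e, hk⟩]
  · rintro (⟨v, h, e⟩ | ⟨k, e, hk⟩)
    exacts [⟨v, Or.inl h, e⟩, ⟨_, Or.inr ⟨k, hk, rfl⟩, e⟩]

theorem isCubical_cubeMap (f : T ⟶ U) : IsCubical (cubeMap f) := by
  refine HasMaxForm.isCubical ⟨fun k i => vert f (T.beadVertex k) = U.beadVertex i,
    fun i => decide (∃ v ∈ T.joints, vert f v = U.beadVertex i), ?_, ?_⟩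
  · intro k k' i i' h h1 h2
    rw [← beadVertex_le, ← h1, ← h2]
    exact (vert f).monotone (beadVertex_le.2 h)
  · intro s i
    rw [cubeMap_apply, decide_eq_true_eq]

/-- The functor that sends a necklace `T` to the cube with one coordinate for each vertex of `T` that
is not a joint, that is, to the cube isomorphic to `P(T)`, and a map `f` to `X ↦ f(X)`. -/
def toCube : Necklace.{u} ⥤ CubeCat where
  obj T := ⟨T.nonjoints.card⟩
  map f := ⟨cubeMap f, isCubical_cubeMap f⟩
  map_id T := CubeCat.Hom.ext (by
    ext s : 2
    change T.cubeEquiv (imageSets (𝟙 T) (T.cubeEquiv.symm s)) = s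
    rw [imageSets_id]
    exact OrderIso.apply_symm_apply _ _)
  map_comp {T U V} f g := CubeCat.Hom.ext (by
    ext s : 2
    change V.cubeEquiv (imageSets (f ≫ g) (T.cubeEquiv.symm s)) = V.cubeEquiv (imageSets g
      (U.cubeEquiv.symm (U.cubeEquiv (imageSets f (T.cubeEquiv.symm s)))))
    rw [imageSets_comp, OrderIso.symm_apply_apply]
    rfl)

/-- The functor that sends a necklace to the standard cubical set of its cube. -/
def cubicalSet : Necklace.{u} ⥤ CubeCatᵒᵖ ⥤ Type u := toCube ⋙ uliftYoneda.{u}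

end Necklace

namespace Necklace
variable {T T' U U' V : Necklace.{u}} {k k' : SimplexCategoryᵒᵖ} {S S' : SSet.{u}}

/-! ### Concatenation of necklaces -/

/-- The concatenation `T ∨ U`, which identifies the last vertex of `T` with the first vertex of
`U`. -/
def wedge (T U : Necklace.{u}) : Necklace.{u} where
  dim := T.dim + U.dim
  joints := T.joints.image (fun v => ⟨v.1, by omega⟩) ∪
    U.joints.image fun v => ⟨T.dim + v.1, by omega⟩
  zero_mem := Finset.mem_union_left _ (Finset.mem_image.2 ⟨0, T.zero_mem, rfl⟩)
  last_mem := Finset.mem_union_right _ (Finset.mem_image.2 ⟨Fin.last _, U.last_mem, rfl⟩)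

theorem wedge_dim : (T.wedge U).dim = T.dim + U.dim := rfl

/-- The inclusion of the vertices of `T` into those of `T ∨ U`. -/
def inlV (T U : Necklace.{u}) : Fin (T.dim + 1) →o Fin ((T.wedge U).dim + 1) where
  toFun v := ⟨v, by rw [wedge_dim]; omega⟩
  monotone' _ _ h := h

/-- The inclusion of the vertices of `U` into those of `T ∨ U`. -/
def inrV (T U : Necklace.{u}) : Fin (U.dim + 1) →o Fin ((T.wedge U).dim + 1) where
  toFun v := ⟨T.dim + v, by rw [wedge_dim]; omega⟩
  monotone' _ _ h := Nat.add_le_add_left (show _ ≤ _ from h) _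

theorem inlV_injective : Function.Injective (inlV T U) := fun v w h =>
  Fin.ext (show (inlV T U v).val = (inlV T U w).val from congrArg Fin.val h)

theorem inrV_injective : Function.Injective (inrV T U) := fun v w h =>
  Fin.ext (Nat.add_left_cancel (show (inrV T U v).val = (inrV T U w).val from congrArg Fin.val h))

theorem inlV_last_eq : inlV T U (Fin.last _) = inrV T U 0 := rfl

theorem inlV_eq_inrV {v : Fin (T.dim + 1)} {w : Fin (U.dim + 1)} (h : inlV T U v = inrV T U w) :
    v = Fin.last _ ∧ w = 0 := by
  have h : (v : ℕ) = T.dim + w := congrArg Fin.val h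
  refine ⟨Fin.ext ?_, Fin.ext ?_⟩
  · simp only [Fin.val_last]; omega
  · simp only [Fin.val_zero]; omega

theorem inlV_le_inrV (v : Fin (T.dim + 1)) (w : Fin (U.dim + 1)) : inlV T U v ≤ inrV T U w :=
  show (v : ℕ) ≤ T.dim + w by omega

theorem exists_inlV {v : Fin ((T.wedge U).dim + 1)} (h : v ≤ inlV T U (Fin.last _)) :
    ∃ w, inlV T U w = v := by
  have h : (v : ℕ) ≤ T.dim := h
  exact ⟨⟨v, by omega⟩, rfl⟩

theorem exists_inrV {v : Fin ((T.wedge U).dim + 1)} (h : inlV T U (Fin.last _) ≤ v) :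
    ∃ w, inrV T U w = v := by
  have h : T.dim ≤ (v : ℕ) := h
  have h2 : (v : ℕ) < T.dim + U.dim + 1 := v.2
  exact ⟨⟨v - T.dim, by omega⟩, Fin.ext (show T.dim + (v - T.dim) = (v : ℕ) by omega)⟩

theorem inl_or_inr (v : Fin ((T.wedge U).dim + 1)) : (∃ w, inlV T U w = v) ∨ ∃ w, inrV T U w = v :=
  (le_total v (inlV T U (Fin.last _))).imp exists_inlV exists_inrV

theorem mem_wedge_joints {v : Fin ((T.wedge U).dim + 1)} : v ∈ (T.wedge U).joints ↔
    (∃ a ∈ T.joints, inlV T U a = v) ∨ ∃ a ∈ U.joints, inrV T U a = v := by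
  change v ∈ T.joints.image (inlV T U) ∪ U.joints.image (inrV T U) ↔ _
  rw [Finset.mem_union, Finset.mem_image, Finset.mem_image]

theorem inlV_mem {v : Fin (T.dim + 1)} : inlV T U v ∈ (T.wedge U).joints ↔ v ∈ T.joints := by
  rw [mem_wedge_joints]
  constructor
  · rintro (⟨a, ha, h⟩ | ⟨a, ha, h⟩)
    · rwa [← inlV_injective h]
    · rw [(inlV_eq_inrV h.symm).1]
      exact T.last_mem
  · exact fun h => Or.inl ⟨v, h, rfl⟩

theorem inrV_mem {v : Fin (U.dim + 1)} : inrV T U v ∈ (T.wedge U).joints ↔ v ∈ U.joints := by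
  rw [mem_wedge_joints]
  constructor
  · rintro (⟨a, ha, h⟩ | ⟨a, ha, h⟩)
    · rw [(inlV_eq_inrV h).2]
      exact U.zero_mem
    · rwa [← inrV_injective h]
  · exact fun h => Or.inr ⟨v, h, rfl⟩

/-- The inclusion of `T` into `T ∨ U`. -/
def inl (T U : Necklace.{u}) : T.toSSet ⟶ (T.wedge U).toSSet where
  app k := ↾fun x : T.toSSet.obj k => (ofVtx ((inlV T U).comp (vtx x)) fun j hj => by
    rcases mem_wedge_joints.1 hj with ⟨a, ha, rfl⟩ | ⟨a, ha, rfl⟩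
    · exact vtx_joint x ha
    · exact Or.inl fun i => inlV_le_inrV _ _ : (T.wedge U).toSSet.obj k)
  naturality k k' θ := by
    ext x
    rfl

/-- The inclusion of `U` into `T ∨ U`. -/
def inr (T U : Necklace.{u}) : U.toSSet ⟶ (T.wedge U).toSSet where
  app k := ↾fun x : U.toSSet.obj k => (ofVtx ((inrV T U).comp (vtx x)) fun j hj => by
    rcases mem_wedge_joints.1 hj with ⟨a, ha, rfl⟩ | ⟨a, ha, rfl⟩
    · exact Or.inr fun i => inlV_le_inrV _ _
    · exact (vtx_joint x ha).imp (fun h i => (inrV T U).monotone (h i))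
        fun h i => (inrV T U).monotone (h i) : (T.wedge U).toSSet.obj k)
  naturality k k' θ := by
    ext x
    rfl

theorem vtx_inl (x : T.toSSet.obj k) : vtx ((inl T U).app k x) = (inlV T U).comp (vtx x) := rfl

theorem vtx_inr (x : U.toSSet.obj k) : vtx ((inr T U).app k x) = (inrV T U).comp (vtx x) := rfl

/-- The collapse of `T ∨ U` onto `T`. -/
noncomputable def projL (T U : Necklace.{u}) : T.wedge U ⟶ T :=
  homMk ⟨fun v => ⟨min v T.dim, by omega⟩, fun v w h => by
      have h : (v : ℕ) ≤ w := h
      exact Fin.le_def.2 (by dsimp only; omega)⟩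
    (Fin.ext (Nat.zero_min _)) (Fin.ext (show min (T.dim + U.dim) T.dim = T.dim by omega)) fun j hj =>
      ⟨inlV T U j, inlV_mem.2 hj, Fin.ext (show min (j : ℕ) T.dim = j by omega)⟩

/-- The collapse of `T ∨ U` onto `U`. -/
noncomputable def projR (T U : Necklace.{u}) : T.wedge U ⟶ U :=
  homMk ⟨fun v => ⟨v - T.dim, by
      have : (v : ℕ) < T.dim + U.dim + 1 := v.2
      omega⟩, fun v w h => by
      have h : (v : ℕ) ≤ w := h
      exact Fin.le_def.2 (by dsimp only; omega)⟩
    (Fin.ext (Nat.zero_sub _)) (Fin.ext (show T.dim + U.dim - T.dim = U.dim by omega)) fun j hj =>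
      ⟨inrV T U j, inrV_mem.2 hj, Fin.ext (show T.dim + (j : ℕ) - T.dim = j by omega)⟩

theorem vert_projL_inlV (v : Fin (T.dim + 1)) : vert (projL T U) (inlV T U v) = v := by
  unfold projL
  rw [vert_homMk]
  exact Fin.ext (show min (v : ℕ) T.dim = v by omega)

theorem vert_projR_inrV (v : Fin (U.dim + 1)) : vert (projR T U) (inrV T U v) = v := by
  unfold projR
  rw [vert_homMk]
  exact Fin.ext (show T.dim + (v : ℕ) - T.dim = v by omega)

theorem projL_inl (x : T.toSSet.obj k) : (sMap (projL T U)).app k ((inl T U).app k x) = x :=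
  simplex_ext fun i => (vtx_app _ _ i).trans (vert_projL_inlV _)

theorem projR_inr (x : U.toSSet.obj k) : (sMap (projR T U)).app k ((inr T U).app k x) = x :=
  simplex_ext fun i => (vtx_app _ _ i).trans (vert_projR_inrV _)

theorem eq_inl (x : (T.wedge U).toSSet.obj k) (h : ∀ i, vtx x i ≤ inlV T U (Fin.last _)) :
    x = (inl T U).app k ((sMap (projL T U)).app k x) :=
  simplex_ext fun i => by
    obtain ⟨w, hw⟩ := exists_inlV (h i)
    refine Eq.trans ?_ (congrArg (inlV T U) (vtx_app (projL T U) x i)).symm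
    refine hw.symm.trans (congrArg (inlV T U) ?_)
    exact (vert_projL_inlV w).symm.trans (congrArg (vert (projL T U)) hw)

theorem eq_inr (x : (T.wedge U).toSSet.obj k) (h : ∀ i, inlV T U (Fin.last _) ≤ vtx x i) :
    x = (inr T U).app k ((sMap (projR T U)).app k x) :=
  simplex_ext fun i => by
    obtain ⟨w, hw⟩ := exists_inrV (h i)
    refine Eq.trans ?_ (congrArg (inrV T U) (vtx_app (projR T U) x i)).symm
    refine hw.symm.trans (congrArg (inrV T U) ?_)
    exact (vert_projR_inrV w).symm.trans (congrArg (vert (projR T U)) hw)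

theorem exists_inl_or_inr (x : (T.wedge U).toSSet.obj k) :
    (∃ y, x = (inl T U).app k y) ∨ ∃ y, x = (inr T U).app k y :=
  (vtx_joint x (inlV_mem.2 T.last_mem)).imp (fun h => ⟨_, eq_inl x h⟩) fun h => ⟨_, eq_inr x h⟩

theorem wedge_hom_ext {φ ψ : (T.wedge U).toSSet ⟶ S} (hl : inl T U ≫ φ = inl T U ≫ ψ)
    (hr : inr T U ≫ φ = inr T U ≫ ψ) : φ = ψ := by
  ext k x
  rcases exists_inl_or_inr x with ⟨y, rfl⟩ | ⟨y, rfl⟩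
  · exact ConcreteCategory.congr_hom (congrArg (fun t => NatTrans.app t k) hl) y
  · exact ConcreteCategory.congr_hom (congrArg (fun t => NatTrans.app t k) hr) y

theorem const_eq (v : Fin (T.dim + 1)) : T.const k v =
    T.toSSet.map (SimplexCategory.const k.unop ⦋0⦌ 0).op (T.const (op ⦋0⦌) v) := rfl

theorem app_const (t : T.toSSet ⟶ S) (v : Fin (T.dim + 1)) : t.app k (T.const k v) =
    S.map (SimplexCategory.const k.unop ⦋0⦌ 0).op (t.app _ (T.const (op ⦋0⦌) v)) :=
  (congrArg _ (const_eq v)).trans (ConcreteCategory.congr_hom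
    (t.naturality (SimplexCategory.const k.unop ⦋0⦌ 0).op) (T.const (op ⦋0⦌) v))

section desc
variable (t : T.toSSet ⟶ S) (u : U.toSSet ⟶ S)

open Classical in
/-- The underlying function of `desc`. -/
noncomputable def descFun (k : SimplexCategoryᵒᵖ) (x : (T.wedge U).toSSet.obj k) : S.obj k :=
  if ∀ i, vtx x i ≤ inlV T U (Fin.last _) then t.app k ((sMap (projL T U)).app k x)
  else u.app k ((sMap (projR T U)).app k x)

theorem descFun_inl (x : T.toSSet.obj k) : descFun t u k ((inl T U).app k x) = t.app k x :=
  (if_pos fun _ => (inlV T U).monotone (Fin.le_last _)).trans (congrArg _ (projL_inl x))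

theorem descFun_inr
    (h : t.app (op ⦋0⦌) (T.const _ (Fin.last _)) = u.app (op ⦋0⦌) (U.const _ 0)) (x : U.toSSet.obj k) : descFun t u k ((inr T U).app k x) = u.app k x := by
  by_cases hx : ∀ i, vtx ((inr T U).app k x) i ≤ inlV T U (Fin.last _)
  · have e1 : x = U.const k 0 := simplex_ext fun i =>
      (inlV_eq_inrV (le_antisymm (inlV_le_inrV _ _) (hx i))).2
    have e2 : (inr T U).app k x = (inl T U).app k (T.const k (Fin.last _)) := by
      rw [e1]
      exact simplex_ext fun i => rfl
    rw [e2, descFun_inl, e1, app_const, h]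
    exact (app_const u 0).symm
  · exact (if_neg hx).trans (congrArg _ (projR_inr x))

/-- The map out of `T ∨ U` given by maps out of `T` and `U` that agree on the common vertex. -/
noncomputable def desc
    (h : t.app (op ⦋0⦌) (T.const _ (Fin.last _)) = u.app (op ⦋0⦌) (U.const _ 0)) : (T.wedge U).toSSet ⟶ S where
  app k := ↾descFun t u k
  naturality k k' θ := by
    ext x
    change descFun t u k' ((T.wedge U).toSSet.map θ x) = S.map θ (descFun t u k x)
    rcases exists_inl_or_inr x with ⟨y, rfl⟩ | ⟨y, rfl⟩
    · rw [descFun_inl]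
      refine Eq.trans ?_ (ConcreteCategory.congr_hom (t.naturality θ) y)
      exact descFun_inl t u (T.toSSet.map θ y)
    · rw [descFun_inr t u h]
      refine Eq.trans ?_ (ConcreteCategory.congr_hom (u.naturality θ) y)
      exact descFun_inr t u h (U.toSSet.map θ y)

theorem inl_desc
    (h : t.app (op ⦋0⦌) (T.const _ (Fin.last _)) = u.app (op ⦋0⦌) (U.const _ 0)) : inl T U ≫ desc t u h = t := by
  ext k x
  exact descFun_inl t u x

theorem inr_desc
    (h : t.app (op ⦋0⦌) (T.const _ (Fin.last _)) = u.app (op ⦋0⦌) (U.const _ 0)) : inr T U ≫ desc t u h = u := by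
  ext k x
  exact descFun_inr t u h x

end desc

section join
variable {x y z w : S _⦋0⦌}

/-- The map out of `T ∨ U` given by maps from `T` and `U` to the same simplicial set, the first of
which ends where the second begins. -/
noncomputable def join (t : incl.obj T ⟶ ⟨S, x, y⟩) (u : incl.obj U ⟶ ⟨S, y, z⟩) :
    incl.obj (T.wedge U) ⟶ ⟨S, x, z⟩ where
  map := desc t.map u.map (t.map_tgt.trans u.map_src.symm)
  map_src := by
    refine Eq.trans ?_ t.map_src
    refine Eq.trans ?_ (ConcreteCategory.congr_hom
      (congrArg (fun f => NatTrans.app f (op ⦋0⦌))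
        (inl_desc t.map u.map (t.map_tgt.trans u.map_src.symm))) (T.const _ 0))
    rfl
  map_tgt := by
    refine Eq.trans ?_ u.map_tgt
    refine Eq.trans ?_ (ConcreteCategory.congr_hom
      (congrArg (fun f => NatTrans.app f (op ⦋0⦌))
        (inr_desc t.map u.map (t.map_tgt.trans u.map_src.symm))) (U.const _ (Fin.last _)))
    rfl

theorem inl_join (t : incl.obj T ⟶ ⟨S, x, y⟩) (u : incl.obj U ⟶ ⟨S, y, z⟩) :
    inl T U ≫ (join t u).map = t.map := inl_desc _ _ (t.map_tgt.trans u.map_src.symm)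

theorem inr_join (t : incl.obj T ⟶ ⟨S, x, y⟩) (u : incl.obj U ⟶ ⟨S, y, z⟩) :
    inr T U ≫ (join t u).map = u.map := inr_desc _ _ (t.map_tgt.trans u.map_src.symm)

theorem join_ext {f g : incl.obj (T.wedge U) ⟶ ⟨S, x, z⟩}
    (hl : inl T U ≫ f.map = inl T U ≫ g.map) (hr : inr T U ≫ f.map = inr T U ≫ g.map) : f = g :=
  BipointedSSet.Hom.ext (wedge_hom_ext hl hr)

theorem join_comp (t : incl.obj T ⟶ ⟨S, x, y⟩) (u : incl.obj U ⟶ ⟨S, y, z⟩) (φ : S ⟶ S') :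
    join t u ≫ (⟨φ, rfl, rfl⟩ : BipointedSSet.Hom ⟨S, x, z⟩ ⟨S', φ.app _ x, φ.app _ z⟩) =
      join (t ≫ (⟨φ, rfl, rfl⟩ : BipointedSSet.Hom ⟨S, x, y⟩ ⟨S', φ.app _ x, φ.app _ y⟩))
        (u ≫ (⟨φ, rfl, rfl⟩ : BipointedSSet.Hom ⟨S, y, z⟩ ⟨S', φ.app _ y, φ.app _ z⟩)) := by
  apply join_ext
  · rw [inl_join]
    exact congrArg (· ≫ φ) (inl_join t u)
  · rw [inr_join]
    exact congrArg (· ≫ φ) (inr_join t u)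

end join

theorem inl_src : (inl T U).app (op ⦋0⦌) (T.const _ 0) = (T.wedge U).const _ 0 := rfl

theorem inr_tgt : (inr T U).app (op ⦋0⦌) (U.const _ (Fin.last _)) =
    (T.wedge U).const _ (Fin.last _) := rfl

/-- The functoriality of `T ∨ U`. -/
noncomputable def wedgeMap (f : T ⟶ T') (g : U ⟶ U') : T.wedge U ⟶ T'.wedge U' :=
  incl.preimage (show incl.obj (T.wedge U) ⟶ incl.obj (T'.wedge U') from join
    (y := (inl T' U').app _ (T'.const _ (Fin.last _)))
    (⟨sMap f ≫ inl T' U', congrArg ((inl T' U').app _) (incl.map f).map_src,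
      congrArg ((inl T' U').app _) (incl.map f).map_tgt⟩ : BipointedSSet.Hom _ _)
    (⟨sMap g ≫ inr T' U', congrArg ((inr T' U').app _) (incl.map g).map_src,
      congrArg ((inr T' U').app _) (incl.map g).map_tgt⟩ : BipointedSSet.Hom _ _))

theorem inl_wedgeMap (f : T ⟶ T') (g : U ⟶ U') :
    inl T U ≫ sMap (wedgeMap f g) = sMap f ≫ inl T' U' := by
  unfold wedgeMap sMap
  rw [Functor.map_preimage]
  exact inl_join _ _

theorem inr_wedgeMap (f : T ⟶ T') (g : U ⟶ U') :
    inr T U ≫ sMap (wedgeMap f g) = sMap g ≫ inr T' U' := by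
  unfold wedgeMap sMap
  rw [Functor.map_preimage]
  exact inr_join _ _

theorem wedgeMap_inl (f : T ⟶ T') (g : U ⟶ U') (x : T.toSSet.obj k) :
    (sMap (wedgeMap f g)).app k ((inl T U).app k x) = (inl T' U').app k ((sMap f).app k x) :=
  ConcreteCategory.congr_hom (congrArg (fun φ => NatTrans.app φ k) (inl_wedgeMap f g)) x

theorem vert_wedgeMap_inlV (f : T ⟶ T') (g : U ⟶ U') (v) :
    vert (wedgeMap f g) (inlV T U v) = inlV T' U' (vert f v) := by
  have h := vtx_app (wedgeMap f g) ((inl T U).app _ (T.const (op ⦋0⦌) v)) 0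
  rw [wedgeMap_inl] at h
  generalize wedgeMap f g = w at h ⊢
  exact h.symm

theorem wedgeMap_inr (f : T ⟶ T') (g : U ⟶ U') (x : U.toSSet.obj k) :
    (sMap (wedgeMap f g)).app k ((inr T U).app k x) = (inr T' U').app k ((sMap g).app k x) :=
  ConcreteCategory.congr_hom (congrArg (fun φ => NatTrans.app φ k) (inr_wedgeMap f g)) x

theorem vert_wedgeMap_inrV (f : T ⟶ T') (g : U ⟶ U') (v) :
    vert (wedgeMap f g) (inrV T U v) = inrV T' U' (vert g v) := by
  have h := vtx_app (wedgeMap f g) ((inr T U).app _ (U.const (op ⦋0⦌) v)) 0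
  rw [wedgeMap_inr] at h
  generalize wedgeMap f g = w at h ⊢
  exact h.symm

theorem wedgeMap_join {x y z : S _⦋0⦌} (f : T ⟶ T') (g : U ⟶ U')
    (t : incl.obj T' ⟶ ⟨S, x, y⟩) (u : incl.obj U' ⟶ ⟨S, y, z⟩) :
    incl.map (wedgeMap f g) ≫ join t u = join (incl.map f ≫ t) (incl.map g ≫ u) := by
  apply join_ext
  · rw [inl_join]
    refine (congrArg (· ≫ (join t u).map) (inl_wedgeMap f g)).trans ?_
    exact congrArg (sMap f ≫ ·) (inl_join t u)
  · rw [inr_join]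
    refine (congrArg (· ≫ (join t u).map) (inr_wedgeMap f g)).trans ?_
    exact congrArg (sMap g ≫ ·) (inr_join t u)

/-! ### Equalities between concatenations -/

theorem eq_of_joints (h : T.dim = U.dim)
    (h' : ∀ n : ℕ, (∃ v ∈ T.joints, v.val = n) ↔ ∃ v ∈ U.joints, v.val = n) : T = U := by
  obtain ⟨N, I, _, _⟩ := T
  obtain ⟨N', J, _, _⟩ := U
  obtain rfl : N = N' := h
  obtain rfl : I = J := by
    ext v
    constructor
    · intro hv
      obtain ⟨w, hw, e⟩ := (h' v).1 ⟨v, hv, rfl⟩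
      rwa [← Fin.ext e]
    · intro hv
      obtain ⟨w, hw, e⟩ := (h' v).2 ⟨v, hv, rfl⟩
      rwa [← Fin.ext e]
  rfl

theorem exists_wedge_joint (n : ℕ) : (∃ v ∈ (T.wedge U).joints, v.val = n) ↔
    (∃ v ∈ T.joints, v.val = n) ∨ ∃ v ∈ U.joints, T.dim + v.val = n := by
  constructor
  · rintro ⟨v, hv, rfl⟩
    rcases mem_wedge_joints.1 hv with ⟨a, ha, rfl⟩ | ⟨a, ha, rfl⟩
    exacts [Or.inl ⟨a, ha, rfl⟩, Or.inr ⟨a, ha, rfl⟩]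
  · rintro (⟨a, ha, rfl⟩ | ⟨a, ha, rfl⟩)
    exacts [⟨_, inlV_mem.2 ha, rfl⟩, ⟨_, inrV_mem.2 ha, rfl⟩]

theorem wedge_assoc (T U V : Necklace.{u}) : (T.wedge U).wedge V = T.wedge (U.wedge V) := by
  refine eq_of_joints (Nat.add_assoc _ _ _) fun n => ?_
  simp only [exists_wedge_joint, or_assoc]
  refine or_congr Iff.rfl ?_
  constructor
  · rintro (⟨v, hv, h⟩ | ⟨v, hv, h⟩)
    · exact ⟨_, inlV_mem.2 hv, h⟩
    · exact ⟨_, inrV_mem.2 hv, (Nat.add_assoc _ _ _).symm.trans h⟩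
  · rintro ⟨v, hv, h⟩
    rcases mem_wedge_joints.1 hv with ⟨a, ha, rfl⟩ | ⟨a, ha, rfl⟩
    exacts [Or.inl ⟨a, ha, h⟩, Or.inr ⟨a, ha, (Nat.add_assoc _ _ _).trans h⟩]

/-- The necklace `Δ⁰`. -/
def point : Necklace.{u} where
  dim := 0
  joints := Finset.univ
  zero_mem := Finset.mem_univ _
  last_mem := Finset.mem_univ _

theorem point_wedge (T : Necklace.{u}) : point.wedge T = T := by
  refine eq_of_joints (Nat.zero_add _) fun n => ?_
  rw [exists_wedge_joint]
  constructor
  · rintro (⟨v, -, h⟩ | ⟨v, hv, h⟩)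
    · exact ⟨0, T.zero_mem, by
        have h2 : v.val < 1 := v.2
        rw [Fin.val_zero]
        omega⟩
    · exact ⟨v, hv, (Nat.zero_add _).symm.trans h⟩
  · rintro ⟨v, hv, h⟩
    exact Or.inr ⟨v, hv, (Nat.zero_add _).trans h⟩

theorem wedge_point (T : Necklace.{u}) : T.wedge point = T := by
  refine eq_of_joints (Nat.add_zero _) fun n => ?_
  rw [exists_wedge_joint]
  constructor
  · rintro (⟨v, hv, h⟩ | ⟨v, -, h⟩)
    · exact ⟨v, hv, h⟩
    · exact ⟨Fin.last _, T.last_mem, by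
        have h2 : v.val < 1 := v.2
        rw [Fin.val_last]
        omega⟩
  · rintro ⟨v, hv, h⟩
    exact Or.inl ⟨v, hv, h⟩

theorem vert_eqToHom (h : T = U) (v : Fin (T.dim + 1)) : (vert (eqToHom h) v).val = v.val := by
  subst h
  rfl

theorem toCube_eqToHom (h : T = U) : toCube.map (eqToHom h) =
    (CubeCat.castIso (congrArg (fun T => (toCube.obj T).dim) h)).hom := by
  subst h
  exact toCube.map_id _

theorem sMap_eqToHom_apply (h : T = U) (x : T.toSSet.obj k) (y : U.toSSet.obj k)
    (hxy : ∀ i, (vtx x i).val = (vtx y i).val) : (sMap (eqToHom h)).app k x = y :=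
  simplex_ext fun i => Fin.ext ((congrArg Fin.val (vtx_app _ x i)).trans
    ((vert_eqToHom h _).trans (hxy i)))

section
variable {x y z w : S _⦋0⦌}

theorem join_assoc (t : incl.obj T ⟶ ⟨S, w, x⟩) (u : incl.obj U ⟶ ⟨S, x, y⟩)
    (v : incl.obj V ⟶ ⟨S, y, z⟩) :
    incl.map (eqToHom (wedge_assoc T U V)) ≫ join t (join u v) = join (join t u) v := by
  apply join_ext
  · rw [inl_join]
    apply wedge_hom_ext
    · rw [inl_join]
      refine Eq.trans ?_ (inl_join t (join u v))
      ext k s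
      refine congrArg ((join t (join u v)).map.app k) (sMap_eqToHom_apply _ _ _ fun i => ?_)
      rfl
    · rw [inr_join]
      refine Eq.trans ?_ ((congrArg (inl U V ≫ ·) (inr_join t (join u v))).trans (inl_join u v))
      ext k s
      refine congrArg ((join t (join u v)).map.app k) (sMap_eqToHom_apply _ _ _ fun i => ?_)
      rfl
  · rw [inr_join]
    refine Eq.trans ?_ ((congrArg (inr U V ≫ ·) (inr_join t (join u v))).trans (inr_join u v))
    ext k s
    refine congrArg ((join t (join u v)).map.app k) (sMap_eqToHom_apply _ _ _ fun i => ?_)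
    exact Nat.add_assoc _ _ _

/-- The map from `Δ⁰` that picks out a vertex. -/
def pointMap (S : SSet.{u}) (x : S _⦋0⦌) : incl.obj point.{u} ⟶ ⟨S, x, x⟩ where
  map :=
    { app := fun k => ↾fun _ => S.map (SimplexCategory.const k.unop ⦋0⦌ 0).op x
      naturality := fun k k' θ => by
        ext _
        exact ConcreteCategory.congr_hom
          (S.map_comp (SimplexCategory.const k.unop ⦋0⦌ 0).op θ) x }
  map_src := by
    change S.map (SimplexCategory.const ⦋0⦌ ⦋0⦌ 0).op x = x
    rw [SimplexCategory.const_eq_id]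
    exact ConcreteCategory.congr_hom (S.map_id (op ⦋0⦌)) x
  map_tgt := by
    change S.map (SimplexCategory.const ⦋0⦌ ⦋0⦌ 0).op x = x
    rw [SimplexCategory.const_eq_id]
    exact ConcreteCategory.congr_hom (S.map_id (op ⦋0⦌)) x

theorem eq_point_const (s : point.{u}.toSSet.obj k) : s = point.const k 0 :=
  simplex_ext fun i => Fin.ext (by
    have h1 : (vtx s i).val < 1 := (vtx s i).2
    have h2 : (vtx (point.{u}.const k 0) i).val < 1 := (vtx (point.{u}.const k 0) i).2
    omega)

theorem point_hom_ext {f g : point.{u}.toSSet ⟶ S}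
    (h : f.app (op ⦋0⦌) (point.const _ 0) = g.app (op ⦋0⦌) (point.const _ 0)) : f = g := by
  ext k s
  obtain rfl := eq_point_const s
  exact (app_const f 0).trans ((congrArg _ h).trans (app_const g 0).symm)

theorem pointMap_join (t : incl.obj T ⟶ ⟨S, x, y⟩) :
    incl.map (eqToHom (point_wedge T)) ≫ t = join (pointMap S x) t := by
  apply join_ext
  · rw [inl_join]
    apply point_hom_ext
    refine Eq.trans ?_ (t.map_src.trans (pointMap S x).map_src.symm)
    exact congrArg (t.map.app (op ⦋0⦌)) (sMap_eqToHom_apply _ _ _ fun i => rfl)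
  · rw [inr_join]
    ext k s
    refine congrArg (t.map.app k) (sMap_eqToHom_apply _ _ _ fun i => ?_)
    exact Nat.zero_add _

theorem join_pointMap (t : incl.obj T ⟶ ⟨S, x, y⟩) :
    incl.map (eqToHom (wedge_point T)) ≫ t = join t (pointMap S y) := by
  apply join_ext
  · rw [inl_join]
    ext k s
    refine congrArg (t.map.app k) (sMap_eqToHom_apply _ _ _ fun i => ?_)
    rfl
  · rw [inr_join]
    apply point_hom_ext
    refine Eq.trans ?_ (t.map_tgt.trans (pointMap S y).map_src.symm)
    exact congrArg (t.map.app (op ⦋0⦌)) (sMap_eqToHom_apply _ _ _ fun i => rfl)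

end

/-! ### The cube of a concatenation -/

theorem wedge_nonjoints (T U : Necklace.{u}) : (T.wedge U).nonjoints =
    T.nonjoints.image (inlV T U) ∪ U.nonjoints.image (inrV T U) := by
  ext v
  simp only [nonjoints, Finset.mem_sdiff, Finset.mem_univ, true_and, Finset.mem_union,
    Finset.mem_image]
  constructor
  · intro hv
    rcases inl_or_inr v with ⟨w, rfl⟩ | ⟨w, rfl⟩
    · exact Or.inl ⟨w, fun h => hv (inlV_mem.2 h), rfl⟩
    · exact Or.inr ⟨w, fun h => hv (inrV_mem.2 h), rfl⟩
  · rintro (⟨w, hw, rfl⟩ | ⟨w, hw, rfl⟩)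
    · exact fun h => hw (inlV_mem.1 h)
    · exact fun h => hw (inrV_mem.1 h)

theorem card_wedge_nonjoints (T U : Necklace.{u}) :
    T.nonjoints.card + U.nonjoints.card = (T.wedge U).nonjoints.card := by
  rw [wedge_nonjoints, Finset.card_union_of_disjoint,
    Finset.card_image_of_injective _ inlV_injective,
    Finset.card_image_of_injective _ inrV_injective]
  rw [Finset.disjoint_left]
  intro v hv hv'
  obtain ⟨a, ha, rfl⟩ := Finset.mem_image.1 hv
  obtain ⟨b, hb, e⟩ := Finset.mem_image.1 hv'
  rw [(inlV_eq_inrV e.symm).1] at ha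
  exact (Finset.mem_sdiff.1 ha).2 T.last_mem

theorem beadVertex_wedge (T U : Necklace.{u}) (i : Fin (T.nonjoints.card + U.nonjoints.card)) :
    (T.wedge U).beadVertex (i.cast (card_wedge_nonjoints T U)) =
      Fin.addCases (fun i => inlV T U (T.beadVertex i)) (fun i => inrV T U (U.beadVertex i)) i := by
  have h := Finset.orderEmbOfFin_unique (s := (T.wedge U).nonjoints)
    (card_wedge_nonjoints T U).symm
    (f := fun i => Fin.addCases (fun i => inlV T U (T.beadVertex i))
      (fun i => inrV T U (U.beadVertex i)) i) (fun i => by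
        rw [wedge_nonjoints, Finset.mem_union, Finset.mem_image, Finset.mem_image]
        refine Fin.addCases (fun i => ?_) (fun i => ?_) i
        · rw [Fin.addCases_left]
          exact Or.inl ⟨_, T.nonjoints.orderEmbOfFin_mem rfl i, rfl⟩
        · rw [Fin.addCases_right]
          exact Or.inr ⟨_, U.nonjoints.orderEmbOfFin_mem rfl i, rfl⟩) (by
        intro i j
        refine Fin.addCases (fun i => ?_) (fun i => ?_) i <;>
          refine Fin.addCases (fun j => ?_) (fun j => ?_) j <;> intro hij
        · simp only [Fin.addCases_left]
          exact (T.nonjoints.orderEmbOfFin rfl).strictMono hij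
        · simp only [Fin.addCases_left, Fin.addCases_right]
          refine lt_of_le_of_ne (inlV_le_inrV _ _) fun e => ?_
          have := (inlV_eq_inrV e).1
          exact beadVertex_notMem i (this ▸ T.last_mem)
        · exact absurd hij (not_lt.2 (Fin.le_def.2 (j.isLt.le.trans (Nat.le_add_right _ _))))
        · simp only [Fin.addCases_right]
          have h : U.beadVertex i < U.beadVertex j := (U.nonjoints.orderEmbOfFin rfl).strictMono
            (Nat.lt_of_add_lt_add_left (show _ < _ from hij))
          exact Nat.add_lt_add_left (show (U.beadVertex i).val < (U.beadVertex j).val from h) _)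
  refine Eq.trans ?_ (congrFun h i).symm
  exact Finset.orderEmbOfFin_eq_orderEmbOfFin_iff.2 rfl

/-- The cube of `T ∨ U` is the tensor product of the cubes of `T` and `U`. -/
def wedgeCube (T U : Necklace.{u}) :
    toCube.obj T ⊗ toCube.obj U ≅ toCube.obj (T.wedge U) :=
  CubeCat.castIso (card_wedge_nonjoints T U)

theorem wedgeCube_naturality (f : T ⟶ T') (g : U ⟶ U') :
    (toCube.map f ⊗ₘ toCube.map g) ≫ (wedgeCube T' U').hom =
      (wedgeCube T U).hom ≫ toCube.map (wedgeMap f g) := by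
  suffices H : ∀ (s : Cube (T.nonjoints.card + U.nonjoints.card))
      (i : Fin (T'.nonjoints.card + U'.nonjoints.card)),
      tensorMap (cubeMap f) (cubeMap g) s i = true ↔ cubeMap (wedgeMap f g)
        (castMap (card_wedge_nonjoints T U) s) (i.cast (card_wedge_nonjoints T' U')) = true by
    ext s i
    exact Bool.eq_iff_iff.2 (H s (i.cast (card_wedge_nonjoints T' U').symm))
  intro s i
  rw [cubeMap_apply, beadVertex_wedge]
  have hk (P : Fin (T.wedge U).nonjoints.card → Prop) : (∃ k, P k) ↔
      (∃ k, P (Fin.cast (card_wedge_nonjoints T U) (Fin.castAdd _ k))) ∨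
        ∃ k, P (Fin.cast (card_wedge_nonjoints T U) (Fin.natAdd _ k)) := by
    constructor
    · rintro ⟨k, hk⟩
      obtain ⟨k, rfl⟩ : ∃ j : Fin (T.nonjoints.card + U.nonjoints.card),
        Fin.cast (card_wedge_nonjoints T U) j = k :=
          ⟨k.cast (card_wedge_nonjoints T U).symm, rfl⟩
      revert hk
      exact Fin.addCases (fun j h => Or.inl ⟨j, h⟩) (fun j h => Or.inr ⟨j, h⟩) k
    · rintro (⟨k, h⟩ | ⟨k, h⟩) <;> exact ⟨_, h⟩
  rw [hk]
  simp only [beadVertex_wedge, Fin.addCases_left, Fin.addCases_right, vert_wedgeMap_inlV,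
    vert_wedgeMap_inrV]
  have hj (P : Fin ((T.wedge U).dim + 1) → Prop) : (∃ v ∈ (T.wedge U).joints, P v) ↔
      (∃ v ∈ T.joints, P (inlV T U v)) ∨ ∃ v ∈ U.joints, P (inrV T U v) := by
    constructor
    · rintro ⟨v, hv, h⟩
      rcases mem_wedge_joints.1 hv with ⟨a, ha, rfl⟩ | ⟨a, ha, rfl⟩
      exacts [Or.inl ⟨a, ha, h⟩, Or.inr ⟨a, ha, h⟩]
    · rintro (⟨a, ha, h⟩ | ⟨a, ha, h⟩)
      exacts [⟨_, inlV_mem.2 ha, h⟩, ⟨_, inrV_mem.2 ha, h⟩]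
  rw [hj]
  simp only [vert_wedgeMap_inlV, vert_wedgeMap_inrV]
  have hlr (i : Fin T'.nonjoints.card) (w) : inrV T' U' w ≠ inlV T' U' (T'.beadVertex i) :=
    fun e => beadVertex_notMem i ((inlV_eq_inrV e.symm).1 ▸ T'.last_mem)
  have hrl (i : Fin U'.nonjoints.card) (w) : inlV T' U' w ≠ inrV T' U' (U'.beadVertex i) :=
    fun e => beadVertex_notMem i ((inlV_eq_inrV e).2 ▸ U'.zero_mem)
  refine Fin.addCases (fun i => ?_) (fun i => ?_) i
  · rw [tensorMap_castAdd, cubeMap_apply]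
    simp only [Fin.addCases_left, inlV_injective.eq_iff, hlr, and_false, false_and, exists_false,
      or_false]
    rfl
  · rw [tensorMap_natAdd, cubeMap_apply]
    simp only [Fin.addCases_right, inrV_injective.eq_iff, hrl, and_false, false_and, exists_false,
      false_or]
    rfl

theorem wedgeCube_assoc (T U V : Necklace.{u}) :
    ((wedgeCube T U).hom ⊗ₘ 𝟙 (toCube.obj V)) ≫ (wedgeCube (T.wedge U) V).hom ≫
      toCube.map (eqToHom (wedge_assoc T U V)) =
    (α_ (toCube.obj T) (toCube.obj U) (toCube.obj V)).hom ≫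
      (𝟙 (toCube.obj T) ⊗ₘ (wedgeCube U V).hom) ≫ (wedgeCube T (U.wedge V)).hom := by
  rw [toCube_eqToHom]
  have h₁ := tensorMap_castMap (card_wedge_nonjoints T U) (rfl : V.nonjoints.card = _)
  have h₂ := tensorMap_castMap (rfl : T.nonjoints.card = _) (card_wedge_nonjoints U V)
  have h₃ : (wedgeCube T U).hom ⊗ₘ 𝟙 (toCube.obj V) = (CubeCat.castIso
    (a := (toCube.obj T ⊗ toCube.obj U) ⊗ toCube.obj V) (b := toCube.obj (T.wedge U) ⊗ toCube.obj V)
      (congrArg (· + V.nonjoints.card) (card_wedge_nonjoints T U))).hom := CubeCat.Hom.ext h₁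
  have h₄ : 𝟙 (toCube.obj T) ⊗ₘ (wedgeCube U V).hom = (CubeCat.castIso
    (a := toCube.obj T ⊗ toCube.obj U ⊗ toCube.obj V) (b := toCube.obj T ⊗ toCube.obj (U.wedge V))
      (congrArg (T.nonjoints.card + ·) (card_wedge_nonjoints U V))).hom := CubeCat.Hom.ext h₂
  rw [h₃, h₄]
  rfl

theorem wedgeCube_point_left (T : Necklace.{u}) (e : 𝟙_ CubeCat ⟶ toCube.obj point.{u}) :
    (e ⊗ₘ 𝟙 (toCube.obj T)) ≫ (wedgeCube point T).hom ≫
      toCube.map (eqToHom (point_wedge T)) = (λ_ (toCube.obj T)).hom := by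
  rw [toCube_eqToHom]
  ext s i
  have h := tensorMap_natAdd e.map (OrderHom.id (α := Cube T.nonjoints.card)) s i
  refine Eq.trans ?_ (h.trans (congrArg s (Fin.ext (Nat.zero_add _))))
  exact congrArg (tensorMap e.map (OrderHom.id (α := Cube T.nonjoints.card)) s)
    (Fin.ext (Nat.zero_add _).symm)

theorem wedgeCube_point_right (T : Necklace.{u}) (e : 𝟙_ CubeCat ⟶ toCube.obj point.{u}) :
    (𝟙 (toCube.obj T) ⊗ₘ e) ≫ (wedgeCube T point).hom ≫
      toCube.map (eqToHom (wedge_point T)) = (ρ_ (toCube.obj T)).hom := by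
  rw [toCube_eqToHom]
  ext s i
  exact tensorMap_castAdd (OrderHom.id (α := Cube T.nonjoints.card)) e.map s i

end Necklace

/-! ### Cubical rigidification -/

/-- The functor that sends a simplicial set `S` with two distinguished vertices `x`, `y` to the
colimit of the cubical sets of all necklaces over `S` from `x` to `y`. -/
noncomputable def mappingSpace : BipointedSSet.{u} ⥤ CubSet.{u} :=
  Necklace.incl.{u}.pointwiseLeftKanExtension Necklace.cubicalSet.{u} ⋙
    (DayFunctor.equiv CubeCatᵒᵖ (Type u)).inverse

namespace mappingSpace
open Necklace
variable {A B : BipointedSSet.{u}} {T T' U U' V : Necklace.{u}} {p q m n : CubeCat}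

/-- The cells of `mappingSpace.obj B`. -/
abbrev Cell (B : BipointedSSet.{u}) (p : CubeCat) : Type u := (mappingSpace.obj B).functor.obj (op p)

/-- The cell given by a necklace over `B` and a cell of its cube. -/
noncomputable def mk (t : incl.obj T ⟶ B) (a : p ⟶ toCube.obj T) : Cell B p :=
  (colimit.ι (CostructuredArrow.proj incl.{u} B ⋙ cubicalSet.{u}) (CostructuredArrow.mk t)).app
    (op p) (ULift.up a : ULift.{u} (p ⟶ toCube.obj T))

theorem mk_comp (f : T ⟶ T') (t : incl.obj T' ⟶ B) (a : p ⟶ toCube.obj T) :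
    mk (incl.map f ≫ t) a = mk t (a ≫ toCube.map f) := by
  let g : CostructuredArrow.mk (incl.map f ≫ t) ⟶ CostructuredArrow.mk t :=
    CostructuredArrow.homMk f rfl
  have := colimit.w (CostructuredArrow.proj incl.{u} B ⋙ cubicalSet.{u}) g
  exact (ConcreteCategory.congr_hom (congrArg (fun t => NatTrans.app t (op p)) this)
    (ULift.up a : ULift.{u} (p ⟶ toCube.obj T))).symm

theorem obj_map_mk (g : q ⟶ p) (t : incl.obj T ⟶ B) (a : p ⟶ toCube.obj T) :
    (mappingSpace.obj B).functor.map g.op (mk t a) = mk t (g ≫ a) :=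
  (ConcreteCategory.congr_hom ((colimit.ι (CostructuredArrow.proj incl.{u} B ⋙ cubicalSet.{u})
    (CostructuredArrow.mk t)).naturality g.op) (ULift.up a : ULift.{u} (p ⟶ toCube.obj T))).symm

theorem exists_mk (x : Cell B p) :
    ∃ (T : Necklace.{u}) (t : incl.obj T ⟶ B) (a : p ⟶ toCube.obj T), x = mk t a := by
  obtain ⟨j, y, rfl⟩ := elem_induction (colimit.isColimit
    (CostructuredArrow.proj incl.{u} B ⋙ cubicalSet.{u})) (op p) x
  exact ⟨j.left, j.hom, y.down, rfl⟩

/-- Maps out of the set of cells of `mappingSpace.obj B`. -/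
noncomputable def lift {Z : Type u}
    (φ : ∀ T : Necklace.{u}, (incl.obj T ⟶ B) → (p ⟶ toCube.obj T) → Z)
    (h : ∀ (T T' : Necklace.{u}) (f : T ⟶ T') (t : incl.obj T' ⟶ B) (a : p ⟶ toCube.obj T),
      φ T (incl.map f ≫ t) a = φ T' t (a ≫ toCube.map f)) (x : Cell B p) : Z :=
  elemLift (colimit.isColimit (CostructuredArrow.proj incl.{u} B ⋙ cubicalSet.{u})) (op p)
    (fun j y => φ j.left j.hom y.down) (fun j j' f y => by
      refine (h _ _ f.left j'.hom y.down).symm.trans ?_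
      rw [CostructuredArrow.w f]) x

theorem lift_mk {Z : Type u}
    (φ : ∀ T : Necklace.{u}, (incl.obj T ⟶ B) → (p ⟶ toCube.obj T) → Z) (h)
    (t : incl.obj T ⟶ B) (a : p ⟶ toCube.obj T) : lift φ h (mk t a) = φ T t a :=
  elemLift_ι (colimit.isColimit (CostructuredArrow.proj incl.{u} B ⋙ cubicalSet.{u})) (op p)
    (fun j y => φ j.left j.hom y.down) _ _ _

theorem map_mk (f : A ⟶ B) (t : incl.obj T ⟶ A) (a : p ⟶ toCube.obj T) :
    (mappingSpace.map f).natTrans.app (op p) (mk t a) = mk (t ≫ f) a :=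
  ConcreteCategory.congr_hom (congrArg (fun t => NatTrans.app t (op p)) (colimit.ι_desc
    (F := CostructuredArrow.proj incl.{u} A ⋙ cubicalSet.{u}) _ (CostructuredArrow.mk t)))
    (ULift.up a : ULift.{u} (p ⟶ toCube.obj T))

variable {S S' : SSet.{u}} {w x y z : S _⦋0⦌}

/-- Composition of cells, by concatenation of necklaces. -/
noncomputable def comp (c : Cell ⟨S, x, y⟩ m) (c' : Cell ⟨S, y, z⟩ n) :
    Cell ⟨S, x, z⟩ (m ⊗ n) :=
  lift (fun T t a => lift (fun U u b => mk (join t u) ((a ⊗ₘ b) ≫ (wedgeCube T U).hom))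
      (fun U U' g u b => by
        have h := wedgeMap_join (𝟙 T) g t u
        rw [CategoryTheory.Functor.map_id, Category.id_comp] at h
        rw [← h, mk_comp, Category.assoc, ← wedgeCube_naturality, CategoryTheory.Functor.map_id,
          tensorHom_comp_tensorHom_assoc, Category.comp_id]) c')
    (fun T T' f t' a => by
      obtain ⟨U, u, b, rfl⟩ := exists_mk c'
      rw [lift_mk, lift_mk]
      have h := wedgeMap_join f (𝟙 U) t' u
      rw [CategoryTheory.Functor.map_id, Category.id_comp] at h
      rw [← h, mk_comp, Category.assoc, ← wedgeCube_naturality, CategoryTheory.Functor.map_id,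
        tensorHom_comp_tensorHom_assoc, Category.comp_id]) c

theorem comp_mk (t : incl.obj T ⟶ ⟨S, x, y⟩) (a : m ⟶ toCube.obj T)
    (u : incl.obj U ⟶ ⟨S, y, z⟩) (b : n ⟶ toCube.obj U) :
    comp (mk t a) (mk u b) = mk (join t u) ((a ⊗ₘ b) ≫ (wedgeCube T U).hom) := by
  unfold comp
  rw [lift_mk, lift_mk]

theorem comp_natural (f : p ⟶ m) (g : q ⟶ n) (s : Cell ⟨S, x, y⟩ m) (t : Cell ⟨S, y, z⟩ n) :
    comp ((mappingSpace.obj ⟨S, x, y⟩).functor.map f.op s)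
      ((mappingSpace.obj ⟨S, y, z⟩).functor.map g.op t) =
        (mappingSpace.obj ⟨S, x, z⟩).functor.map (f ⊗ₘ g).op (comp s t) := by
  obtain ⟨T, t', a, rfl⟩ := exists_mk s
  obtain ⟨U, u, b, rfl⟩ := exists_mk t
  rw [obj_map_mk, obj_map_mk, comp_mk, comp_mk, obj_map_mk, tensorHom_comp_tensorHom_assoc]

theorem comp_assoc (r : Cell ⟨S, w, x⟩ m) (s : Cell ⟨S, x, y⟩ n) (t : Cell ⟨S, y, z⟩ p) :
    comp (comp r s) t =
      (mappingSpace.obj ⟨S, w, z⟩).functor.map (α_ m n p).hom.op (comp r (comp s t)) := by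
  obtain ⟨T, r, a, rfl⟩ := exists_mk r
  obtain ⟨U, s, b, rfl⟩ := exists_mk s
  obtain ⟨V, t, c, rfl⟩ := exists_mk t
  rw [comp_mk, comp_mk, comp_mk, comp_mk, obj_map_mk, ← join_assoc, mk_comp]
  refine congrArg (mk _) ?_
  have h := wedgeCube_assoc T U V
  have e₁ : ((a ⊗ₘ b) ≫ (wedgeCube T U).hom) ⊗ₘ c =
      ((a ⊗ₘ b) ⊗ₘ c) ≫ ((wedgeCube T U).hom ⊗ₘ 𝟙 _) := by
    rw [tensorHom_comp_tensorHom, Category.comp_id]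
  have e₂ : a ⊗ₘ ((b ⊗ₘ c) ≫ (wedgeCube U V).hom) =
      (a ⊗ₘ (b ⊗ₘ c)) ≫ (𝟙 _ ⊗ₘ (wedgeCube U V).hom) := by
    rw [tensorHom_comp_tensorHom, Category.comp_id]
  rw [e₁, e₂, Category.assoc, Category.assoc, Category.assoc, h, associator_naturality_assoc]

variable (S x) in
/-- The identity cell. -/
noncomputable def ident : Cell ⟨S, x, x⟩ (𝟙_ CubeCat) :=
  mk (pointMap S x) (CubeCat.castIso (by rfl)).hom

theorem ident_comp (t : Cell ⟨S, x, y⟩ m) : comp (ident S x) t =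
    (mappingSpace.obj ⟨S, x, y⟩).functor.map (λ_ m).hom.op t := by
  obtain ⟨T, t, a, rfl⟩ := exists_mk t
  unfold ident
  rw [comp_mk, obj_map_mk, ← pointMap_join, mk_comp]
  refine congrArg (mk _) ?_
  have h := wedgeCube_point_left T (CubeCat.castIso (by rfl)).hom
  rw [MonoidalCategory.tensorHom_def', Category.assoc, Category.assoc, ← tensorHom_id, h, leftUnitor_naturality]

theorem comp_ident (t : Cell ⟨S, x, y⟩ m) : comp t (ident S y) =
    (mappingSpace.obj ⟨S, x, y⟩).functor.map (ρ_ m).hom.op t := by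
  obtain ⟨T, t, a, rfl⟩ := exists_mk t
  unfold ident
  rw [comp_mk, obj_map_mk, ← join_pointMap, mk_comp]
  refine congrArg (mk _) ?_
  have h := wedgeCube_point_right T (CubeCat.castIso (by rfl)).hom
  rw [MonoidalCategory.tensorHom_def, Category.assoc, Category.assoc, ← id_tensorHom, h, rightUnitor_naturality]

variable (S x y z) in
/-- Composition. -/
noncomputable def compHom : mappingSpace.obj ⟨S, x, y⟩ ⊗ mappingSpace.obj ⟨S, y, z⟩ ⟶
    mappingSpace.obj ⟨S, x, z⟩ :=
  CubSet.tensorLift (fun _ _ s t => comp s t) fun _ _ _ _ f g s t => comp_natural f g s t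

theorem compHom_tens (s : Cell ⟨S, x, y⟩ m) (t : Cell ⟨S, y, z⟩ n) :
    (compHom S x y z).natTrans.app (op (m ⊗ n)) (CubSet.tens s t) = comp s t :=
  CubSet.tensorLift_tens _ _ _ _

variable (S x) in
/-- Identities. -/
noncomputable def identHom : 𝟙_ CubSet.{u} ⟶ mappingSpace.obj ⟨S, x, x⟩ :=
  CubSet.unitLift (ident S x)

theorem identHom_unitCell :
    (identHom S x).natTrans.app (op (𝟙_ CubeCat)) CubSet.unitCell = ident S x :=
  CubSet.unitLift_unitCell _

theorem identHom_compHom : (λ_ (mappingSpace.obj ⟨S, x, y⟩)).inv ≫ identHom S x ▷ _ ≫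
    compHom S x x y = 𝟙 _ := by
  refine CubSet.hom_ext' fun m a => ?_
  rw [CubSet.comp_app, CubSet.comp_app, CubSet.leftUnitor_inv_apply, CubSet.hom_natural,
    CubSet.hom_natural, CubSet.whiskerRight_tens, identHom_unitCell, compHom_tens,
    ident_comp, ← Functor.map_comp_apply, ← op_comp, Iso.inv_hom_id, op_id, Functor.map_id_apply]
  rfl

theorem compHom_identHom : (ρ_ (mappingSpace.obj ⟨S, x, y⟩)).inv ≫ _ ◁ identHom S y ≫
    compHom S x y y = 𝟙 _ := by
  refine CubSet.hom_ext' fun m a => ?_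
  rw [CubSet.comp_app, CubSet.comp_app, CubSet.rightUnitor_inv_apply, CubSet.hom_natural,
    CubSet.hom_natural, CubSet.whiskerLeft_tens, identHom_unitCell, compHom_tens,
    comp_ident, ← Functor.map_comp_apply, ← op_comp, Iso.inv_hom_id, op_id, Functor.map_id_apply]
  rfl

theorem compHom_assoc : compHom S w x y ▷ _ ≫ compHom S w y z =
    (α_ _ _ _).hom ≫ _ ◁ compHom S x y z ≫ compHom S w x z := by
  refine CubSet.tensor_hom_ext₃ fun m n p a b c => ?_
  rw [CubSet.comp_app, CubSet.comp_app, CubSet.comp_app, CubSet.whiskerRight_tens,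
    CubSet.associator_hom_tens, CubSet.hom_natural, CubSet.hom_natural, CubSet.whiskerLeft_tens,
    compHom_tens, compHom_tens, compHom_tens, compHom_tens, comp_assoc]

/-- The map of bipointed simplicial sets given by a map of simplicial sets. -/
def bip (φ : S ⟶ S') (x y : S _⦋0⦌) :
    (⟨S, x, y⟩ : BipointedSSet.{u}) ⟶ ⟨S', φ.app _ x, φ.app _ y⟩ where
  map := φ
  map_src := rfl
  map_tgt := rfl

theorem map_comp_cell (φ : S ⟶ S') (s : Cell ⟨S, x, y⟩ m) (t : Cell ⟨S, y, z⟩ n) :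
    (mappingSpace.map (bip φ x z)).natTrans.app _ (comp s t) =
      comp ((mappingSpace.map (bip φ x y)).natTrans.app _ s)
        ((mappingSpace.map (bip φ y z)).natTrans.app _ t) := by
  obtain ⟨T, s, a, rfl⟩ := exists_mk s
  obtain ⟨U, t, b, rfl⟩ := exists_mk t
  rw [comp_mk, map_mk, map_mk, map_mk, comp_mk]
  exact congrArg (fun f => mk f _) (join_comp s t φ)

theorem map_ident (φ : S ⟶ S') :
    (mappingSpace.map (bip φ x x)).natTrans.app _ (ident S x) = ident S' (φ.app _ x) := by
  unfold ident
  rw [map_mk]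
  refine congrArg (fun f => mk f _) (BipointedSSet.Hom.ext (point_hom_ext ?_))
  exact ((bip φ x x).map_src ▸ congrArg (φ.app _) (pointMap S x).map_src).trans
    (pointMap S' (φ.app _ x)).map_src.symm

end mappingSpace

open mappingSpace

/-- The objects of the cubical rigidification of `S`: the vertices of `S`. -/
def Vertex (S : SSet.{u}) : Type u := S _⦋0⦌

/-- The cubical rigidification of `S`, a category enriched in cubical sets with connections. The
mapping space from `x` to `y` is the colimit of the cubical sets of all necklaces over `S` from `x`
to `y`, composition is concatenation of necklaces. -/
noncomputable instance (S : SSet.{u}) : EnrichedCategory CubSet.{u} (Vertex S) where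
  Hom x y := mappingSpace.obj ⟨S, x, y⟩
  id x := identHom S x
  comp x y z := compHom S x y z
  id_comp _ _ := identHom_compHom
  comp_id _ _ := compHom_identHom
  assoc _ _ _ _ := (Iso.inv_comp_eq _).2 compHom_assoc

/-- Maps of simplicial sets induce enriched functors. -/
noncomputable def cubicalMap {S S' : SSet.{u}} (φ : S ⟶ S') :
    EnrichedFunctor CubSet.{u} (Vertex S) (Vertex S') where
  obj x := φ.app (op ⦋0⦌) x
  map x y := mappingSpace.map (bip φ x y)
  map_id x := by
    refine CubSet.unit_hom_ext' ?_
    refine (congrArg ((mappingSpace.map (bip φ x x)).natTrans.app _)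
      (identHom_unitCell (S := S) (x := x))).trans ?_
    exact (map_ident φ).trans (identHom_unitCell (S := S')).symm
  map_comp x y z := by
    refine CubSet.tensor_hom_ext' fun m n a b => ?_
    refine (congrArg ((mappingSpace.map (bip φ x z)).natTrans.app _)
      (compHom_tens (S := S) a b)).trans ((map_comp_cell φ a b).trans ?_)
    refine (compHom_tens (S := S') _ _).symm.trans ?_
    exact congrArg ((compHom S' _ _ _).natTrans.app _) (CubSet.tensorHom_tens _ _ a b).symm

/-- The cubical rigidification functor `𝔠_□`. -/
noncomputable def cubicalRigidification :
    SSet.{u} ⥤ EnrichedCat.{u, u + 1, u} CubSet.{u} where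
  obj S := EnrichedCat.of CubSet.{u} (Vertex S)
  map φ := cubicalMap φ
  map_id _ := enrichedFunctor_ext (fun _ => rfl) fun _ _ => heq_of_eq (mappingSpace.map_id _)
  map_comp φ ψ := enrichedFunctor_ext (fun _ => rfl) fun _ _ =>
    heq_of_eq (mappingSpace.map_comp (bip φ _ _) (bip ψ _ _))

end CubicalRigidification

/-!
Both functors are left Kan extensions, along the inclusion of the standard simplices, of the functor
`Δⁿ ↦ 𝔠(Δⁿ)`. For `𝔠` this is the definition. For `𝔗 ∘ 𝔠_□` it is verified by exhibiting the universal
property of the colimit of `𝔠(Δⁿ)` over the simplices `Δⁿ ⟶ S` directly.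

Triangulation preserves colimits and sends the cube of a necklace `T` to the nerve of `P(T)`. So a
`k`-simplex of the mapping space from `x` to `y` in `𝔗(𝔠_□(S))` is represented by a necklace `T` over
`S` from `x` to `y` and a flag `X₀ ⊆ ⋯ ⊆ X_k` of sets of vertices of `T` that contain the joints, up to
the relation generated by the maps of necklaces over `S`, which act on flags by taking images; the
composition is the union of flags in the concatenated necklace (`FlagCell`, `verts_map`,
`verts_wedge`).

Over `S = Δⁿ` every necklace from `i` to `j` maps to the interval `[i, j]`, which is itself a necklace
with one bead. Hence a simplex is determined by the image of its flag in `Δⁿ` (`FlagCell.mk_eq_mk`),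
and flags of subsets of `[i, j]` that contain `i` and `j` define a natural simplicial functor
`𝔠(Δⁿ) ⟶ 𝔗(𝔠_□(Δⁿ))` (`thickeningUnit`). Its composites with the maps induced by the simplices of `S`
form the colimit cocone.

Given a compatible family of simplicial functors `𝔠(Δⁿ) ⟶ C`, a flag in a necklace over `S` is sent to
the composite, over the beads, of the images of the parts of the flag in the beads. To see that this is
invariant under maps of necklaces, which may send a bead into a part of a bead, the composite is
characterized by all partial composites at once: a *development* assigns to every vertex `v` a simplex
of the mapping space from a fixed object to the image of `v`, compatibly with all intervals that are contained in
a bead and start in `X₀`. Compatibility at the joints already determines a development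
(`IsDevelopment.unique`), compatibility at all of `X₀` holds automatically (`exists_development`), and
therefore developments can be pulled back along maps of necklaces (`IsDevelopment.pullback`).
This gives the induced functor `SimplexFamily.desc`. It is unique since every flag is a composite of
flags in single beads, which come from `𝔠(Δⁿ)` (`triRig_hom_ext`).
-/

namespace CubicalRigidification

open CategoryTheory MonoidalCategory Limits Opposite
open scoped Simplicial

/-! ### The simplices of the triangulated mapping spaces -/

/-- The functor `𝔗 ∘ 𝔠_□`. -/
noncomputable abbrev triRig : SSet.{u} ⥤ EnrichedCat.{u, u + 1, u} SSet.{u} :=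
  cubicalRigidification.{u} ⋙ triangulateCat.{u}

/-- The `k`-simplices of the mapping space from `x` to `y` in the triangulation of the cubical
rigidification of `S`. -/
abbrev FlagCell (S : SSet.{u}) (k : SimplexCategoryᵒᵖ) (x y : S _⦋0⦌) : Type u :=
  (triangulation.{u}.obj (mappingSpace.obj ⟨S, x, y⟩)).obj k

namespace FlagCell
open Necklace
variable {S S' : SSet.{u}} {x y z : S _⦋0⦌} {T U : Necklace.{u}} {k k' : SimplexCategoryᵒᵖ}

/-- The simplex given by a necklace `T` over `S` and a simplex of the cube of `T`. -/
noncomputable def mk (t : incl.obj T ⟶ ⟨S, x, y⟩)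
    (c : (cubeNerve.{u}.obj (toCube.obj T)).obj k) : FlagCell S k x y :=
  triangulation.mk (mappingSpace.mk t (𝟙 _)) c

theorem triangulation_mk_mk {p : CubeCat} (t : incl.obj T ⟶ ⟨S, x, y⟩) (a : p ⟶ toCube.obj T)
    (c : (cubeNerve.{u}.obj p).obj k) :
    triangulation.mk (mappingSpace.mk t a) c = mk t ((cubeNerve.map a).app k c) := by
  unfold mk
  rw [← triangulation.mk_map, mappingSpace.obj_map_mk, Category.comp_id]

theorem mk_comp (f : T ⟶ U) (t : incl.obj U ⟶ ⟨S, x, y⟩)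
    (c : (cubeNerve.{u}.obj (toCube.obj T)).obj k) :
    mk (incl.map f ≫ t) c = mk t ((cubeNerve.map (toCube.map f)).app k c) := by
  rw [← triangulation_mk_mk]
  unfold mk
  rw [mappingSpace.mk_comp, Category.id_comp]

theorem exists_mk (a : FlagCell S k x y) : ∃ (T : Necklace.{u}) (t : incl.obj T ⟶ ⟨S, x, y⟩)
    (c : (cubeNerve.{u}.obj (toCube.obj T)).obj k), a = mk t c := by
  obtain ⟨n, b, c, rfl⟩ := triangulation.exists_mk a
  obtain ⟨T, t, a, rfl⟩ := mappingSpace.exists_mk b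
  exact ⟨T, t, _, triangulation_mk_mk t a c⟩

/-- Maps out of the set of simplices of a triangulated mapping space. -/
noncomputable def lift {Z : Type u}
    (φ : ∀ T : Necklace.{u}, (incl.obj T ⟶ ⟨S, x, y⟩) →
      (cubeNerve.{u}.obj (toCube.obj T)).obj k → Z)
    (h : ∀ (T U : Necklace.{u}) (f : T ⟶ U) (t : incl.obj U ⟶ ⟨S, x, y⟩)
      (c : (cubeNerve.{u}.obj (toCube.obj T)).obj k),
      φ T (incl.map f ≫ t) c = φ U t ((cubeNerve.map (toCube.map f)).app k c)) :
    FlagCell S k x y → Z :=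
  triangulation.lift
    (fun _ b c => mappingSpace.lift (fun T t a => φ T t ((cubeNerve.map a).app k c))
      (fun T U f t a => by rw [h, cubeNerve.map_comp]; rfl) b)
    (fun m n g b c => by
      obtain ⟨T, t, a, rfl⟩ := mappingSpace.exists_mk b
      rw [mappingSpace.obj_map_mk, mappingSpace.lift_mk, mappingSpace.lift_mk, cubeNerve.map_comp]
      rfl)

theorem lift_mk {Z : Type u}
    (φ : ∀ T : Necklace.{u}, (incl.obj T ⟶ ⟨S, x, y⟩) →
      (cubeNerve.{u}.obj (toCube.obj T)).obj k → Z) (h)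
    (t : incl.obj T ⟶ ⟨S, x, y⟩) (c : (cubeNerve.{u}.obj (toCube.obj T)).obj k) :
    lift φ h (mk t c) = φ T t c := by
  unfold lift mk
  rw [triangulation.lift_mk, mappingSpace.lift_mk, cubeNerve.map_id]
  rfl

theorem act_mk (θ : k ⟶ k') (t : incl.obj T ⟶ ⟨S, x, y⟩)
    (c : (cubeNerve.{u}.obj (toCube.obj T)).obj k) :
    Simp.act (C := triRig.obj S) (X := x) (Y := y) θ (mk t c) =
      mk t ((cubeNerve.obj (toCube.obj T)).map θ c) :=
  triangulation.obj_map_mk θ _ c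

theorem fmap_mk (φ : S ⟶ S') (t : incl.obj T ⟶ ⟨S, x, y⟩)
    (c : (cubeNerve.{u}.obj (toCube.obj T)).obj k) :
    Simp.fmap (Colim.fn (triRig.map φ)) (X := x) (Y := y) (mk t c) =
      mk (t ≫ mappingSpace.bip φ x y) c :=
  (triangulation.map_mk _ _ _).trans (congrArg (fun a => triangulation.mk a c)
    (mappingSpace.map_mk _ _ _))

theorem comp_mk (t : incl.obj T ⟶ ⟨S, x, y⟩) (c : (cubeNerve.{u}.obj (toCube.obj T)).obj k)
    (s : incl.obj U ⟶ ⟨S, y, z⟩) (d : (cubeNerve.{u}.obj (toCube.obj U)).obj k) :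
    Simp.comp (C := triRig.obj S) (X := x) (Y := y) (Z := z) (mk t c) (mk s d) =
      mk (join t s) ((cubeNerve.map (wedgeCube T U).hom).app k (cubeNerve.pair c d)) := by
  -- composition is defined by pairing the two simplices and then composing cells
  have h1 : Simp.comp (C := triRig.obj S) (X := x) (Y := y) (Z := z) (mk t c) (mk s d) =
      (triangulation.map (mappingSpace.compHom S x y z)).app k (triangulation.pairing
        (triangulation.mk (mappingSpace.mk t (𝟙 _)) c)
        (triangulation.mk (mappingSpace.mk s (𝟙 _)) d)) := rfl
  rw [h1, triangulation.pairing_mk, triangulation.map_mk, mappingSpace.compHom_tens,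
    mappingSpace.comp_mk, id_tensorHom_id, Category.id_comp, triangulation_mk_mk]

theorem ident_eq (x : S _⦋0⦌) (c : (cubeNerve.{u}.obj (toCube.obj point)).obj k) :
    Simp.ident (C := triRig.obj S) k x = mk (pointMap S x) c := by
  have h1 : Simp.ident (C := triRig.obj S) k x =
      (triangulation.map (mappingSpace.identHom (S := S) (x := x))).app k
      (triangulation.mk CubSet.unitCell (cubeNerve.point k)) := rfl
  rw [h1, triangulation.map_mk, mappingSpace.identHom_unitCell]
  unfold mappingSpace.ident
  rw [triangulation_mk_mk]
  refine congrArg (mk _) (cubeNerve.ext' fun i => ULift.ext _ _ (funext fun j => ?_))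
  have h : point.{u}.nonjoints.card = 0 :=
    Finset.card_eq_zero.2 (Finset.sdiff_self (Finset.univ : Finset (Fin 1)))
  exact (Fin.cast h j).elim0

end FlagCell

/-! ### Simplices of the cube of a necklace as flags of sets of vertices -/

namespace Necklace
variable {T U V : Necklace.{u}} {k k' : SimplexCategoryᵒᵖ}

/-- The sets of vertices `X₀ ⊆ X₁ ⊆ ⋯`, all of which contain the joints, that form a simplex of the
nerve of `P(T)`. -/
def verts (c : (cubeNerve.{u}.obj (toCube.obj T)).obj k) (l : Fin (k.unop.len + 1)) :
    Set (Fin (T.dim + 1)) :=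
  {v | v ∈ (T.cubeEquiv.symm (Functor.obj c l).down).1}

theorem joints_subset_verts (c : (cubeNerve.{u}.obj (toCube.obj T)).obj k) (l) {v}
    (hv : v ∈ T.joints) : v ∈ verts c l :=
  (T.cubeEquiv.symm (Functor.obj c l).down).2 hv

theorem verts_mono (c : (cubeNerve.{u}.obj (toCube.obj T)).obj k) : Monotone (verts c) := by
  intro l l' h
  have := T.cubeEquiv.symm.monotone (show (Functor.obj c l).down ≤ (Functor.obj c l').down from
    Functor.monotone c h)
  exact fun v hv => (show (_ : Finset _) ⊆ _ from this) hv

theorem verts_ext {c d : (cubeNerve.{u}.obj (toCube.obj T)).obj k}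
    (h : ∀ l v, v ∈ verts c l ↔ v ∈ verts d l) : c = d :=
  cubeNerve.ext' fun l => ULift.ext _ _ (T.cubeEquiv.symm.injective
    (Subtype.ext (Finset.ext fun v => h l v)))

theorem verts_act (θ : k ⟶ k') (c : (cubeNerve.{u}.obj (toCube.obj T)).obj k) (l) :
    verts ((cubeNerve.obj (toCube.obj T)).map θ c) l = verts c (θ.unop.toOrderHom l) := rfl

theorem verts_map (f : T ⟶ U) (c : (cubeNerve.{u}.obj (toCube.obj T)).obj k) (l) :
    verts ((cubeNerve.map (toCube.map f)).app k c) l = vert f '' verts c l := by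
  ext v
  change v ∈ (U.cubeEquiv.symm (U.cubeEquiv (imageSets f (T.cubeEquiv.symm _)))).1 ↔ _
  rw [OrderIso.symm_apply_apply]
  exact Finset.mem_image

open Classical in
/-- The simplex of the nerve of `P(T)` obtained from a flag of sets of vertices by adding the
joints. -/
noncomputable def ofFlag (T : Necklace.{u}) (A : Fin (k.unop.len + 1) → Set (Fin (T.dim + 1)))
    (hA : Monotone A) : (cubeNerve.{u}.obj (toCube.obj T)).obj k :=
  Monotone.functor (f := fun l => (⟨T.cubeEquiv ⟨T.joints ∪ Finset.univ.filter (· ∈ A l),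
      Finset.subset_union_left⟩⟩ : Vert.{u} (toCube.obj T))) fun l l' h =>
    T.cubeEquiv.monotone (show T.joints ∪ _ ⊆ T.joints ∪ _ from
      Finset.union_subset_union_right fun v hv => by
        simp only [Finset.mem_filter, Finset.mem_univ, true_and] at hv ⊢
        exact hA h hv)

theorem mem_verts_ofFlag {A : Fin (k.unop.len + 1) → Set (Fin (T.dim + 1))} {hA : Monotone A}
    {l} {v} : v ∈ verts (T.ofFlag A hA) l ↔ v ∈ T.joints ∨ v ∈ A l := by
  classical
  let X : VertexSets T := ⟨T.joints ∪ Finset.univ.filter (· ∈ A l), Finset.subset_union_left⟩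
  have h : T.cubeEquiv.symm (T.cubeEquiv X) = X := T.cubeEquiv.symm_apply_apply X
  have h' : v ∈ (T.cubeEquiv.symm (T.cubeEquiv X)).1 ↔ v ∈ X.1 := by rw [h]
  refine Iff.trans ?_ (h'.trans (by simp [X]))
  exact Iff.rfl

theorem mem_cubeEquiv_symm (s : Cube T.nonjoints.card) (v : Fin (T.dim + 1)) :
    v ∈ (T.cubeEquiv.symm s).1 ↔ v ∈ T.joints ∨ ∃ i, s i = true ∧ T.beadVertex i = v := by
  change v ∈ T.joints ∪ (Finset.univ.filter fun i => s i = true).image T.beadVertex ↔ _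
  simp

theorem mem_cubeEquiv_symm_append (s : Cube T.nonjoints.card) (s' : Cube U.nonjoints.card) (v) :
    v ∈ ((T.wedge U).cubeEquiv.symm (castMap (card_wedge_nonjoints T U) (Fin.append s s'))).1 ↔
      (∃ a, a ∈ (T.cubeEquiv.symm s).1 ∧ inlV T U a = v) ∨
        ∃ a, a ∈ (U.cubeEquiv.symm s').1 ∧ inrV T U a = v := by
  have hc (i) : castMap (card_wedge_nonjoints T U) (Fin.append s s')
      (Fin.cast (card_wedge_nonjoints T U) i) = Fin.append s s' i := rfl
  simp only [mem_cubeEquiv_symm]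
  rw [mem_wedge_joints]
  constructor
  · rintro ((⟨a, ha, rfl⟩ | ⟨a, ha, rfl⟩) | ⟨i, hi, rfl⟩)
    · exact Or.inl ⟨a, Or.inl ha, rfl⟩
    · exact Or.inr ⟨a, Or.inl ha, rfl⟩
    · obtain ⟨i, rfl⟩ : ∃ j, Fin.cast (card_wedge_nonjoints T U) j = i :=
        ⟨i.cast (card_wedge_nonjoints T U).symm, rfl⟩
      rw [hc] at hi
      rw [beadVertex_wedge]
      revert hi
      refine Fin.addCases (fun i hi => ?_) (fun i hi => ?_) i
      · rw [Fin.append_left] at hi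
        rw [Fin.addCases_left]
        exact Or.inl ⟨_, Or.inr ⟨i, hi, rfl⟩, rfl⟩
      · rw [Fin.append_right] at hi
        rw [Fin.addCases_right]
        exact Or.inr ⟨_, Or.inr ⟨i, hi, rfl⟩, rfl⟩
  · rintro (⟨_, ha | ⟨i, hi, rfl⟩, rfl⟩ | ⟨_, ha | ⟨i, hi, rfl⟩, rfl⟩)
    · exact Or.inl (Or.inl ⟨_, ha, rfl⟩)
    · refine Or.inr ⟨Fin.cast (card_wedge_nonjoints T U) (Fin.castAdd _ i), ?_, ?_⟩
      · rw [hc, Fin.append_left, hi]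
      · rw [beadVertex_wedge, Fin.addCases_left]
    · exact Or.inl (Or.inr ⟨_, ha, rfl⟩)
    · refine Or.inr ⟨Fin.cast (card_wedge_nonjoints T U) (Fin.natAdd _ i), ?_, ?_⟩
      · rw [hc, Fin.append_right, hi]
      · rw [beadVertex_wedge, Fin.addCases_right]

/-- Under the identification `P(T) × P(U) = P(T ∨ U)`, pairs of flags correspond to their unions. -/
theorem verts_wedge (c : (cubeNerve.{u}.obj (toCube.obj T)).obj k)
    (d : (cubeNerve.{u}.obj (toCube.obj U)).obj k) (l) :
    verts ((cubeNerve.map (wedgeCube T U).hom).app k (cubeNerve.pair c d)) l =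
      inlV T U '' verts c l ∪ inrV T U '' verts d l :=
  Set.ext fun v => mem_cubeEquiv_symm_append (T := T) (U := U) _ _ v

end Necklace

/-! ### The simplices of the thickened simplices as flags of sets of vertices -/

/-- The object `i` of `𝔠(Δⁿ)`. -/
def thickVertex (n : SimplexCategory) (i : Fin (n.len + 1)) : thickening.{u}.obj n :=
  SimplicialThickening.mk ⟨i⟩

/-- The `k`-simplices of the mapping space from `i` to `j` in `𝔠(Δⁿ)`. -/
abbrev PathFlag (n : SimplexCategory) (k : SimplexCategoryᵒᵖ) (i j : Fin (n.len + 1)) : Type u :=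
  Simp.Hom.{u} (C := thickening.{u}.obj n) k (thickVertex n i) (thickVertex n j)

/-- The poset of paths from `i` to `j`, as a category. -/
abbrev PathCat (n : SimplexCategory) (i j : Fin (n.len + 1)) : Type u :=
  (SimplicialThickening.mk (ULift.up.{u} i) : SimplicialThickening (ULift.{u} (Fin (n.len + 1)))) ⟶
    SimplicialThickening.mk (ULift.up.{u} j)

namespace PathFlag
variable {m n : SimplexCategory} {k k' : SimplexCategoryᵒᵖ} {h i j : Fin (n.len + 1)}

/-- The categories of paths are posets, so simplices of their nerves are determined by vertices. -/
instance {J : Type*} [LinearOrder J] (a b : SimplicialThickening J) : Quiver.IsThin (a ⟶ b) :=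
  fun _ _ => ⟨fun f g => by
    obtain ⟨f⟩ := f
    obtain ⟨g⟩ := g
    exact congrArg _ (Subsingleton.elim f g)⟩

/-- The `l`-th vertex of a simplex, a path from `i` to `j`. -/
def path (P : PathFlag.{u} n k i j) (l : Fin (k.unop.len + 1)) :
    SimplicialThickening.Path (ULift.up.{u} i) (ULift.up.{u} j) :=
  CategoryTheory.Functor.obj (C := Fin (k.unop.len + 1)) (D := PathCat.{u} n i j) P l

/-- The set of vertices of the `l`-th path. -/
def verts (P : PathFlag.{u} n k i j) (l : Fin (k.unop.len + 1)) : Set (Fin (n.len + 1)) :=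
  {v | ULift.up v ∈ (P.path l).I}

theorem left_mem (P : PathFlag.{u} n k i j) (l) : i ∈ P.verts l := (P.path l).left

theorem right_mem (P : PathFlag.{u} n k i j) (l) : j ∈ P.verts l := (P.path l).right

theorem left_le (P : PathFlag.{u} n k i j) {l v} (hv : v ∈ P.verts l) : i ≤ v :=
  (P.path l).left_le _ hv

theorem le_right (P : PathFlag.{u} n k i j) {l v} (hv : v ∈ P.verts l) : v ≤ j :=
  (P.path l).le_right _ hv

theorem le (P : PathFlag.{u} n k i j) : i ≤ j := P.left_le (P.right_mem 0)

theorem verts_mono (P : PathFlag.{u} n k i j) : Monotone P.verts := by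
  intro l l' h v hv
  have := CategoryTheory.Functor.map (C := Fin (k.unop.len + 1)) (D := PathCat.{u} n i j) P
    (homOfLE h)
  exact this.hom.le hv

theorem ext {P Q : PathFlag.{u} n k i j} (h : ∀ l v, v ∈ P.verts l ↔ v ∈ Q.verts l) : P = Q :=
  nerve.ext_of_isThin (C := PathCat.{u} n i j) (funext fun l =>
      SimplicialThickening.Path.ext (Set.ext fun v => h l v.down))

theorem verts_ident (l) : verts (Simp.ident k (thickVertex.{u} n i) : PathFlag.{u} n k i i) l =
    {i} := by
  ext v
  exact ULift.up_inj

theorem verts_comp (P : PathFlag.{u} n k h i) (Q : PathFlag.{u} n k i j) (l) :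
    verts (Simp.comp P Q : PathFlag.{u} n k h j) l = P.verts l ∪ Q.verts l := rfl

theorem verts_act (θ : k ⟶ k') (P : PathFlag.{u} n k i j) (l) :
    verts (Simp.act θ P : PathFlag.{u} n k' i j) l = P.verts (θ.unop.toOrderHom l) := rfl

/-- The image of a flag of paths under a monotone map. -/
noncomputable def map (θ : m ⟶ n) {i j : Fin (m.len + 1)} (P : PathFlag.{u} m k i j) :
    PathFlag.{u} n k (θ.toOrderHom i) (θ.toOrderHom j) :=
  Simp.fmap (Colim.fn (thickening.{u}.map θ)) P

theorem verts_map (θ : m ⟶ n) {i j : Fin (m.len + 1)} (P : PathFlag.{u} m k i j) (l) :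
    verts (P.map θ) l = θ.toOrderHom '' P.verts l := by
  ext v
  constructor
  · rintro ⟨w, hw, e⟩
    exact ⟨w.down, hw, congrArg ULift.down e⟩
  · rintro ⟨w, hw, rfl⟩
    exact ⟨⟨w⟩, hw, rfl⟩

/-- The flag of paths from `i` to `j` obtained from a flag of sets of vertices by removing the
vertices outside `[i, j]` and adding `i` and `j`. -/
def ofFlag (n : SimplexCategory) (i j : Fin (n.len + 1)) (hij : i ≤ j)
    (A : Fin (k.unop.len + 1) → Set (Fin (n.len + 1))) (hA : Monotone A) : PathFlag.{u} n k i j :=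
  show CategoryTheory.Functor (Fin (k.unop.len + 1)) (PathCat.{u} n i j) from
  { obj := fun l =>
      { I := {v | v.down = i ∨ v.down = j ∨ (v.down ∈ A l ∧ i ≤ v.down ∧ v.down ≤ j)}
        left := Or.inl rfl
        right := Or.inr (Or.inl rfl)
        left_le := by
          rintro ⟨v⟩ (h | h | h)
          exacts [h.ge, hij.trans_eq h.symm, h.2.1]
        le_right := by
          rintro ⟨v⟩ (h | h | h)
          exacts [h.trans_le hij, h.le, h.2.2] }
    map := fun f => ⟨homOfLE fun v hv => by
      rcases hv with h | h | h
      exacts [Or.inl h, Or.inr (Or.inl h), Or.inr (Or.inr ⟨hA (leOfHom f) h.1, h.2⟩)]⟩ }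

theorem mem_verts_ofFlag {hij : i ≤ j} {A : Fin (k.unop.len + 1) → Set (Fin (n.len + 1))}
    {hA : Monotone A} {l v} : v ∈ verts (ofFlag.{u} n i j hij A hA) l ↔
      v = i ∨ v = j ∨ (v ∈ A l ∧ i ≤ v ∧ v ≤ j) := Iff.rfl

end PathFlag

/-! ### Necklaces over a standard simplex -/

namespace Necklace
variable {T U V : Necklace.{u}} {k k' : SimplexCategoryᵒᵖ} {S : SSet.{u}} {m n : SimplexCategory}

/-- The necklace `Δᵈ`, with a single bead if `d ≥ 1`. -/
def bead (d : ℕ) : Necklace.{u} where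
  dim := d
  joints := {0, Fin.last d}
  zero_mem := by simp
  last_mem := by simp

theorem mem_bead_joints {d : ℕ} {v : Fin (d + 1)} :
    v ∈ (bead.{u} d).joints ↔ v = 0 ∨ v = Fin.last d := by
  change v ∈ ({0, Fin.last d} : Finset _) ↔ _
  simp

/-- The vertex `i` of the standard simplex. -/
def simplexVertex (n : SimplexCategory) (i : Fin (n.len + 1)) :
    (SSet.stdSimplex.{u}.obj n) _⦋0⦌ := SSet.stdSimplex.objMk (OrderHom.const _ i)

/-- The vertices of a simplex of the standard simplex. -/
def simplexVtx (x : (SSet.stdSimplex.{u}.obj n).obj k) : Fin (k.unop.len + 1) →o Fin (n.len + 1) :=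
  SSet.stdSimplex.asOrderHom (n := n.len) x

theorem simplexVtx_ext {x y : (SSet.stdSimplex.{u}.obj n).obj k}
    (h : ∀ i, simplexVtx x i = simplexVtx y i) : x = y := by
  refine SSet.stdSimplex.objEquiv.injective ?_
  apply SimplexCategory.Hom.ext
  ext i : 2
  exact h i

/-- The effect on vertices of a map from a necklace to a standard simplex. -/
def vertFunOver (t : T.toSSet ⟶ SSet.stdSimplex.{u}.obj n) (v : Fin (T.dim + 1)) :
    Fin (n.len + 1) := simplexVtx (t.app (op ⦋0⦌) (T.const _ v)) 0

theorem simplexVtx_app_eq_vertFunOver (t : T.toSSet ⟶ SSet.stdSimplex.{u}.obj n) (x : T.toSSet.obj k) (i) :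
    simplexVtx (t.app k x) i = vertFunOver t (vtx x i) := by
  let θ : k ⟶ op ⦋0⦌ := (SimplexCategory.const ⦋0⦌ k.unop i).op
  have h := ConcreteCategory.congr_hom (t.naturality θ) x
  have h' : T.toSSet.map θ x = T.const _ (vtx x i) := simplex_ext fun _ => rfl
  have h2 : simplexVtx (t.app _ (T.toSSet.map θ x)) 0 =
      simplexVtx ((SSet.stdSimplex.{u}.obj n).map θ (t.app k x)) 0 :=
    congrArg (fun z => simplexVtx z 0) h
  rw [h'] at h2
  exact h2.symm

/-- The monotone map on vertices induced by a map from a necklace to a standard simplex. -/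
def vertOver (t : T.toSSet ⟶ SSet.stdSimplex.{u}.obj n) :
    Fin (T.dim + 1) →o Fin (n.len + 1) where
  toFun := vertFunOver t
  monotone' := by
    rw [Fin.monotone_iff_le_succ]
    intro i
    have h' : ∀ j ∈ T.joints, j ≤ i.castSucc ∨ i.succ ≤ j := fun j _ => by
      rcases le_or_gt j i.castSucc with h | h
      · exact Or.inl h
      · exact Or.inr (Fin.castSucc_lt_iff_succ_le.1 h)
    have e0 := simplexVtx_app_eq_vertFunOver t (T.edge _ _ (Fin.castSucc_lt_succ (i := i)).le h') 0
    have e1 := simplexVtx_app_eq_vertFunOver t (T.edge _ _ (Fin.castSucc_lt_succ (i := i)).le h') 1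
    have hm := (simplexVtx (t.app _ (T.edge _ _ (Fin.castSucc_lt_succ (i := i)).le h'))).monotone
      (show (0 : Fin 2) ≤ 1 by decide)
    rw [e0, e1] at hm
    exact hm

theorem simplexVtx_app (t : T.toSSet ⟶ SSet.stdSimplex.{u}.obj n) (x : T.toSSet.obj k) (i) :
    simplexVtx (t.app k x) i = vertOver t (vtx x i) := simplexVtx_app_eq_vertFunOver t x i

theorem over_ext {t t' : T.toSSet ⟶ SSet.stdSimplex.{u}.obj n}
    (h : ∀ v, vertOver t v = vertOver t' v) : t = t' := by
  ext k x
  exact simplexVtx_ext fun i => (simplexVtx_app t x i).trans ((h _).trans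
    (simplexVtx_app t' x i).symm)

/-- The map from a necklace to a standard simplex with given effect on the vertices. -/
def ofVert (T : Necklace.{u}) (g : Fin (T.dim + 1) →o Fin (n.len + 1)) :
    T.toSSet ⟶ SSet.stdSimplex.{u}.obj n :=
  T.subcomplex.ι ≫ SSet.stdSimplex.map (SimplexCategory.Hom.mk (a := ⦋T.dim⦌) (b := n) g)

theorem vertOver_comp (f : T ⟶ U) (t : U.toSSet ⟶ SSet.stdSimplex.{u}.obj n) (v) :
    vertOver (sMap f ≫ t) v = vertOver t (vert f v) :=
  (simplexVtx_app t ((sMap f).app (op ⦋0⦌) (T.const _ v)) 0)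

theorem vertOver_zero {i j : Fin (n.len + 1)} (t : incl.obj T ⟶
    ⟨SSet.stdSimplex.{u}.obj n, simplexVertex n i, simplexVertex n j⟩) :
    vertOver t.map 0 = i := congrArg (fun z => simplexVtx z 0) t.map_src

theorem vertOver_last {i j : Fin (n.len + 1)} (t : incl.obj T ⟶
    ⟨SSet.stdSimplex.{u}.obj n, simplexVertex n i, simplexVertex n j⟩) :
    vertOver t.map (Fin.last _) = j := congrArg (fun z => simplexVtx z 0) t.map_tgt

/-- The map from a necklace to a standard simplex with given effect on the vertices, with prescribed
first and last vertex. -/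
def overMk (T : Necklace.{u}) (g : Fin (T.dim + 1) →o Fin (n.len + 1)) {i j : Fin (n.len + 1)}
    (hi : g 0 = i) (hj : g (Fin.last _) = j) : incl.obj T ⟶
      ⟨SSet.stdSimplex.{u}.obj n, simplexVertex n i, simplexVertex n j⟩ where
  map := T.ofVert g
  map_src := simplexVtx_ext fun _ => hi
  map_tgt := simplexVtx_ext fun _ => hj

theorem vertOver_join_inl {i j : Fin (n.len + 1)} {y} (t : incl.obj T ⟶
    ⟨SSet.stdSimplex.{u}.obj n, simplexVertex n i, y⟩) (s : incl.obj U ⟶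
    ⟨SSet.stdSimplex.{u}.obj n, y, simplexVertex n j⟩) (v) :
    vertOver (join t s).map (inlV T U v) = vertOver t.map v :=
  congrArg (fun z : T.toSSet ⟶ SSet.stdSimplex.{u}.obj n => vertOver z v) (inl_join t s)

theorem vertOver_join_inr {i j : Fin (n.len + 1)} {y} (t : incl.obj T ⟶
    ⟨SSet.stdSimplex.{u}.obj n, simplexVertex n i, y⟩) (s : incl.obj U ⟶
    ⟨SSet.stdSimplex.{u}.obj n, y, simplexVertex n j⟩) (v) :
    vertOver (join t s).map (inrV T U v) = vertOver s.map v :=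
  congrArg (fun z : U.toSSet ⟶ SSet.stdSimplex.{u}.obj n => vertOver z v) (inr_join t s)

/-- The vertex `v` of `Δ^{j - i}` as a vertex of the interval `[i, j]` of `Δⁿ`. -/
def shift (i j : Fin (n.len + 1)) (hij : i ≤ j) :
    Fin ((bead.{u} (j - i : ℕ)).dim + 1) →o Fin (n.len + 1) where
  toFun v := ⟨i + v, by
    have h1 : (v : ℕ) < (j - i : ℕ) + 1 := v.2
    have h2 := j.2
    have h3 : (i : ℕ) ≤ j := hij
    omega⟩
  monotone' v w h := Nat.add_le_add_left (show (v : ℕ) ≤ w from h) _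

theorem shift_zero (i j : Fin (n.len + 1)) (hij : i ≤ j) : shift.{u} i j hij 0 = i := rfl

theorem shift_last (i j : Fin (n.len + 1)) (hij : i ≤ j) :
    shift.{u} i j hij (Fin.last _) = j :=
  Fin.ext (show (i : ℕ) + (j - i) = j from Nat.add_sub_cancel' hij)

theorem shift_injective (i j : Fin (n.len + 1)) (hij : i ≤ j) :
    Function.Injective (shift.{u} i j hij) := fun _ _ h =>
  Fin.ext (Nat.add_left_cancel (congrArg Fin.val h))

theorem exists_shift {i j : Fin (n.len + 1)} (hij : i ≤ j) {v} (h : i ≤ v) (h' : v ≤ j) :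
    ∃ w, shift.{u} i j hij w = v := by
  have h : (i : ℕ) ≤ v := h
  have h' : (v : ℕ) ≤ j := h'
  exact ⟨⟨v - i, show (v - i : ℕ) < (j - i : ℕ) + 1 by omega⟩,
    Fin.ext (show (i : ℕ) + (v - i) = v by omega)⟩

/-- The interval `[i, j]` as a necklace over `Δⁿ`. -/
def interval (i j : Fin (n.len + 1)) (hij : i ≤ j) : incl.obj (bead.{u} (j - i : ℕ)) ⟶
    ⟨SSet.stdSimplex.{u}.obj n, simplexVertex n i, simplexVertex n j⟩ :=
  overMk _ (shift i j hij) (shift_zero i j hij) (shift_last i j hij)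

/-- Every necklace over `Δⁿ` from `i` to `j` factors through the interval `[i, j]`. -/
theorem exists_factor {i j : Fin (n.len + 1)} (t : incl.obj T ⟶
    ⟨SSet.stdSimplex.{u}.obj n, simplexVertex n i, simplexVertex n j⟩) (hij : i ≤ j) :
    ∃ f : T ⟶ bead (j - i : ℕ), t = incl.map f ≫ interval i j hij := by
  have h0 := vertOver_zero t
  have h1 := vertOver_last t
  let g : Fin (T.dim + 1) →o Fin ((bead.{u} (j - i : ℕ)).dim + 1) :=
    { toFun := fun v => ⟨vertOver t.map v - i, by
        have h2 : vertOver t.map v ≤ vertOver t.map (Fin.last _) :=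
          (vertOver t.map).monotone (Fin.le_last v)
        rw [h1] at h2
        have h2 : (vertOver t.map v : ℕ) ≤ j := h2
        change _ < (j - i : ℕ) + 1
        omega⟩
      monotone' := fun v w h =>
        Nat.sub_le_sub_right (show (vertOver t.map v : ℕ) ≤ vertOver t.map w from
          (vertOver t.map).monotone h) _ }
  have g0 : g 0 = 0 := Fin.ext (show (vertOver t.map 0 : ℕ) - i = 0 by rw [h0]; omega)
  have g1 : g (Fin.last _) = Fin.last _ :=
    Fin.ext (show (vertOver t.map (Fin.last _) : ℕ) - i = j - i by rw [h1])
  refine ⟨homMk g g0 g1 fun b hb => ?_, BipointedSSet.Hom.ext (over_ext fun v => ?_)⟩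
  · rcases mem_bead_joints.1 hb with rfl | rfl
    exacts [⟨0, T.zero_mem, g0⟩, ⟨Fin.last _, T.last_mem, g1⟩]
  · refine Eq.trans ?_ (vertOver_comp (homMk g g0 g1 _) (interval.{u} i j hij).map v).symm
    rw [vert_homMk]
    have h2 : vertOver t.map 0 ≤ vertOver t.map v := (vertOver t.map).monotone (Fin.zero_le v)
    rw [h0] at h2
    exact Fin.ext (show (vertOver t.map v : ℕ) = i + (vertOver t.map v - i) from
      (Nat.add_sub_cancel' h2).symm)

end Necklace

namespace FlagCell
open Necklace
variable {k k' : SimplexCategoryᵒᵖ} {m n : SimplexCategory} {T U : Necklace.{u}}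

/-- A simplex of a mapping space over `Δⁿ` is determined by the images in `Δⁿ` of the sets of
vertices of its flag. -/
theorem mk_eq_mk {i j : Fin (n.len + 1)} {t : incl.obj T ⟶
    ⟨SSet.stdSimplex.{u}.obj n, simplexVertex n i, simplexVertex n j⟩}
    {t' : incl.obj U ⟶ ⟨SSet.stdSimplex.{u}.obj n, simplexVertex n i, simplexVertex n j⟩}
    {c : (cubeNerve.{u}.obj (toCube.obj T)).obj k} {c' : (cubeNerve.{u}.obj (toCube.obj U)).obj k}
    (h : ∀ l, vertOver t.map '' verts c l = vertOver t'.map '' verts c' l) :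
    mk t c = mk t' c' := by
  have hij : i ≤ j := by
    have h : vertOver t.map 0 ≤ vertOver t.map (Fin.last _) :=
      (vertOver t.map).monotone (Fin.zero_le _)
    exact (vertOver_zero t).symm.trans_le (h.trans_eq (vertOver_last t))
  obtain ⟨f, rfl⟩ := exists_factor t hij
  obtain ⟨f', rfl⟩ := exists_factor t' hij
  rw [mk_comp, mk_comp]
  refine congrArg _ (verts_ext fun l v => ?_)
  rw [verts_map, verts_map]
  have key (W : Necklace.{u}) (f : W ⟶ bead (j - i : ℕ)) (A : Set (Fin (W.dim + 1))) :
      vertOver (incl.map f ≫ interval i j hij).map '' A = shift i j hij '' (vert f '' A) := by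
    rw [Set.image_image]
    exact Set.image_congr fun a _ => vertOver_comp f (interval.{u} i j hij).map a
  have := h l
  rw [key, key] at this
  rw [(shift_injective i j hij).image_injective this]

/-- The simplex given by a flag of paths from `i` to `j`. -/
noncomputable def ofPath {i j : Fin (n.len + 1)} (P : PathFlag.{u} n k i j) :
    FlagCell (SSet.stdSimplex.{u}.obj n) k (simplexVertex n i) (simplexVertex n j) :=
  mk (interval i j P.le) (Necklace.ofFlag _ (fun l => shift i j P.le ⁻¹' P.verts l)
    fun _ _ h => Set.preimage_mono (P.verts_mono h))

theorem image_ofPath {i j : Fin (n.len + 1)} (P : PathFlag.{u} n k i j) (l) :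
    vertOver (interval i j P.le).map '' verts (Necklace.ofFlag _
      (fun l => shift i j P.le ⁻¹' P.verts l) fun _ _ h => Set.preimage_mono (P.verts_mono h)) l =
        P.verts l := by
  ext v
  constructor
  · rintro ⟨w, hw, rfl⟩
    rcases mem_verts_ofFlag.1 hw with h | h
    · rcases mem_bead_joints.1 h with rfl | rfl
      · exact (congrArg (· ∈ P.verts l) (shift_zero.{u} i j P.le)).mpr (P.left_mem l)
      · exact (congrArg (· ∈ P.verts l) (shift_last.{u} i j P.le)).mpr (P.right_mem l)
    · exact h
  · intro hv
    obtain ⟨w, rfl⟩ := exists_shift P.le (P.left_le hv) (P.le_right hv)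
    exact ⟨w, mem_verts_ofFlag.2 (Or.inr hv), rfl⟩

theorem ofPath_eq_mk {i j : Fin (n.len + 1)} (P : PathFlag.{u} n k i j) {t : incl.obj T ⟶
    ⟨SSet.stdSimplex.{u}.obj n, simplexVertex n i, simplexVertex n j⟩}
    {c : (cubeNerve.{u}.obj (toCube.obj T)).obj k}
    (h : ∀ l, P.verts l = vertOver t.map '' verts c l) : ofPath P = mk t c :=
  mk_eq_mk fun l => (image_ofPath P l).trans (h l)

theorem ofPath_act (θ : k ⟶ k') {i j : Fin (n.len + 1)} (P : PathFlag.{u} n k i j) :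
    ofPath (Simp.act θ P) = Simp.act (C := triRig.obj (SSet.stdSimplex.{u}.obj n))
      (X := simplexVertex n i) (Y := simplexVertex n j) θ (ofPath P) := by
  refine Eq.trans (ofPath_eq_mk _ fun l => ?_) (act_mk θ _ _).symm
  rw [Necklace.verts_act, image_ofPath, PathFlag.verts_act]

theorem ofPath_ident (i : Fin (n.len + 1)) :
    ofPath (Simp.ident k (thickVertex.{u} n i) : PathFlag.{u} n k i i) =
      Simp.ident (C := triRig.obj (SSet.stdSimplex.{u}.obj n)) k (simplexVertex n i) := by
  refine Eq.trans (ofPath_eq_mk _ (c := Necklace.ofFlag _ (fun _ => ∅) fun _ _ _ => le_rfl)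
    fun l => ?_) (ident_eq _ _).symm
  rw [PathFlag.verts_ident]
  ext v
  constructor
  · rintro rfl
    exact ⟨0, joints_subset_verts _ _ point.zero_mem, rfl⟩
  · rintro ⟨w, -, rfl⟩
    rfl

theorem ofPath_comp {h i j : Fin (n.len + 1)} (P : PathFlag.{u} n k h i)
    (Q : PathFlag.{u} n k i j) : ofPath (Simp.comp P Q : PathFlag.{u} n k h j) =
      Simp.comp (C := triRig.obj (SSet.stdSimplex.{u}.obj n)) (X := simplexVertex n h)
        (Y := simplexVertex n i) (Z := simplexVertex n j) (ofPath P) (ofPath Q) := by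
  refine Eq.trans (ofPath_eq_mk _ fun l => ?_) (comp_mk _ _ _ _).symm
  rw [PathFlag.verts_comp, verts_wedge, Set.image_union, Set.image_image, Set.image_image]
  simp only [vertOver_join_inl, vertOver_join_inr]
  exact congrArg₂ _ (image_ofPath P l).symm (image_ofPath Q l).symm

theorem ofPath_map (θ : m ⟶ n) {i j : Fin (m.len + 1)} (P : PathFlag.{u} m k i j) :
    ofPath (P.map θ) = Simp.fmap (Colim.fn (triRig.map (SSet.stdSimplex.{u}.map θ)))
      (X := simplexVertex m i) (Y := simplexVertex m j) (ofPath P) := by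
  let φ : SSet.stdSimplex.{u}.obj m ⟶ SSet.stdSimplex.{u}.obj n := SSet.stdSimplex.{u}.map θ
  let t : incl.obj (bead (j - i : ℕ)) ⟶ ⟨SSet.stdSimplex.{u}.obj n,
      simplexVertex n (θ.toOrderHom i), simplexVertex n (θ.toOrderHom j)⟩ :=
    interval.{u} i j P.le ≫ mappingSpace.bip φ (simplexVertex m i) (simplexVertex m j)
  refine Eq.trans (ofPath_eq_mk (P.map θ) (t := t) fun l => ?_)
    (fmap_mk φ (interval i j P.le) _).symm
  rw [PathFlag.verts_map, ← image_ofPath P l, Set.image_image]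
  rfl

end FlagCell

open Necklace in
/-- The functor from `𝔠(Δⁿ)` to the triangulation of the cubical rigidification of `Δⁿ`. -/
noncomputable def thickeningUnitApp (n : SimplexCategory) :
    EnrichedFunctor SSet.{u} (thickening.{u}.obj n) (triRig.{u}.obj (SSet.stdSimplex.{u}.obj n)) where
  obj a := simplexVertex n (SimplicialThickening.as a).down
  map a b :=
    { app := fun k => ↾fun P : PathFlag.{u} n k (SimplicialThickening.as a).down
        (SimplicialThickening.as b).down => FlagCell.ofPath P
      naturality := fun k k' θ => by
        ext P
        exact FlagCell.ofPath_act θ P }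
  map_id a := by
    ext k x
    exact FlagCell.ofPath_ident _
  map_comp a b c := by
    ext k ⟨P, Q⟩
    exact FlagCell.ofPath_comp P Q

/-- The natural transformation from `𝔠(Δⁿ)` to the triangulation of the cubical rigidification of
`Δⁿ`. -/
noncomputable def thickeningUnit : thickening.{u} ⟶ SSet.stdSimplex.{u} ⋙ triRig.{u} where
  app n := thickeningUnitApp n
  naturality m n θ := by
    refine enrichedFunctor_ext (fun _ => rfl) fun a b => heq_of_eq ?_
    ext k P
    exact FlagCell.ofPath_map θ P

/-! ### Evaluating flags in a simplicial category -/

/-- A compatible family of simplicial functors `𝔠(Δⁿ) ⟶ C`, one for each `n`-simplex of `S`, that is,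
a map from `S` to the homotopy coherent nerve of `C`. -/
structure SimplexFamily (S : SSet.{u}) (C : Type u) [EnrichedCategory SSet.{u} C] where
  leg : ∀ {n : SimplexCategory}, S.obj (op n) → EnrichedFunctor SSet.{u} (thickening.{u}.obj n) C
  leg_map : ∀ {m n : SimplexCategory} (θ : m ⟶ n) (σ : S.obj (op n)),
    (Colim.fn (thickening.{u}.map θ)).comp SSet.{u} (leg σ) = leg (S.map θ.op σ)

namespace SimplexFamily
open Necklace
variable {S : SSet.{u}} {C : Type u} [EnrichedCategory SSet.{u} C] (s : SimplexFamily S C)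
  {m n : SimplexCategory} {k k' : SimplexCategoryᵒᵖ} {T U V : Necklace.{u}}

/-- The object of `C` that corresponds to a vertex of `S`. -/
def ob (x : S _⦋0⦌) : C := (s.leg x).obj (thickVertex ⦋0⦌ 0)

theorem leg_obj (σ : S.obj (op n)) (i : Fin (n.len + 1)) : (s.leg σ).obj (thickVertex n i) =
    ob s (S.map (SimplexCategory.const ⦋0⦌ n i).op σ) :=
  congrArg (fun G => EnrichedFunctor.obj G (thickVertex ⦋0⦌ 0))
    (s.leg_map (SimplexCategory.const ⦋0⦌ n i) σ)

/-- The image in `C` of a simplex of a mapping space of `𝔠(Δⁿ)` under the leg at a simplex `σ`,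
with end points specified up to equality. -/
noncomputable def gen (σ : S.obj (op n)) {i j : Fin (n.len + 1)} {x y : C}
    (hx : (s.leg σ).obj (thickVertex n i) = x) (hy : (s.leg σ).obj (thickVertex n j) = y)
    (P : PathFlag.{u} n k i j) : Simp.Hom.{u} k x y := by
  subst hx hy
  exact Simp.fmap (s.leg σ) P

section gen
variable {s} {σ : S.obj (op n)} {h i j : Fin (n.len + 1)} {x y z : C}

theorem gen_heq (hx : (s.leg σ).obj (thickVertex n i) = x)
    (hy : (s.leg σ).obj (thickVertex n j) = y) (P : PathFlag.{u} n k i j) :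
    HEq (gen s σ hx hy P) (Simp.fmap (s.leg σ) P) := by
  subst hx hy
  rfl

theorem gen_ident (hx hx' : (s.leg σ).obj (thickVertex n i) = x) :
    gen s σ hx hx' (Simp.ident k (thickVertex n i)) = Simp.ident k x := by
  subst hx
  exact Simp.fmap_ident (s.leg σ) _

theorem gen_comp (hx : (s.leg σ).obj (thickVertex n h) = x)
    (hy : (s.leg σ).obj (thickVertex n i) = y) (hz : (s.leg σ).obj (thickVertex n j) = z)
    (P : PathFlag.{u} n k h i) (Q : PathFlag.{u} n k i j) :
    gen s σ hx hz (Simp.comp P Q) = Simp.comp (gen s σ hx hy P) (gen s σ hy hz Q) := by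
  subst hx hy hz
  exact Simp.fmap_comp (s.leg σ) P Q

theorem gen_act (θ : k ⟶ k') (hx : (s.leg σ).obj (thickVertex n i) = x)
    (hy : (s.leg σ).obj (thickVertex n j) = y) (P : PathFlag.{u} n k i j) :
    gen s σ hx hy (Simp.act θ P) = Simp.act θ (gen s σ hx hy P) := by
  subst hx hy
  exact Simp.fmap_act (s.leg σ) θ P

/-- The compatibility of the family of functors, for simplices of mapping spaces that correspond
under a map `θ` of standard simplices. -/
theorem gen_eq_gen (θ : m ⟶ n) {σ' : S.obj (op m)} (hσ : S.map θ.op σ = σ')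
    {i' j' : Fin (m.len + 1)} (hi : θ.toOrderHom i' = i) (hj : θ.toOrderHom j' = j)
    {P : PathFlag.{u} n k i j} {P' : PathFlag.{u} m k i' j'}
    (hP : ∀ l, P.verts l = θ.toOrderHom '' P'.verts l)
    (hx : (s.leg σ).obj (thickVertex n i) = x) (hy : (s.leg σ).obj (thickVertex n j) = y)
    (hx' : (s.leg σ').obj (thickVertex m i') = x) (hy' : (s.leg σ').obj (thickVertex m j') = y) :
    gen s σ hx hy P = gen s σ' hx' hy' P' := by
  subst hσ hi hj
  obtain rfl : P = P'.map θ := PathFlag.ext fun l v => by rw [hP, PathFlag.verts_map]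
  refine eq_of_heq ((gen_heq hx hy _).trans (HEq.trans ?_ (gen_heq hx' hy' _).symm))
  exact Simp.fmap_congr (s.leg_map θ σ) P'

end gen

/-- The object of `C` that corresponds to a vertex of a necklace over `S`. -/
def obAt (t : T.toSSet ⟶ S) (v : Fin (T.dim + 1)) : C := ob s (t.app _ (T.const _ v))

theorem leg_obj_app (t : T.toSSet ⟶ S) (τ : T.toSSet.obj (op n)) (i : Fin (n.len + 1)) :
    (s.leg (t.app (op n) τ)).obj (thickVertex n i) = obAt s t (vtx τ i) := by
  rw [leg_obj]
  refine congrArg (ob s) ?_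
  refine (ConcreteCategory.congr_hom (t.naturality (SimplexCategory.const ⦋0⦌ n i).op) τ).symm.trans
    (congrArg (t.app (op ⦋0⦌)) ?_)
  exact simplex_ext fun _ => rfl

/-- The simplex of `T` obtained by collapsing all vertices of `T` onto the interval `[a, b]`, which
has to be contained in a bead. -/
def clamp (T : Necklace.{u}) (a b : Fin (T.dim + 1)) (hab : a ≤ b)
    (hj : ∀ j ∈ T.joints, j ≤ a ∨ b ≤ j) : T.toSSet.obj (op ⦋T.dim⦌) :=
  ofVtx ⟨fun v : Fin (T.dim + 1) => max a (min v b),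
    fun _ _ h => max_le_max le_rfl (min_le_min h le_rfl)⟩ fun j h => by
      rcases hj j h with h | h
      · exact Or.inr fun v => h.trans (le_max_left _ _)
      · exact Or.inl fun v => (max_le hab (min_le_right _ _)).trans h

theorem vtx_clamp {a b : Fin (T.dim + 1)} (hab : a ≤ b) (hj : ∀ j ∈ T.joints, j ≤ a ∨ b ≤ j)
    (v : Fin (T.dim + 1)) : vtx (clamp T a b hab hj) v = max a (min v b) := rfl

theorem leg_obj_clamp (t : T.toSSet ⟶ S) {a b : Fin (T.dim + 1)} (hab : a ≤ b)
    (hj : ∀ j ∈ T.joints, j ≤ a ∨ b ≤ j) (v : Fin (T.dim + 1)) (h : a ≤ v) (h' : v ≤ b) :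
    (s.leg (t.app _ (clamp T a b hab hj))).obj (thickVertex ⦋T.dim⦌ v) = obAt s t v := by
  refine (leg_obj_app s t (clamp T a b hab hj) v).trans (congrArg (obAt s t) ?_)
  rw [vtx_clamp, min_eq_left h', max_eq_right h]

variable (t : T.toSSet ⟶ S) (c : (cubeNerve.{u}.obj (toCube.obj T)).obj k)
  {F : Fin (T.dim + 1) → C} (hF : ∀ v, obAt s t v = F v)

/-- The image in `C` of the part of a flag that lies in an interval `[a, b]` contained in a
bead. -/
noncomputable def piece (a b : Fin (T.dim + 1)) (hab : a ≤ b) (hj : ∀ j ∈ T.joints, j ≤ a ∨ b ≤ j) :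
    Simp.Hom.{u} k (F a) (F b) :=
  gen s (t.app _ (clamp T a b hab hj))
    ((leg_obj_clamp s t hab hj a le_rfl hab).trans (hF a))
    ((leg_obj_clamp s t hab hj b hab le_rfl).trans (hF b))
    (PathFlag.ofFlag ⦋T.dim⦌ a b hab (verts c) (verts_mono c))

variable {s t c hF}

theorem piece_self (a : Fin (T.dim + 1)) (hj) :
    piece s t c hF a a le_rfl hj = Simp.ident k (F a) := by
  refine Eq.trans (congrArg (gen s _ _ _) (PathFlag.ext fun l v => ?_))
    (gen_ident ((leg_obj_clamp s t le_rfl hj a le_rfl le_rfl).trans (hF a)) _)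
  rw [PathFlag.verts_ident, PathFlag.mem_verts_ofFlag]
  constructor
  · rintro (h | h | h)
    exacts [h, h, le_antisymm h.2.2 h.2.1]
  · exact Or.inl

/-- A piece of a flag can be computed in any larger interval of the same bead. -/
theorem piece_restrict {a b d e : Fin (T.dim + 1)} (hab : a ≤ b) (hda : d ≤ a) (hbe : b ≤ e)
    (hj : ∀ j ∈ T.joints, j ≤ d ∨ e ≤ j) (hj' : ∀ j ∈ T.joints, j ≤ a ∨ b ≤ j)
    (hx : (s.leg (t.app _ (clamp T d e (hda.trans (hab.trans hbe)) hj))).obj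
      (thickVertex ⦋T.dim⦌ a) = F a)
    (hy : (s.leg (t.app _ (clamp T d e (hda.trans (hab.trans hbe)) hj))).obj
      (thickVertex ⦋T.dim⦌ b) = F b) :
    gen s (t.app _ (clamp T d e (hda.trans (hab.trans hbe)) hj)) hx hy
      (PathFlag.ofFlag ⦋T.dim⦌ a b hab (verts c) (verts_mono c)) =
        piece s t c hF a b hab hj' := by
  let θ : ⦋T.dim⦌ ⟶ ⦋T.dim⦌ := SimplexCategory.Hom.mk (vtx (clamp T a b hab hj'))
  have hθ (v : Fin (T.dim + 1)) (h : a ≤ v) (h' : v ≤ b) : θ.toOrderHom v = v :=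
    (vtx_clamp hab hj' v).trans (by rw [min_eq_left h', max_eq_right h])
  refine gen_eq_gen θ ?_ (hθ a le_rfl hab) (hθ b hab le_rfl) (fun l => ?_) _ _ _ _
  · refine (ConcreteCategory.congr_hom (t.naturality θ.op)
      (clamp T d e (hda.trans (hab.trans hbe)) hj)).symm.trans (congrArg (t.app _) ?_)
    refine simplex_ext fun v => ?_
    change max d (min (max a (min v b)) e) = max a (min v b)
    have h1 : max a (min v b) ≤ e := (max_le hab (min_le_right _ _)).trans hbe
    have h2 : d ≤ max a (min v b) := hda.trans (le_max_left _ _)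
    rw [min_eq_left h1, max_eq_right h2]
  · ext v
    constructor
    · intro hv
      exact ⟨v, hv, hθ v (PathFlag.left_le _ hv) (PathFlag.le_right _ hv)⟩
    · rintro ⟨w, hw, rfl⟩
      rw [hθ w (PathFlag.left_le _ hw) (PathFlag.le_right _ hw)]
      exact hw

/-- Pieces compose at vertices that belong to all sets of the flag. -/
theorem piece_comp {a b d : Fin (T.dim + 1)} (hab : a ≤ b) (hbd : b ≤ d)
    (hj : ∀ j ∈ T.joints, j ≤ a ∨ d ≤ j) (hj₁ : ∀ j ∈ T.joints, j ≤ a ∨ b ≤ j)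
    (hj₂ : ∀ j ∈ T.joints, j ≤ b ∨ d ≤ j) (hb : b ∈ verts c 0) :
    piece s t c hF a d (hab.trans hbd) hj =
      Simp.comp (piece s t c hF a b hab hj₁) (piece s t c hF b d hbd hj₂) := by
  have hy := (leg_obj_clamp s t (hab.trans hbd) hj b hab hbd).trans (hF b)
  rw [← piece_restrict hab le_rfl hbd hj hj₁ ((leg_obj_clamp s t (hab.trans hbd) hj a le_rfl
    (hab.trans hbd)).trans (hF a)) hy, ← piece_restrict hbd hab le_rfl hj hj₂ hy
    ((leg_obj_clamp s t (hab.trans hbd) hj d (hab.trans hbd) le_rfl).trans (hF d)), ← gen_comp]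
  refine congrArg (gen s _ _ _) (PathFlag.ext fun l v => ?_)
  have hb' : b ∈ verts c l := verts_mono c (Fin.zero_le l) hb
  rw [PathFlag.verts_comp, Set.mem_union, PathFlag.mem_verts_ofFlag, PathFlag.mem_verts_ofFlag,
    PathFlag.mem_verts_ofFlag]
  constructor
  · rintro (h | h | ⟨h, h1, h2⟩)
    · exact Or.inl (Or.inl h)
    · exact Or.inr (Or.inr (Or.inl h))
    · rcases le_total v b with h3 | h3
      · exact Or.inl (Or.inr (Or.inr ⟨h, h1, h3⟩))
      · exact Or.inr (Or.inr (Or.inr ⟨h, h3, h2⟩))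
  · rintro ((rfl | rfl | ⟨h, h1, h2⟩) | (rfl | rfl | ⟨h, h1, h2⟩))
    · exact Or.inl rfl
    · exact Or.inr (Or.inr ⟨hb', hab, hbd⟩)
    · exact Or.inr (Or.inr ⟨h, h1, h2.trans hbd⟩)
    · exact Or.inr (Or.inr ⟨hb', hab, hbd⟩)
    · exact Or.inr (Or.inl rfl)
    · exact Or.inr (Or.inr ⟨h, hab.trans h1, h2⟩)

variable (s t c hF) in
/-- A family of simplices of the mapping spaces from a fixed object to the objects that correspond to
the vertices of a necklace is a development of a flag along a set of vertices `B` if it is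
compatible with the pieces of the flag that start in `B`. -/
def IsDevelopment (B : Set (Fin (T.dim + 1))) {x : C} (L : ∀ v, Simp.Hom.{u} k x (F v)) : Prop :=
  ∀ a b (hab : a ≤ b) (hj : ∀ j ∈ T.joints, j ≤ a ∨ b ≤ j), a ∈ B →
    L b = Simp.comp (L a) (piece s t c hF a b hab hj)

theorem exists_prevJoint (T : Necklace.{u}) (v : Fin (T.dim + 1)) (hv : v ≠ 0) :
    ∃ a ∈ T.joints, a < v ∧ ∀ j ∈ T.joints, j ≤ a ∨ v ≤ j := by
  have h : (T.joints.filter (· < v)).Nonempty :=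
    ⟨0, Finset.mem_filter.2 ⟨T.zero_mem, Fin.pos_of_ne_zero hv⟩⟩
  obtain ⟨h1, h2⟩ := Finset.mem_filter.1 (Finset.max'_mem _ h)
  refine ⟨_, h1, h2, fun j hj => ?_⟩
  rcases lt_or_ge j v with h' | h'
  · exact Or.inl (Finset.le_max' _ _ (Finset.mem_filter.2 ⟨hj, h'⟩))
  · exact Or.inr h'

/-- A development along the joints is determined by its value at the first vertex. -/
theorem IsDevelopment.unique {B B' : Set (Fin (T.dim + 1))} (hB : ∀ j ∈ T.joints, j ∈ B)
    (hB' : ∀ j ∈ T.joints, j ∈ B') {x : C} {L L' : ∀ v, Simp.Hom.{u} k x (F v)}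
    (h : IsDevelopment s t c hF B L) (h' : IsDevelopment s t c hF B' L') (h0 : L 0 = L' 0) (v) :
    L v = L' v := by
  induction v using WellFoundedLT.induction with
  | _ v ih =>
  by_cases hv : v = 0
  · subst hv
    exact h0
  · obtain ⟨a, ha, hav, hj⟩ := exists_prevJoint T v hv
    rw [h a v hav.le hj (hB a ha), h' a v hav.le hj (hB' a ha), ih a hav]

variable (s t c hF) in
/-- Every flag has a development along its smallest set of vertices, with given initial value: go
from each vertex back to the preceding joint. -/
theorem exists_development {x : C} (f : Simp.Hom.{u} k x (F 0)) :
    ∃ L : ∀ v, Simp.Hom.{u} k x (F v), L 0 = f ∧ IsDevelopment s t c hF (verts c 0) L := by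
  choose p hp hpv hpj using exists_prevJoint T
  let L : ∀ v, Simp.Hom.{u} k x (F v) := WellFoundedLT.fix fun v ih =>
    if hv : v = 0 then hv ▸ f
    else Simp.comp (ih (p v hv) (hpv v hv)) (piece s t c hF _ v (hpv v hv).le (hpj v hv))
  have h0 : L 0 = f := by
    change WellFoundedLT.fix _ _ = _
    rw [WellFoundedLT.fix_eq]
    simp
  have hL (v) (hv : v ≠ 0) : L v =
      Simp.comp (L (p v hv)) (piece s t c hF _ v (hpv v hv).le (hpj v hv)) := by
    change WellFoundedLT.fix _ _ = _
    rw [WellFoundedLT.fix_eq, dif_neg hv]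
  have hL' (v) (hv : v ≠ 0) (a) (hav : a < v) (ha : a ∈ T.joints)
      (hj : ∀ j ∈ T.joints, j ≤ a ∨ v ≤ j) :
      L v = Simp.comp (L a) (piece s t c hF a v hav.le hj) := by
    obtain rfl : a = p v hv := by
      apply le_antisymm
      · exact (hpj v hv a ha).resolve_right hav.not_ge
      · exact (hj _ (hp v hv)).resolve_right (hpv v hv).not_ge
    exact hL v hv
  refine ⟨L, h0, fun a b hab hj ha => ?_⟩
  rcases hab.eq_or_lt with rfl | hlt
  · rw [piece_self, Simp.comp_ident]
  have hb : b ≠ 0 := (Fin.zero_le a).trans_lt hlt |>.ne'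
  by_cases haj : a ∈ T.joints
  · exact hL' b hb a hlt haj hj
  · have ha0 : a ≠ 0 := fun h => haj (h ▸ T.zero_mem)
    -- `a` is not a joint, so `a` and `b` have the same preceding joint
    have hj' : ∀ j ∈ T.joints, j ≤ p a ha0 ∨ b ≤ j := fun j h => by
      rcases hj j h with h' | h'
      · exact Or.inl ((hpj a ha0 j h).resolve_right fun h'' => haj (le_antisymm h'' h' ▸ h))
      · exact Or.inr h'
    rw [hL' b hb (p a ha0) ((hpv a ha0).trans hlt) (hp a ha0) hj', hL a ha0, Simp.comp_assoc,
      ← piece_comp]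
    exact ha

variable (s t c) in
/-- The composite of the pieces of a flag. -/
noncomputable def eval {x y : C} (hx : obAt s t 0 = x) (hy : obAt s t (Fin.last _) = y) :
    Simp.Hom.{u} k x y := by
  subst hx hy
  exact (exists_development s t c (F := obAt s t) (fun _ => rfl) (Simp.ident k _)).choose (Fin.last _)

/-- A development along a set of vertices that contains the joints computes the composite of the
pieces. -/
theorem IsDevelopment.last_eq {B : Set (Fin (T.dim + 1))} (hB : ∀ j ∈ T.joints, j ∈ B) {x : C}
    {L : ∀ v, Simp.Hom.{u} k x (F v)} (h : IsDevelopment s t c hF B L) :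
    L (Fin.last _) = Simp.comp (L 0) (eval s t c (hF 0) (hF (Fin.last _))) := by
  obtain rfl : obAt s t = F := funext hF
  have h' := (exists_development s t c (F := obAt s t) (fun _ => rfl) (Simp.ident k _)).choose_spec
  set L' := (exists_development s t c (F := obAt s t) (fun _ => rfl) (Simp.ident k _)).choose with hL
  refine h.unique (L' := fun v => Simp.comp (L 0) (L' v)) hB
    (fun j hj => joints_subset_verts c 0 hj) (fun a b hab hj ha => ?_) ?_ (Fin.last _)
  · beta_reduce
    rw [h'.2 a b hab hj ha, Simp.comp_assoc]
  · rw [h'.1, Simp.comp_ident]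

variable (s t c hF) in
theorem exists_development_eval :
    ∃ L : ∀ v, Simp.Hom.{u} k (F 0) (F v), IsDevelopment s t c hF (verts c 0) L ∧
      L 0 = Simp.ident k (F 0) ∧ L (Fin.last _) = eval s t c (hF 0) (hF (Fin.last _)) := by
  obtain ⟨L, h0, h⟩ := exists_development s t c hF (Simp.ident k (F 0))
  refine ⟨L, h, h0, ?_⟩
  rw [h.last_eq fun j hj => joints_subset_verts c 0 hj, h0, Simp.ident_comp]

/-- A development can be pulled back along a map of simplicial sets between necklaces. -/
theorem IsDevelopment.pullback {p : U.toSSet ⟶ T.toSSet} {φ : Fin (U.dim + 1) →o Fin (T.dim + 1)}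
    (hp : ∀ {k : SimplexCategoryᵒᵖ} (x : U.toSSet.obj k) i, vtx (p.app k x) i = φ (vtx x i))
    {d : (cubeNerve.{u}.obj (toCube.obj U)).obj k}
    (hd : ∀ l, ∀ v ∈ verts d l, φ v ∈ verts c l)
    (hd' : ∀ l, ∀ v ∈ verts c l, ∀ a b, φ a < v → v < φ b → ∃ w ∈ verts d l, φ w = v)
    (hF' : ∀ v, obAt s (p ≫ t) v = F (φ v)) {x : C}
    {L : ∀ v, Simp.Hom.{u} k x (F v)} (h : IsDevelopment s t c hF (verts c 0) L) :
    IsDevelopment s (p ≫ t) d (F := fun v => F (φ v)) hF' (verts d 0) fun v => L (φ v) := by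
  intro a b hab hj ha
  have hj' : ∀ j ∈ T.joints, j ≤ φ a ∨ φ b ≤ j := fun j hj₁ => by
    rcases vtx_joint (p.app _ (U.edge a b hab hj)) hj₁ with h | h
    · exact Or.inr ((hp (U.edge a b hab hj) 1).symm.trans_le (h 1))
    · exact Or.inl ((h 0).trans_eq (hp (U.edge a b hab hj) 0))
  beta_reduce
  rw [h (φ a) (φ b) (φ.monotone hab) hj' (hd 0 a ha)]
  refine congrArg (Simp.comp (L (φ a))) ?_
  let θ : ⦋U.dim⦌ ⟶ ⦋T.dim⦌ := SimplexCategory.Hom.mk φ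
  refine gen_eq_gen θ ?_ rfl rfl (fun l => ?_) _ _ _ _
  · refine (ConcreteCategory.congr_hom (t.naturality θ.op)
      (clamp T _ _ (φ.monotone hab) hj')).symm.trans (congrArg (t.app _) ?_)
    refine simplex_ext fun v => ?_
    refine Eq.trans ?_ (hp (clamp U a b hab hj) v).symm
    rw [vtx_clamp, φ.monotone.map_max, φ.monotone.map_min]
    rfl
  · ext v
    constructor
    · rintro (h | h | ⟨h, h1, h2⟩)
      · exact ⟨a, Or.inl rfl, h.symm⟩
      · exact ⟨b, Or.inr (Or.inl rfl), h.symm⟩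
      · rcases h1.eq_or_lt with h1 | h1
        · exact ⟨a, Or.inl rfl, h1⟩
        rcases h2.eq_or_lt with h2 | h2
        · exact ⟨b, Or.inr (Or.inl rfl), h2.symm⟩
        obtain ⟨w, hw, rfl⟩ := hd' l v h a b h1 h2
        exact ⟨w, Or.inr (Or.inr ⟨hw, (φ.monotone.reflect_lt h1).le,
          (φ.monotone.reflect_lt h2).le⟩), rfl⟩
    · rintro ⟨w, h | h | ⟨h, h1, h2⟩, rfl⟩
      · exact Or.inl (congrArg φ h)
      · exact Or.inr (Or.inl (congrArg φ h))
      · exact Or.inr (Or.inr ⟨hd l w h, φ.monotone h1, φ.monotone h2⟩)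

theorem obAt_comp {p : U.toSSet ⟶ T.toSSet} {φ : Fin (U.dim + 1) →o Fin (T.dim + 1)}
    (hp : ∀ {k : SimplexCategoryᵒᵖ} (x : U.toSSet.obj k) i, vtx (p.app k x) i = φ (vtx x i))
    (t : T.toSSet ⟶ S) (v) : obAt s (p ≫ t) v = obAt s t (φ v) :=
  congrArg (fun x => ob s (t.app _ x)) (simplex_ext fun i => hp (U.const _ v) i)

/-- The value of a flag does not change under maps of necklaces over `S`. -/
theorem eval_map (f : U ⟶ T) (d : (cubeNerve.{u}.obj (toCube.obj U)).obj k) {x y : C}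
    (hx : obAt s (sMap f ≫ t) 0 = x) (hy : obAt s (sMap f ≫ t) (Fin.last _) = y)
    (hx' : obAt s t 0 = x) (hy' : obAt s t (Fin.last _) = y) :
    eval s (sMap f ≫ t) d hx hy =
      eval s t ((cubeNerve.map (toCube.map f)).app k d) hx' hy' := by
  subst hx' hy'
  obtain ⟨L, hL, h0, h1⟩ := exists_development_eval s t
    ((cubeNerve.map (toCube.map f)).app k d) (F := obAt s t) fun _ => rfl
  rw [← h1]
  have h := (hL.pullback (p := sMap f) (φ := vert f) (vtx_app f) (d := d)
    (fun l v hv => by rw [verts_map]; exact ⟨v, hv, rfl⟩)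
    (fun l v hv _ _ _ _ => by rw [verts_map] at hv; exact hv)
    (obAt_comp (vtx_app f) t)).last_eq fun j hj => joints_subset_verts d 0 hj
  have key : ∀ w w' (hw : vert f 0 = w) (hw' : vert f (Fin.last _) = w')
      (hx : obAt s (sMap f ≫ t) 0 = obAt s t w)
      (hy : obAt s (sMap f ≫ t) (Fin.last _) = obAt s t w'),
      L w' = Simp.comp (L w) (eval s (sMap f ≫ t) d hx hy) := by
    rintro _ _ rfl rfl _ _
    exact h
  rw [key 0 (Fin.last _) (vert_zero f) (vert_last f) hx hy, h0, Simp.ident_comp]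

/-- Concatenation of flags is sent to composition: restricting a development of the concatenation to
the two parts gives developments, the second of which starts where the first one ends. -/
theorem eval_wedge {t : T.toSSet ⟶ S} {t' : U.toSSet ⟶ S} {r : (T.wedge U).toSSet ⟶ S}
    (hl : inl T U ≫ r = t) (hr : inr T U ≫ r = t')
    (d : (cubeNerve.{u}.obj (toCube.obj U)).obj k) {x y z : C}
    (hx : obAt s r 0 = x) (hz : obAt s r (Fin.last _) = z)
    (hx' : obAt s t 0 = x) (hy : obAt s t (Fin.last _) = y)
    (hy' : obAt s t' 0 = y) (hz' : obAt s t' (Fin.last _) = z) :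
    eval s r ((cubeNerve.map (wedgeCube T U).hom).app k (cubeNerve.pair c d)) hx hz =
      Simp.comp (eval s t c hx' hy) (eval s t' d hy' hz') := by
  subst hl hr hx hz
  obtain ⟨L, hL, h0, h1⟩ := exists_development_eval s r
    ((cubeNerve.map (wedgeCube T U).hom).app k (cubeNerve.pair c d)) (F := obAt s r) fun _ => rfl
  have hvl {k : SimplexCategoryᵒᵖ} (x : T.toSSet.obj k) (i) :
      vtx ((inl T U).app k x) i = inlV T U (vtx x i) := rfl
  have hvr {k : SimplexCategoryᵒᵖ} (x : U.toSSet.obj k) (i) :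
      vtx ((inr T U).app k x) i = inrV T U (vtx x i) := rfl
  have el := (hL.pullback (p := inl T U) (φ := inlV T U) hvl (d := c)
    (fun l v hv => by rw [verts_wedge]; exact Or.inl ⟨v, hv, rfl⟩)
    (fun l v hv a b _ h' => by
      rw [verts_wedge] at hv
      rcases hv with hv | ⟨w, -, rfl⟩
      · exact hv
      · exact absurd h' (inlV_le_inrV _ _).not_gt)
    (obAt_comp hvl r)).last_eq fun j hj => joints_subset_verts c 0 hj
  have er := (hL.pullback (p := inr T U) (φ := inrV T U) hvr (d := d)
    (fun l v hv => by rw [verts_wedge]; exact Or.inr ⟨v, hv, rfl⟩)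
    (fun l v hv a b h' _ => by
      rw [verts_wedge] at hv
      rcases hv with ⟨w, -, rfl⟩ | hv
      · exact absurd h' (inlV_le_inrV _ _).not_gt
      · exact hv)
    (obAt_comp hvr r)).last_eq fun j hj => joints_subset_verts d 0 hj
  obtain rfl : obAt s r (inrV T U 0) = y := (obAt_comp hvr r 0).symm.trans hy'
  rw [← h1]
  refine er.trans (congrArg (fun f => Simp.comp f (eval s (inr T U ≫ r) d hy' hz')) ?_)
  refine el.trans ?_
  exact (congrArg (fun f => Simp.comp f (eval s (inl T U ≫ r) c hx' hy)) h0).trans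
    (Simp.ident_comp _)

theorem eval_act (θ : k ⟶ k') {x y : C} (hx : obAt s t 0 = x)
    (hy : obAt s t (Fin.last _) = y) :
    eval s t ((cubeNerve.obj (toCube.obj T)).map θ c) hx hy = Simp.act θ (eval s t c hx hy) := by
  subst hx hy
  obtain ⟨L, hL, h0, h1⟩ := exists_development_eval s t c (F := obAt s t) fun _ => rfl
  have h : IsDevelopment s t ((cubeNerve.obj (toCube.obj T)).map θ c) (fun _ => rfl) (verts c 0)
      fun v => Simp.act θ (L v) := fun a b hab hj ha => by
    beta_reduce
    rw [hL a b hab hj ha, Simp.act_comp]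
    refine congrArg (Simp.comp _) ((gen_act θ _ _ _).symm.trans ?_)
    exact congrArg (gen s _ _ _) (PathFlag.ext fun l v => Iff.rfl)
  rw [← h1, h.last_eq fun j hj => joints_subset_verts c 0 hj, h0, Simp.act_ident, Simp.ident_comp]

/-- The composite of the pieces of a flag in a necklace with a single bead is its only piece. -/
theorem eval_single (h : ∀ j ∈ T.joints, j ≤ 0 ∨ Fin.last _ ≤ j) {x y : C}
    (hx : obAt s t 0 = x) (hy : obAt s t (Fin.last _) = y) : eval s t c hx hy =
      gen s (t.app _ (clamp T 0 (Fin.last _) (Fin.zero_le _) h))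
        ((leg_obj_clamp s t (Fin.zero_le _) h 0 le_rfl (Fin.zero_le _)).trans hx)
        ((leg_obj_clamp s t (Fin.zero_le _) h (Fin.last _) (Fin.zero_le _) le_rfl).trans hy)
        (PathFlag.ofFlag ⦋T.dim⦌ 0 (Fin.last _) (Fin.zero_le _) (verts c) (verts_mono c)) := by
  subst hx hy
  obtain ⟨L, hL, h0, h1⟩ := exists_development_eval s t c (F := obAt s t) fun _ => rfl
  rw [← h1, hL 0 _ (Fin.zero_le _) h (joints_subset_verts c 0 T.zero_mem), h0, Simp.ident_comp]
  rfl

theorem eval_point {t : point.{u}.toSSet ⟶ S} {c : (cubeNerve.{u}.obj (toCube.obj point)).obj k}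
    {x : C} (hx : obAt s t 0 = x) (hx' : obAt s t (Fin.last _) = x) :
    eval s t c hx hx' = Simp.ident k x := by
  subst hx
  obtain ⟨L, hL, h0, h1⟩ := exists_development_eval s t c (F := obAt s t) fun _ => rfl
  exact h1.symm.trans h0

end SimplexFamily

/-! ### The universal property -/

namespace SimplexFamily
open Necklace
variable {S : SSet.{u}} {C : Type u} [EnrichedCategory SSet.{u} C] (s : SimplexFamily S C)
  {m n : SimplexCategory} {k k' : SimplexCategoryᵒᵖ} {T U V : Necklace.{u}}

theorem obAt_zero {x y : S _⦋0⦌} (t : incl.obj T ⟶ ⟨S, x, y⟩) : obAt s t.map 0 = ob s x :=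
  congrArg (ob s) t.map_src

theorem obAt_last {x y : S _⦋0⦌} (t : incl.obj T ⟶ ⟨S, x, y⟩) :
    obAt s t.map (Fin.last _) = ob s y := congrArg (ob s) t.map_tgt

/-- The map on simplices of mapping spaces induced by a family of functors. -/
noncomputable def descCell {x y : S _⦋0⦌} (a : FlagCell S k x y) :
    Simp.Hom.{u} k (ob s x) (ob s y) :=
  FlagCell.lift (fun _ t c => eval s t.map c (obAt_zero s t) (obAt_last s t))
    (fun _ _ f t c => eval_map (t := t.map) f c _ _ _ _) a

theorem descCell_mk {x y : S _⦋0⦌} (t : incl.obj T ⟶ ⟨S, x, y⟩)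
    (c : (cubeNerve.{u}.obj (toCube.obj T)).obj k) :
    descCell s (FlagCell.mk t c) = eval s t.map c (obAt_zero s t) (obAt_last s t) :=
  FlagCell.lift_mk _ _ _ _

theorem descCell_act {x y : S _⦋0⦌} (θ : k ⟶ k') (a : FlagCell S k x y) :
    descCell s (Simp.act (C := triRig.obj S) (X := x) (Y := y) θ a) =
      Simp.act θ (descCell s a) := by
  obtain ⟨T, t, c, rfl⟩ := FlagCell.exists_mk a
  exact (congrArg (descCell s) (FlagCell.act_mk θ t c)).trans ((descCell_mk s _ _).trans
    ((eval_act θ _ _).trans (congrArg (Simp.act θ) (descCell_mk s t c).symm)))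

theorem descCell_ident (x : S _⦋0⦌) :
    descCell s (Simp.ident (C := triRig.obj S) k x) = Simp.ident k (ob s x) :=
  (congrArg (descCell s) (FlagCell.ident_eq x (point.ofFlag (fun _ => ∅) fun _ _ _ => le_rfl))).trans
    ((descCell_mk s _ _).trans (eval_point _ _))

theorem descCell_comp {x y z : S _⦋0⦌} (a : FlagCell S k x y) (b : FlagCell S k y z) :
    descCell s (Simp.comp (C := triRig.obj S) (X := x) (Y := y) (Z := z) a b) =
      Simp.comp (descCell s a) (descCell s b) := by
  obtain ⟨T, t, c, rfl⟩ := FlagCell.exists_mk a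
  obtain ⟨U, r, d, rfl⟩ := FlagCell.exists_mk b
  refine (congrArg (descCell s) (FlagCell.comp_mk t c r d)).trans ((descCell_mk s _ _).trans ?_)
  rw [descCell_mk, descCell_mk]
  exact eval_wedge (inl_join t r) (inr_join t r) d _ _ (obAt_zero s t) (obAt_last s t)
    (obAt_zero s r) (obAt_last s r)

/-- The simplicial functor out of the triangulation of the cubical rigidification of `S` induced by
a compatible family of simplicial functors `𝔠(Δⁿ) ⟶ C`. -/
noncomputable def desc : EnrichedFunctor SSet.{u} (triRig.{u}.obj S) C where
  obj x := ob s x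
  map x y :=
    { app := fun k => ↾fun a : FlagCell S k x y => descCell s a
      naturality := fun k k' θ => by
        ext a
        exact descCell_act s θ a }
  map_id x := by
    ext k a
    exact descCell_ident s x
  map_comp x y z := by
    ext k ⟨a, b⟩
    exact descCell_comp s (x := x) (y := y) (z := z) a b

end SimplexFamily

/-- The functor from `𝔠(Δⁿ)` to the triangulation of the cubical rigidification of `S` given by an
`n`-simplex of `S`. -/
noncomputable def simplexLeg {S : SSet.{u}} {n : SimplexCategory} (σ : S.obj (op n)) :
    EnrichedFunctor SSet.{u} (thickening.{u}.obj n) (triRig.{u}.obj S) :=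
  (thickeningUnitApp n).comp SSet.{u} (Colim.fn (triRig.map (SSet.yonedaEquiv.symm σ)))

section
open Necklace SimplexFamily
variable {S : SSet.{u}} {n : SimplexCategory} {k : SimplexCategoryᵒᵖ} {T : Necklace.{u}}

theorem mem_verts_ofFlag_verts {c : (cubeNerve.{u}.obj (toCube.obj T)).obj k} {l}
    {v : Fin (T.dim + 1)} : v ∈ PathFlag.verts (PathFlag.ofFlag.{u} ⦋T.dim⦌ 0 (Fin.last _)
      (Fin.zero_le _) (verts c) (verts_mono c)) l ↔ v ∈ verts c l := by
  constructor
  · rintro (rfl | rfl | h)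
    exacts [joints_subset_verts c l T.zero_mem, joints_subset_verts c l T.last_mem, h.1]
  · exact fun h => Or.inr (Or.inr ⟨h, Fin.zero_le _, Fin.le_last _⟩)

theorem bead_joints {d : ℕ} : ∀ j ∈ (bead.{u} d).joints, j ≤ 0 ∨ Fin.last _ ≤ j := fun _ h =>
  (mem_bead_joints.1 h).imp (fun h => h.le) fun h => h.ge

/-- The functor induced by a family restricts to the members of the family. -/
theorem simplexLeg_desc {C : Type u} [EnrichedCategory SSet.{u} C] (s : SimplexFamily S C)
    (σ : S.obj (op n)) : (simplexLeg σ).comp SSet.{u} s.desc = s.leg σ := by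
  have hob (i : Fin (n.len + 1)) : (s.leg σ).obj (thickVertex n i) =
      ob s ((SSet.yonedaEquiv.symm σ).app _ (simplexVertex n i)) := leg_obj s σ i
  refine enrichedFunctor_ext (fun i => (hob (SimplicialThickening.as i).down).symm) fun i j => ?_
  refine Simp.heq_of_app (hob _).symm (hob _).symm fun k P => ?_
  change PathFlag.{u} n k (SimplicialThickening.as i).down (SimplicialThickening.as j).down at P
  refine HEq.trans (heq_of_eq ?_) (gen_heq (hob _) (hob _) P)
  refine (congrArg (descCell s) (FlagCell.fmap_mk (SSet.yonedaEquiv.symm σ)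
    (interval _ _ P.le) _)).trans ((descCell_mk s _ _).trans
      ((eval_single bead_joints _ _).trans ?_))
  symm
  let θ : ⦋((SimplicialThickening.as j).down - (SimplicialThickening.as i).down : ℕ)⦌ ⟶ n :=
    SimplexCategory.Hom.mk (shift.{u} _ _ P.le)
  refine gen_eq_gen θ ?_ (shift_zero.{u} _ _ P.le) (shift_last.{u} _ _ P.le) (fun l => ?_) _ _ _ _
  · refine congrArg ((SSet.yonedaEquiv.symm σ).app _) (a₁ := SSet.stdSimplex.objEquiv.symm θ)
      (simplexVtx_ext fun v => ?_)
    exact congrArg (shift.{u} _ _ P.le) ((vtx_clamp (Fin.zero_le _) bead_joints v).trans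
      ((max_eq_right (Fin.zero_le _)).trans (min_eq_left (Fin.le_last _)))).symm
  · rw [← FlagCell.image_ofPath P l]
    exact congrArg _ (Set.ext fun v => mem_verts_ofFlag_verts.symm)

/-- Every flag in a necklace is the composite of its part before the last bead and its part in the
last bead. -/
theorem FlagCell.exists_eq_comp {x y : S _⦋0⦌} (t : incl.obj T ⟶ ⟨S, x, y⟩)
    (c : (cubeNerve.{u}.obj (toCube.obj T)).obj k) (hT : T.dim ≠ 0) :
    ∃ (z : S _⦋0⦌) (R : Necklace.{u}) (r : incl.obj R ⟶ ⟨S, x, z⟩)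
      (c₁ : (cubeNerve.{u}.obj (toCube.obj R)).obj k) (d : ℕ)
      (b : incl.obj (bead.{u} d) ⟶ ⟨S, z, y⟩)
      (c₂ : (cubeNerve.{u}.obj (toCube.obj (bead.{u} d))).obj k), R.dim < T.dim ∧
        mk t c = Simp.comp (C := triRig.obj S) (X := x) (Y := z) (Z := y) (mk r c₁) (mk b c₂) := by
  obtain ⟨a, ha, hlt, haj⟩ := exists_prevJoint T (Fin.last _) fun h => hT (congrArg Fin.val h)
  have hlt : (a : ℕ) < T.dim := hlt
  -- `R` consists of all beads of `T` but the last, and `f : R ∨ B ⟶ T` is the identity on vertices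
  let R : Necklace.{u} :=
    { dim := a
      joints := Finset.univ.filter fun v => (⟨v, by omega⟩ : Fin (T.dim + 1)) ∈ T.joints
      zero_mem := Finset.mem_filter.2 ⟨Finset.mem_univ _, T.zero_mem⟩
      last_mem := Finset.mem_filter.2 ⟨Finset.mem_univ _, ha⟩ }
  have hR (v : Fin (R.dim + 1)) : v ∈ R.joints ↔
      (⟨v, by have := v.2; change _ < (a : ℕ) + 1 at this; omega⟩ : Fin (T.dim + 1)) ∈ T.joints :=
    Finset.mem_filter.trans (and_iff_right (Finset.mem_univ _))
  let B : Necklace.{u} := bead (T.dim - a)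
  have hdim : (R.wedge B).dim = T.dim := Nat.add_sub_cancel' hlt.le
  let g : Fin ((R.wedge B).dim + 1) →o Fin (T.dim + 1) :=
    ⟨fun v => ⟨v, by have := v.2; omega⟩, fun _ _ h => h⟩
  have g0 : g 0 = 0 := rfl
  have g1 : g (Fin.last _) = Fin.last _ := Fin.ext hdim
  have gr : g (inrV R B (Fin.last _)) = Fin.last _ := g1
  have g2 : g (inrV R B 0) = a := rfl
  let f : R.wedge B ⟶ T := homMk g g0 g1 fun j hj => by
    rcases haj j hj with h | h
    · have h : (j : ℕ) ≤ a := h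
      exact ⟨inlV R B ⟨j, Nat.lt_succ_of_le h⟩, inlV_mem.2 ((hR _).2 hj), rfl⟩
    · obtain rfl := Fin.last_le_iff.1 h
      exact ⟨_, (R.wedge B).last_mem, g1⟩
  have hf : vert f = g := vert_homMk _ _ _ _
  let r : incl.obj R ⟶ ⟨S, x, t.map.app _ (T.const _ a)⟩ :=
    { map := inl R B ≫ sMap f ≫ t.map
      map_src := (congrArg (t.map.app _) (simplex_ext fun i => (vtx_app f _ i).trans
        (by change vert f 0 = 0; rw [vert_zero]))).trans t.map_src
      map_tgt := congrArg (t.map.app _) (simplex_ext fun i => (vtx_app f _ i).trans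
        (by change vert f (inlV R B (Fin.last _)) = a; rw [hf]; exact g2)) }
  let b : incl.obj B ⟶ ⟨S, t.map.app _ (T.const _ a), y⟩ :=
    { map := inr R B ≫ sMap f ≫ t.map
      map_src := congrArg (t.map.app _) (simplex_ext fun i => (vtx_app f _ i).trans
        (by change vert f (inrV R B 0) = a; rw [hf]; exact g2))
      map_tgt := (congrArg (t.map.app _) (simplex_ext fun i => (vtx_app f _ i).trans
        (by change vert f (inrV R B (Fin.last _)) = Fin.last _; rw [hf]; exact gr))).trans
          t.map_tgt }
  have hj : join r b = incl.map f ≫ t := join_ext (inl_join r b) (inr_join r b)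
  let c₁ : (cubeNerve.{u}.obj (toCube.obj R)).obj k :=
    R.ofFlag (fun l => (fun v => g (inlV R B v)) ⁻¹' verts c l) fun _ _ h =>
      Set.preimage_mono (verts_mono c h)
  let c₂ : (cubeNerve.{u}.obj (toCube.obj B)).obj k :=
    B.ofFlag (fun l => (fun v => g (inrV R B v)) ⁻¹' verts c l) fun _ _ h =>
      Set.preimage_mono (verts_mono c h)
  refine ⟨_, R, r, c₁, _, b, c₂, hlt, ?_⟩
  refine Eq.trans ?_ (comp_mk r c₁ b c₂).symm
  rw [hj, mk_comp]
  refine congrArg (mk t) (verts_ext fun l v => ?_)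
  rw [verts_map, verts_wedge, hf]
  constructor
  · intro hv
    rcases inl_or_inr (⟨v, by have := v.2; omega⟩ : Fin ((R.wedge B).dim + 1)) with ⟨w, hw⟩ | ⟨w, hw⟩
    · have hw : g (inlV R B w) = v := congrArg g hw
      exact ⟨inlV R B w, Or.inl ⟨w, mem_verts_ofFlag.2 (Or.inr
        ((congrArg (· ∈ verts c l) hw).mpr hv)), rfl⟩, hw⟩
    · have hw : g (inrV R B w) = v := congrArg g hw
      exact ⟨inrV R B w, Or.inr ⟨w, mem_verts_ofFlag.2 (Or.inr
        ((congrArg (· ∈ verts c l) hw).mpr hv)), rfl⟩, hw⟩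
  · rintro ⟨_, ⟨w, hw, rfl⟩ | ⟨w, hw, rfl⟩, rfl⟩
    · rcases mem_verts_ofFlag.1 hw with h | h
      · exact joints_subset_verts c l ((hR w).1 h)
      · exact h
    · rcases mem_verts_ofFlag.1 hw with h | h
      · rcases mem_bead_joints.1 h with rfl | rfl
        · exact (congrArg (· ∈ verts c l) g2).mpr (joints_subset_verts c l ha)
        · exact (congrArg (· ∈ verts c l) gr).mpr (joints_subset_verts c l T.last_mem)
      · exact h

theorem FlagCell.mk_heq {x x' y y' : S _⦋0⦌} (hx : x = x') (hy : y = y')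
    {t : incl.obj T ⟶ ⟨S, x, y⟩} {t' : incl.obj T ⟶ ⟨S, x', y'⟩} (h : t.map = t'.map)
    (c : (cubeNerve.{u}.obj (toCube.obj T)).obj k) : HEq (mk t c) (mk t' c) := by
  subst hx hy
  rw [BipointedSSet.Hom.ext h]

/-- Flags in a bead come from the thickened simplices. -/
theorem FlagCell.exists_eq_simplexLeg {x y : S _⦋0⦌} {d : ℕ}
    (b : incl.obj (bead.{u} d) ⟶ ⟨S, x, y⟩)
    (c : (cubeNerve.{u}.obj (toCube.obj (bead.{u} d))).obj k) :
    ∃ (σ : S.obj (op ⦋d⦌)) (P : PathFlag.{u} ⦋d⦌ k 0 (Fin.last _)),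
      (simplexLeg σ).obj (thickVertex ⦋d⦌ 0) = x ∧
        (simplexLeg σ).obj (thickVertex ⦋d⦌ (Fin.last _)) = y ∧
          HEq (Simp.fmap (simplexLeg σ) P) (mk b c) := by
  let B : Necklace.{u} := bead d
  -- the nondegenerate simplex of maximal dimension of the bead
  let τ : B.toSSet.obj (op ⦋d⦌) := ofVtx OrderHom.id fun j hj => by
    rcases mem_bead_joints.1 hj with rfl | rfl
    · exact Or.inr fun _ => Fin.zero_le _
    · exact Or.inl fun _ => Fin.le_last _
  let σ : S.obj (op ⦋d⦌) := b.map.app _ τ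
  let P : PathFlag.{u} ⦋d⦌ k 0 (Fin.last _) :=
    PathFlag.ofFlag ⦋B.dim⦌ 0 (Fin.last _) (Fin.zero_le _) (verts c) (verts_mono c)
  let β := overMk (n := ⦋d⦌) B OrderHom.id (i := 0) (j := Fin.last _) rfl rfl
  have hP : ofPath P = mk β c := ofPath_eq_mk P fun l => by
    refine (Set.ext fun v => mem_verts_ofFlag_verts).trans (Set.image_id _).symm
  have hσ : β.map ≫ SSet.yonedaEquiv.symm σ = b.map := by
    ext k z
    refine (ConcreteCategory.congr_hom (b.map.naturality (SSet.stdSimplex.objEquiv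
      (β.map.app k z)).op) τ).symm.trans (congrArg (b.map.app k) ?_)
    exact simplex_ext fun i => rfl
  have hx : (SSet.yonedaEquiv.symm σ).app _ (simplexVertex ⦋d⦌ 0) = x := by
    refine Eq.trans ?_ b.map_src
    rw [← hσ]
    exact congrArg ((SSet.yonedaEquiv.symm σ).app _) β.map_src.symm
  have hy : (SSet.yonedaEquiv.symm σ).app _ (simplexVertex ⦋d⦌ (Fin.last _)) = y := by
    refine Eq.trans ?_ b.map_tgt
    rw [← hσ]
    exact congrArg ((SSet.yonedaEquiv.symm σ).app _) β.map_tgt.symm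
  refine ⟨σ, P, hx, hy, ?_⟩
  refine HEq.trans (heq_of_eq ?_) (mk_heq (t := β ≫ mappingSpace.bip (SSet.yonedaEquiv.symm σ)
    (simplexVertex ⦋d⦌ 0) (simplexVertex ⦋d⦌ (Fin.last _))) hx hy hσ c)
  refine Eq.trans ?_ (fmap_mk (SSet.yonedaEquiv.symm σ) β c)
  rw [← hP]
  rfl

/-- A simplicial functor out of the triangulation of the cubical rigidification of `S` is determined
by its restrictions along the simplices of `S`. -/
theorem triRig_hom_ext {C : Type u} [EnrichedCategory SSet.{u} C]
    {G H : EnrichedFunctor SSet.{u} (triRig.{u}.obj S) C}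
    (h : ∀ {n : SimplexCategory} (σ : S.obj (op n)),
      (simplexLeg σ).comp SSet.{u} G = (simplexLeg σ).comp SSet.{u} H) : G = H := by
  have hob (x : S _⦋0⦌) : G.obj x = H.obj x := by
    have h1 := congrArg (fun F => EnrichedFunctor.obj F (thickVertex ⦋0⦌ 0)) (h x)
    have h2 : (simplexLeg x).obj (thickVertex ⦋0⦌ 0) = x := by
      change S.map (SimplexCategory.const ⦋0⦌ ⦋0⦌ 0).op x = x
      rw [SimplexCategory.const_eq_id]
      exact ConcreteCategory.congr_hom (S.map_id (op ⦋0⦌)) x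
    change G.obj ((simplexLeg x).obj (thickVertex ⦋0⦌ 0)) =
      H.obj ((simplexLeg x).obj (thickVertex ⦋0⦌ 0)) at h1
    rwa [h2] at h1
  have hbead {k} {x y : S _⦋0⦌} {d : ℕ} (b : incl.obj (bead.{u} d) ⟶ ⟨S, x, y⟩)
      (c : (cubeNerve.{u}.obj (toCube.obj (bead.{u} d))).obj k) :
      HEq (Simp.fmap G (X := x) (Y := y) (FlagCell.mk b c))
        (Simp.fmap H (X := x) (Y := y) (FlagCell.mk b c)) := by
    obtain ⟨σ, P, hx, hy, hP⟩ := FlagCell.exists_eq_simplexLeg b c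
    generalize FlagCell.mk b c = a at hP
    subst hx hy
    obtain rfl := eq_of_heq hP
    exact Simp.fmap_congr (h σ) P
  have main {k} (N : ℕ) : ∀ (T : Necklace.{u}), T.dim = N → ∀ {x y : S _⦋0⦌}
      (t : incl.obj T ⟶ ⟨S, x, y⟩) (c : (cubeNerve.{u}.obj (toCube.obj T)).obj k),
      HEq (Simp.fmap G (X := x) (Y := y) (FlagCell.mk t c))
        (Simp.fmap H (X := x) (Y := y) (FlagCell.mk t c)) := by
    induction N using Nat.strong_induction_on with
    | _ N ih =>
    intro T hN x y t c
    by_cases hT : T.dim = 0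
    · obtain rfl : T = bead 0 := eq_of_joints hT fun n => by
        constructor
        · rintro ⟨v, -, rfl⟩
          exact ⟨0, (bead 0).zero_mem, by have := v.2; simp; omega⟩
        · rintro ⟨v, -, rfl⟩
          exact ⟨0, T.zero_mem, by have : (v : ℕ) < 1 := v.2; simp; omega⟩
      exact hbead t c
    · obtain ⟨z, R, r, c₁, d, b, c₂, hlt, e⟩ := FlagCell.exists_eq_comp t c hT
      rw [e]
      refine HEq.trans (heq_of_eq (Simp.fmap_comp G (X := x) (Y := z) (Z := y) (FlagCell.mk r c₁)
        (FlagCell.mk b c₂))) (HEq.trans ?_ (heq_of_eq (Simp.fmap_comp H (X := x) (Y := z) (Z := y)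
          (FlagCell.mk r c₁) (FlagCell.mk b c₂))).symm)
      exact Simp.comp_heq (hob x) (hob z) (hob y) (ih _ (hN ▸ hlt) R rfl r c₁) (hbead b c₂)
  refine enrichedFunctor_ext hob fun x y => Simp.heq_of_app (hob x) (hob y) fun k a => ?_
  obtain ⟨T, t, c, rfl⟩ := FlagCell.exists_mk (S := S) (x := x) (y := y) a
  exact main _ T rfl t c

end

/-! ### The comparison -/

/-- The standard simplices, with the type of a functor rather than that of a cosimplicial object, as
is needed to find the category structure on its comma categories. -/
def simplexInclusion : SimplexCategory ⥤ SSet.{u} := SSet.stdSimplex.{u}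

/-- The triangulation of the cubical rigidification with the canonical maps from the thickened
simplices, as an extension along the inclusion of the standard simplices. -/
noncomputable def triRigExtension : simplexInclusion.{u}.LeftExtension thickening.{u} :=
  Functor.LeftExtension.mk triRig.{u} thickeningUnit.{u}

/-- The family of simplicial functors given by a cocone under the thickened simplices of `S`. -/
noncomputable def familyOfCocone {S : SSet.{u}} (c : Cocone (CostructuredArrow.proj
    simplexInclusion.{u} S ⋙ thickening.{u})) :
    SimplexFamily S c.pt where
  leg σ := c.ι.app (CostructuredArrow.mk (S := simplexInclusion.{u}) (SSet.yonedaEquiv.symm σ))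
  leg_map θ σ := c.w (show
    CostructuredArrow.mk (S := simplexInclusion.{u}) (SSet.yonedaEquiv.symm (S.map θ.op σ)) ⟶
      CostructuredArrow.mk (S := simplexInclusion.{u}) (SSet.yonedaEquiv.symm σ) from
    CostructuredArrow.homMk θ (uliftYonedaEquiv_symm_map θ.op σ).symm)

/-- The triangulation of the cubical rigidification is a pointwise left Kan extension. -/
noncomputable def triRigIsPointwise :
    triRigExtension.{u}.IsPointwiseLeftKanExtension := fun S =>
  { desc := fun c => (familyOfCocone c).desc
    fac := fun c j => by
      obtain ⟨n, ⟨⟨⟩⟩, f⟩ := j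
      obtain ⟨σ, rfl⟩ := SSet.yonedaEquiv.symm.surjective f
      exact simplexLeg_desc (familyOfCocone c) σ
    uniq := fun c m hm => triRig_hom_ext fun σ =>
      (hm (CostructuredArrow.mk (S := simplexInclusion.{u}) (SSet.yonedaEquiv.symm σ))).trans
        (simplexLeg_desc (familyOfCocone c) σ).symm }

end CubicalRigidification

theorem proposition5p3 :
    Nonempty (CategoryTheory.Iso CubicalRigidification.rigidification.{u}
      (CategoryTheory.Functor.comp CubicalRigidification.cubicalRigidification.{u}
        CubicalRigidification.triangulateCat.{u})) :=
  ⟨(CategoryTheory.StructuredArrow.proj _ _).mapIso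
    ((CategoryTheory.Functor.pointwiseLeftKanExtensionIsUniversal _ _).uniqueUpToIso
      CubicalRigidification.triRigIsPointwise.isUniversal)⟩
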